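/- **Language.** Let $V_P=\{x_0,x_1,\dots\}$ (propositional variables) and $V_J=\{v_0,v_1,\dots\}$ (justification variables) be ordered by their indices, put $V=V_P\cup V_J$, and let $C$, $D$ be arbitrary sets of justification constants and of propositional constants, all these sets being pairwise disjoint. The set $Tm(C)$ of justification terms is generated from $V_J\cup C$ by $(s\cdot t)$ and $(s+t)$. The set $Fm(C,D)$ of formulas is generated from $V_P\cup D$ by $\varphi\to\psi$, $\neg\varphi$, $\varphi\equiv\psi$, $\varphi<\psi$, $s\equiv t$, $s\le t$, $\varphi:true$, $\varphi:false$, $\square\varphi$, $\varphi:t$, and by $\forall x.\varphi$ and $\bigwedge u.\varphi$ with $x\in V_P$ free in $\varphi$, respectively $u\in V_J$ free in $\varphi$ (no vacuous quantification). Here $s,t\in Tm(C)$. The symbols $\wedge,\leftrightarrow,\exists x,\bigvee u$ are the usual abbreviations; $fvar_P$, $fvar_J$ denote the sets of free propositional and justification variables, and $fvar=fvar_P\cup fvar_J$. A substitution $\sigma$ maps $V_P\cup D$ to formulas and $V_J\cup C$ to terms; it extends to terms and formulas by commuting with all operations, and $(\bigwedge u.\varphi)[\sigma]=\bigwedge v.\varphi[\sigma[u:=v]]$,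 where $v$ is the least justification variable greater than all free justification variables of the expressions $\sigma(z)$, $z$ a free variable or constant of $\bigwedge u.\varphi$; likewise for $\forall x$ with propositional variables. We write $\sigma:V\to Fm(C,D)\cup Tm(C)$ if $\sigma$ fixes all constants; $[x:=\psi]$ and $[u:=t]$ change the identity substitution at one variable. Alpha-congruence $=_\alpha$ is the smallest equivalence relation on formulas compatible with $\to,\equiv,<,\neg,\square,{:}true,{:}false$ and ${:}t$ such that $\bigwedge u.\varphi=_\alpha\bigwedge v.\psi$ whenever $\varphi=_\alpha\psi[v:=u]$ and ($v\ne u$ implies $u\notin fvar_J(\psi)$), and likewise for $\forall$. Put $\varphi\prec\psi$ iff there are $x\in V_P$ and a formula $\psi'\neq x$ with $x\in fvar_P(\psi')$ and $\psi'[x:=\varphi]=_\alpha\psi$. For $\sigma,\sigma':V\to Fm(C,D)\cup Tm(C)$, $\sigma\equiv_\varphi\sigma'$ is the conjunction of the equations $\sigma(z)\equiv\sigma'(z)$ over $z\in fvar(\varphi)$, and $\sigma\equiv_t\sigma'$ is the one over the variables $z$ of $t$; an empty conjunction standing as a premise is omitted. **Deductive system.** The set of axioms $Ax+(4)$ is the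 smallest set of formulas that contains all classical propositional tautologies and all formulas of the forms 1. $\varphi:true\leftrightarrow\varphi$; 2. $\varphi:false\leftrightarrow\neg\varphi$; 3. $(\varphi\to\psi):s\to(\varphi:t\to\psi:(s\cdot t))$; 4. $\varphi:s\to\varphi:(s+t)$; 5. $\varphi:t\to\varphi:(s+t)$; 6. $\square\varphi\leftrightarrow\bigvee u.(\varphi:u)$, if $u\notin fvar_J(\varphi)$; 7. $\square\varphi\to\varphi$; 8. $\varphi<\psi$, if $\varphi\prec\psi$; 9. $(\varphi<\psi)\to((\psi<\chi)\to(\varphi<\chi))$; 10. $\varphi\equiv\psi$, if $\varphi=_\alpha\psi$; 11. $(\varphi\equiv\psi)\to(\varphi\to\psi)$; 12. $(\sigma\equiv_\varphi\sigma')\to(\varphi[\sigma]\equiv\varphi[\sigma'])$; 13. $\varphi[u:=t]\to\bigvee u.\varphi$; 14. $\bigwedge u.\varphi\to\varphi[u:=t]$; 15. $\bigwedge u.(\psi\to\varphi)\to(\bigwedge u.\psi\to\bigwedge u.\varphi)$; 16. $\bigwedge u.(\psi\to\varphi)\to(\psi\to\bigwedge u.\varphi)$, if $u\notin fvar_J(\psi)$;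 17. $\varphi[x:=\psi]\to\exists x.\varphi$; 18. $\forall x.\varphi\to\varphi[x:=\psi]$; 19. $\forall x.(\psi\to\varphi)\to(\forall x.\psi\to\forall x.\varphi)$; 20. $\forall x.(\psi\to\varphi)\to(\psi\to\forall x.\varphi)$, if $x\notin fvar_P(\psi)$; 21. $(s\le t)\leftrightarrow\forall x.(x:s\to x:t)$; 22. $(s\equiv t)\leftrightarrow(s\le t)\wedge(t\le s)$; 23. $(\sigma\equiv_t\sigma')\to(t[\sigma]\equiv t[\sigma'])$; 24. schema (4): $\square\varphi\to\square\square\varphi$; and that is closed under passing from $\varphi$ to $\bigwedge u.\varphi$ if $u\in fvar_J(\varphi)$ and to $\forall x.\varphi$ if $x\in fvar_P(\varphi)$. For $\Phi\subseteq Fm(C,D)$ write $\Phi\vdash_{(4)}\varphi$ if $\varphi$ belongs to the smallest set that contains $\Phi\cup(Ax+(4))$ and is closed under Modus Ponens. **Models.** A model consists of a set $L$ with binary operations $+,\cdot$ and a partial order $\le$; a set $M=TRUE\cup FALSE$ with $TRUE\cap FALSE=\varnothing$; sets $REASON_l\subseteq M$ ($l\in L$) such that $l\le l'\Leftrightarrow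 REASON_l\subseteq REASON_{l'}$; the set $NECESSARY=\bigcup_{l\in L}REASON_l$, which is required to satisfy $NECESSARY\subseteq TRUE$; a transitive relation $<^{\mathcal M}$ on $M$; and a function $\Gamma$ which, for each assignment $\gamma$ (mapping $V_P$ to $M$ and $V_J$ to $L$), sends formulas $\varphi$ to $\Gamma(\varphi,\gamma)\in M$ and terms $s$ to $\Gamma(s,\gamma)\in L$, such that for all formulas, terms, assignments and all $\sigma:V\to Fm(C,D)\cup Tm(C)$: - $\Gamma(z,\gamma)=\gamma(z)$ for every variable $z\in V$; $\Gamma(e,\gamma)$ depends only on the values of $\gamma$ at the free variables of the formula or term $e$; $\Gamma(e[\sigma],\gamma)=\Gamma(e,\gamma\sigma)$, where $\gamma\sigma(z)=\Gamma(\sigma(z),\gamma)$; $\varphi\prec\psi$ implies $\Gamma(\varphi,\gamma)<^{\mathcal M}\Gamma(\psi,\gamma)$; $\Gamma(s+t,\gamma)=\Gamma(s,\gamma)+\Gamma(t,\gamma)$ and $\Gamma(s\cdot t,\gamma)=\Gamma(s,\gamma)\cdot\Gamma(t,\gamma)$; - $\Gamma(\varphi\to\psi,\gamma)\in TRUE$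 iff $\Gamma(\varphi,\gamma)\in FALSE$ or $\Gamma(\psi,\gamma)\in TRUE$; $\Gamma(\neg\varphi,\gamma)\in TRUE$ iff $\Gamma(\varphi,\gamma)\notin TRUE$; $\Gamma(\varphi:true,\gamma)\in TRUE$ iff $\Gamma(\varphi,\gamma)\in TRUE$; $\Gamma(\varphi:false,\gamma)\in TRUE$ iff $\Gamma(\varphi,\gamma)\in FALSE$; - $\Gamma(\varphi\equiv\psi,\gamma)\in TRUE$ iff $\Gamma(\varphi,\gamma)=\Gamma(\psi,\gamma)$; $\Gamma(\varphi<\psi,\gamma)\in TRUE$ iff $\Gamma(\varphi,\gamma)<^{\mathcal M}\Gamma(\psi,\gamma)$; $\Gamma(s\equiv t,\gamma)\in TRUE$ iff $\Gamma(s,\gamma)=\Gamma(t,\gamma)$; $\Gamma(s\le t,\gamma)\in TRUE$ iff $\Gamma(s,\gamma)\le\Gamma(t,\gamma)$; - $\Gamma(\square\varphi,\gamma)\in TRUE$ iff $\Gamma(\varphi,\gamma)\in NECESSARY$; $\Gamma(\varphi:t,\gamma)\in TRUE$ iff $\Gamma(\varphi,\gamma)\in REASON_{\Gamma(t,\gamma)}$;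 - $\Gamma(\varphi\to\psi,\gamma)\in REASON_{\Gamma(s,\gamma)}$ and $\Gamma(\varphi,\gamma)\in REASON_{\Gamma(t,\gamma)}$ imply $\Gamma(\psi,\gamma)\in REASON_{\Gamma(s\cdot t,\gamma)}$; $\Gamma(\varphi,\gamma)\in REASON_{\Gamma(s,\gamma)}\cup REASON_{\Gamma(t,\gamma)}$ implies $\Gamma(\varphi,\gamma)\in REASON_{\Gamma(s+t,\gamma)}$; - $\Gamma(\bigwedge u.\varphi,\gamma)\in TRUE$ iff $\Gamma(\varphi,\gamma_u^l)\in TRUE$ for all $l\in L$; $\Gamma(\forall x.\varphi,\gamma)\in TRUE$ iff $\Gamma(\varphi,\gamma_x^m)\in TRUE$ for all $m\in M$, where $\gamma_z^a$ is $\gamma$ changed to the value $a$ at $z$. The model satisfies truth condition (4) if $\Gamma(\square\varphi,\gamma)\in TRUE$ implies $\Gamma(\square\square\varphi,\gamma)\in TRUE$, for all formulas $\varphi$ and all assignments $\gamma$. Write $\Phi\Vdash_{(4)}\varphi$ if, for every model with truth condition (4) and every assignment $\gamma$ of it such that $\Gamma(\psi,\gamma)\in TRUE$ for all $\psi\in\Phi$,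 also $\Gamma(\varphi,\gamma)\in TRUE$. **Corollary 680.** For all sets $C$, $D$, all $\Phi\subseteq Fm(C,D)$ and all $\varphi\in Fm(C,D)$: $$\Phi\Vdash_{(4)}\varphi\quad\Longleftrightarrow\quad\Phi\vdash_{(4)}\varphi .$$ -/

import Mathlib

universe u v w

namespace EpsJ

/-! ### Terms and formulas

Both sorts of variables are indexed by `ℕ` with its usual well-ordering; the two sorts are kept
apart by the constructors. -/

/-- Justification terms over the set `C` of justification constants. -/
inductive Tm (C : Type u) : Type u
  | var : ℕ → Tm C
  | con : C → Tm C
  | app : Tm C → Tm C → Tm C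
  | plus : Tm C → Tm C → Tm C

/-- Expressions of the formula language, where vacuous quantification is still allowed. -/
inductive PreFm (C : Type u) (D : Type v) : Type (max u v)
  | var : ℕ → PreFm C D
  | con : D → PreFm C D
  | imp : PreFm C D → PreFm C D → PreFm C D
  | neg : PreFm C D → PreFm C D
  /-- `φ ≡ ψ` -/
  | eqv : PreFm C D → PreFm C D → PreFm C D
  /-- `φ < ψ` -/
  | ref : PreFm C D → PreFm C D → PreFm C D
  /-- `s ≡ t` -/
  | teq : Tm C → Tm C → PreFm C D
  /-- `s ≤ t` -/
  | tle : Tm C → Tm C → PreFm C D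
  /-- `φ : true` -/
  | isTrue : PreFm C D → PreFm C D
  /-- `φ : false` -/
  | isFalse : PreFm C D → PreFm C D
  /-- `□ φ` -/
  | box : PreFm C D → PreFm C D
  /-- `φ : t` -/
  | just : PreFm C D → Tm C → PreFm C D
  /-- `∀ x. φ`, with `x` a propositional variable -/
  | allP : ℕ → PreFm C D → PreFm C D
  /-- `⋀ u. φ`, with `u` a justification variable -/
  | allJ : ℕ → PreFm C D → PreFm C D

noncomputable section

variable {C : Type u} {D : Type v}

/-- Variables of a justification term. -/
def Tm.vars : Tm C → Finset ℕ
  | .var i => {i}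
  | .con _ => ∅
  | .app s t => s.vars ∪ t.vars
  | .plus s t => s.vars ∪ t.vars

open Classical in
/-- Constants of a justification term. -/
def Tm.cons : Tm C → Finset C
  | .var _ => ∅
  | .con c => {c}
  | .app s t => s.cons ∪ t.cons
  | .plus s t => s.cons ∪ t.cons

namespace PreFm

/-- Free propositional variables. -/
def fvarP : PreFm C D → Finset ℕ
  | var x => {x}
  | con _ => ∅
  | imp a b => a.fvarP ∪ b.fvarP
  | neg a => a.fvarP
  | eqv a b => a.fvarP ∪ b.fvarP
  | ref a b => a.fvarP ∪ b.fvarP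
  | teq _ _ => ∅
  | tle _ _ => ∅
  | isTrue a => a.fvarP
  | isFalse a => a.fvarP
  | box a => a.fvarP
  | just a _ => a.fvarP
  | allP x a => a.fvarP.erase x
  | allJ _ a => a.fvarP

/-- Free justification variables. -/
def fvarJ : PreFm C D → Finset ℕ
  | var _ => ∅
  | con _ => ∅
  | imp a b => a.fvarJ ∪ b.fvarJ
  | neg a => a.fvarJ
  | eqv a b => a.fvarJ ∪ b.fvarJ
  | ref a b => a.fvarJ ∪ b.fvarJ
  | teq s t => s.vars ∪ t.vars
  | tle s t => s.vars ∪ t.vars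
  | isTrue a => a.fvarJ
  | isFalse a => a.fvarJ
  | box a => a.fvarJ
  | just a t => a.fvarJ ∪ t.vars
  | allP _ a => a.fvarJ
  | allJ u a => a.fvarJ.erase u

open Classical in
/-- Propositional constants. -/
def conP : PreFm C D → Finset D
  | var _ => ∅
  | con d => {d}
  | imp a b => a.conP ∪ b.conP
  | neg a => a.conP
  | eqv a b => a.conP ∪ b.conP
  | ref a b => a.conP ∪ b.conP
  | teq _ _ => ∅
  | tle _ _ => ∅
  | isTrue a => a.conP
  | isFalse a => a.conP
  | box a => a.conP
  | just a _ => a.conP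
  | allP _ a => a.conP
  | allJ _ a => a.conP

open Classical in
/-- Justification constants. -/
def conJ : PreFm C D → Finset C
  | var _ => ∅
  | con _ => ∅
  | imp a b => a.conJ ∪ b.conJ
  | neg a => a.conJ
  | eqv a b => a.conJ ∪ b.conJ
  | ref a b => a.conJ ∪ b.conJ
  | teq s t => s.cons ∪ t.cons
  | tle s t => s.cons ∪ t.cons
  | isTrue a => a.conJ
  | isFalse a => a.conJ
  | box a => a.conJ
  | just a t => a.conJ ∪ t.cons
  | allP _ a => a.conJ
  | allJ _ a => a.conJ

/-- A formula is proper if no quantifier in it is vacuous. -/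
def Proper : PreFm C D → Prop
  | var _ => True
  | con _ => True
  | imp a b => a.Proper ∧ b.Proper
  | neg a => a.Proper
  | eqv a b => a.Proper ∧ b.Proper
  | ref a b => a.Proper ∧ b.Proper
  | teq _ _ => True
  | tle _ _ => True
  | isTrue a => a.Proper
  | isFalse a => a.Proper
  | box a => a.Proper
  | just a _ => a.Proper
  | allP x a => x ∈ a.fvarP ∧ a.Proper
  | allJ u a => u ∈ a.fvarJ ∧ a.Proper

end PreFm

/-! ### Substitutions -/

/-- A substitution sends propositional variables and constants to elements of `F` (formulas), and
justification variables and constants to justification terms. -/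
@[ext]
structure SubstInto (C : Type u) (D : Type v) (F : Type w) where
  onVarP : ℕ → F
  onVarJ : ℕ → Tm C
  onConP : D → F
  onConJ : C → Tm C

/-- `σ[x := e]` for a propositional variable `x`. -/
def SubstInto.updP {F : Type w} (σ : SubstInto C D F) (x : ℕ) (e : F) : SubstInto C D F :=
  { σ with onVarP := Function.update σ.onVarP x e }

/-- `σ[u := t]` for a justification variable `u`. -/
def SubstInto.updJ {F : Type w} (σ : SubstInto C D F) (u : ℕ) (t : Tm C) : SubstInto C D F :=
  { σ with onVarJ := Function.update σ.onVarJ u t }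

/-- The least number greater than all elements of `s` (it is `0` if `s` is empty). -/
def above (s : Finset ℕ) : ℕ := s.sup Nat.succ

/-- `t[σ]` for a justification term. -/
def Tm.subst {F : Type w} (σ : SubstInto C D F) : Tm C → Tm C
  | .var i => σ.onVarJ i
  | .con c => σ.onConJ c
  | .app s t => .app (s.subst σ) (t.subst σ)
  | .plus s t => .plus (s.subst σ) (t.subst σ)

namespace PreFm

/-- The least propositional variable greater than all free propositional variables of `σ z`, for
`z` a free variable or a constant of `φ`. (Justification terms contain no propositional
variables.) -/
def forcedP (σ : SubstInto C D (PreFm C D)) (φ : PreFm C D) : ℕ :=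
  above (φ.fvarP.biUnion (fun x => (σ.onVarP x).fvarP) ∪
    φ.conP.biUnion (fun d => (σ.onConP d).fvarP))

/-- The least justification variable greater than all free justification variables of `σ z`, for
`z` a free variable or a constant of `φ`. -/
def forcedJ (σ : SubstInto C D (PreFm C D)) (φ : PreFm C D) : ℕ :=
  above ((φ.fvarP.biUnion (fun x => (σ.onVarP x).fvarJ) ∪
      φ.fvarJ.biUnion (fun u => (σ.onVarJ u).vars)) ∪
    (φ.conP.biUnion (fun d => (σ.onConP d).fvarJ) ∪
      φ.conJ.biUnion (fun c => (σ.onConJ c).vars)))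

/-- `φ[σ]`; bound variables are always renamed to the variable forced by `σ`. -/
def subst : PreFm C D → SubstInto C D (PreFm C D) → PreFm C D
  | var x, σ => σ.onVarP x
  | con d, σ => σ.onConP d
  | imp a b, σ => imp (a.subst σ) (b.subst σ)
  | neg a, σ => neg (a.subst σ)
  | eqv a b, σ => eqv (a.subst σ) (b.subst σ)
  | ref a b, σ => ref (a.subst σ) (b.subst σ)
  | teq s t, σ => teq (s.subst σ) (t.subst σ)
  | tle s t, σ => tle (s.subst σ) (t.subst σ)
  | isTrue a, σ => isTrue (a.subst σ)
  | isFalse a, σ => isFalse (a.subst σ)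
  | box a, σ => box (a.subst σ)
  | just a t, σ => just (a.subst σ) (t.subst σ)
  | allP x a, σ =>
      allP (forcedP σ (allP x a)) (a.subst (σ.updP x (var (forcedP σ (allP x a)))))
  | allJ u a, σ =>
      allJ (forcedJ σ (allJ u a)) (a.subst (σ.updJ u (.var (forcedJ σ (allJ u a)))))

end PreFm

theorem not_mem_of_above_le {s : Finset ℕ} {n : ℕ} (h : above s ≤ n) : n ∉ s := fun hn =>
  absurd (lt_of_lt_of_le (Nat.lt_succ_self n) (Finset.le_sup (f := Nat.succ) hn))
    (not_lt.mpr h)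

theorem Tm.vars_subst {F : Type w} (σ : SubstInto C D F) (t : Tm C) {u : ℕ} (hu : u ∈ t.vars) :
    (σ.onVarJ u).vars ⊆ (t.subst σ).vars := by
  induction t with
  | var i => simp only [Tm.vars, Finset.mem_singleton] at hu; subst hu; exact subset_rfl
  | con c => simp [Tm.vars] at hu
  | app s t hs ht | plus s t hs ht =>
    rcases Finset.mem_union.mp hu with h | h
    · exact (hs h).trans Finset.subset_union_left
    · exact (ht h).trans Finset.subset_union_right

namespace PreFm

theorem fvarP_subst (φ : PreFm C D) : ∀ (σ : SubstInto C D (PreFm C D)) {x : ℕ},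
    x ∈ φ.fvarP → (σ.onVarP x).fvarP ⊆ (φ.subst σ).fvarP := by
  induction φ with
  | var i =>
    intro σ x hx; simp only [fvarP, Finset.mem_singleton] at hx; subst hx; exact subset_rfl
  | con d | teq s t | tle s t => intro σ x hx; simp [fvarP] at hx
  | imp a b ha hb | eqv a b ha hb | ref a b ha hb =>
    intro σ x hx
    rcases Finset.mem_union.mp hx with h | h
    · exact (ha σ h).trans Finset.subset_union_left
    · exact (hb σ h).trans Finset.subset_union_right
  | neg a ha | isTrue a ha | isFalse a ha | box a ha | just a t ha =>
    intro σ x hx; exact ha σ hx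
  | allJ u a ha => intro σ x hx; exact ha (σ.updJ u _) hx
  | allP y a ha =>
    intro σ x hx
    have hx' := Finset.mem_erase.mp hx
    have h := ha (σ.updP y (var (forcedP σ (allP y a)))) hx'.2
    simp only [SubstInto.updP, Function.update_of_ne hx'.1] at h
    intro i hi
    refine Finset.mem_erase.mpr ⟨?_, h hi⟩
    rintro rfl
    exact not_mem_of_above_le (s := _) le_rfl
      (Finset.mem_union_left _ (Finset.mem_biUnion.mpr ⟨x, hx, hi⟩))

theorem fvarJ_subst (φ : PreFm C D) : ∀ (σ : SubstInto C D (PreFm C D)) {u : ℕ},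
    u ∈ φ.fvarJ → (σ.onVarJ u).vars ⊆ (φ.subst σ).fvarJ := by
  induction φ with
  | var i | con d => intro σ x hx; simp [fvarJ] at hx
  | teq s t | tle s t =>
    intro σ x hx
    rcases Finset.mem_union.mp hx with h | h
    · exact (s.vars_subst σ h).trans Finset.subset_union_left
    · exact (t.vars_subst σ h).trans Finset.subset_union_right
  | imp a b ha hb | eqv a b ha hb | ref a b ha hb =>
    intro σ x hx
    rcases Finset.mem_union.mp hx with h | h
    · exact (ha σ h).trans Finset.subset_union_left
    · exact (hb σ h).trans Finset.subset_union_right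
  | neg a ha | isTrue a ha | isFalse a ha | box a ha => intro σ x hx; exact ha σ hx
  | just a t ha =>
    intro σ x hx
    rcases Finset.mem_union.mp hx with h | h
    · exact (ha σ h).trans Finset.subset_union_left
    · exact (t.vars_subst σ h).trans Finset.subset_union_right
  | allP y a ha => intro σ x hx; exact ha (σ.updP y _) hx
  | allJ v a ha =>
    intro σ x hx
    have hx' := Finset.mem_erase.mp hx
    have h := ha (σ.updJ v (.var (forcedJ σ (allJ v a)))) hx'.2
    simp only [SubstInto.updJ, Function.update_of_ne hx'.1] at h
    intro i hi
    refine Finset.mem_erase.mpr ⟨?_, h hi⟩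
    rintro rfl
    exact not_mem_of_above_le (s := _) le_rfl (Finset.mem_union_left _
      (Finset.mem_union_right _ (Finset.mem_biUnion.mpr ⟨x, hx, hi⟩)))

theorem Proper.subst {φ : PreFm C D} : ∀ {σ : SubstInto C D (PreFm C D)}, φ.Proper →
    (∀ x, (σ.onVarP x).Proper) → (∀ d, (σ.onConP d).Proper) → (φ.subst σ).Proper := by
  induction φ with
  | var i => intro σ _ hv _; exact hv i
  | con d => intro σ _ _ hc; exact hc d
  | teq s t | tle s t => intro σ _ _ _; trivial
  | imp a b ha hb | eqv a b ha hb | ref a b ha hb =>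
    intro σ h hv hc; exact ⟨ha h.1 hv hc, hb h.2 hv hc⟩
  | neg a ha | isTrue a ha | isFalse a ha | box a ha | just a t ha =>
    intro σ h hv hc; exact ha (σ := σ) h hv hc
  | allP y a ha =>
    intro σ h hv hc
    refine ⟨?_, ha h.2 ?_ hc⟩
    · refine fvarP_subst a _ h.1 ?_
      simp [SubstInto.updP, fvarP]
    · intro x
      by_cases hx : x = y
      · subst hx; simp [SubstInto.updP, Proper]
      · simpa [SubstInto.updP, Function.update_of_ne hx] using hv x
  | allJ u a ha =>
    intro σ h hv hc
    refine ⟨?_, ha h.2 hv hc⟩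
    refine fvarJ_subst a _ h.1 ?_
    simp [SubstInto.updJ, Tm.vars]

end PreFm

/-! ### Proper formulas -/

/-- The set of formulas: the proper ones. -/
def Fm (C : Type u) (D : Type v) : Type (max u v) := {φ : PreFm C D // φ.Proper}

namespace Fm

def fvarP (φ : Fm C D) : Finset ℕ := φ.1.fvarP
def fvarJ (φ : Fm C D) : Finset ℕ := φ.1.fvarJ

def var (x : ℕ) : Fm C D := ⟨.var x, trivial⟩
def con (d : D) : Fm C D := ⟨.con d, trivial⟩
def imp (φ ψ : Fm C D) : Fm C D := ⟨.imp φ.1 ψ.1, φ.2, ψ.2⟩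
def neg (φ : Fm C D) : Fm C D := ⟨.neg φ.1, φ.2⟩
def eqv (φ ψ : Fm C D) : Fm C D := ⟨.eqv φ.1 ψ.1, φ.2, ψ.2⟩
def ref (φ ψ : Fm C D) : Fm C D := ⟨.ref φ.1 ψ.1, φ.2, ψ.2⟩
def teq (s t : Tm C) : Fm C D := ⟨.teq s t, trivial⟩
def tle (s t : Tm C) : Fm C D := ⟨.tle s t, trivial⟩
def isTrue (φ : Fm C D) : Fm C D := ⟨.isTrue φ.1, φ.2⟩
def isFalse (φ : Fm C D) : Fm C D := ⟨.isFalse φ.1, φ.2⟩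
def box (φ : Fm C D) : Fm C D := ⟨.box φ.1, φ.2⟩
def just (φ : Fm C D) (t : Tm C) : Fm C D := ⟨.just φ.1 t, φ.2⟩
def allP (x : ℕ) (φ : Fm C D) (h : x ∈ φ.fvarP) : Fm C D := ⟨.allP x φ.1, h, φ.2⟩
def allJ (u : ℕ) (φ : Fm C D) (h : u ∈ φ.fvarJ) : Fm C D := ⟨.allJ u φ.1, h, φ.2⟩

/-- Defined connectives and quantifiers. -/
def and (φ ψ : Fm C D) : Fm C D := neg (imp φ (neg ψ))
def iff (φ ψ : Fm C D) : Fm C D := and (imp φ ψ) (imp ψ φ)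
def exP (x : ℕ) (φ : Fm C D) (h : x ∈ φ.fvarP) : Fm C D := neg (allP x (neg φ) h)
def exJ (u : ℕ) (φ : Fm C D) (h : u ∈ φ.fvarJ) : Fm C D := neg (allJ u (neg φ) h)

end Fm

/-- Substitutions with values in the proper formulas and the justification terms. -/
abbrev Subst (C : Type u) (D : Type v) : Type (max u v) := SubstInto C D (Fm C D)

/-- The substitution that is given by `p`, `j` on the variables and fixes all constants. -/
def Subst.ofVars (p : ℕ → Fm C D) (j : ℕ → Tm C) : Subst C D :=
  ⟨p, j, Fm.con, Tm.con⟩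

/-- The identity substitution. -/
def Subst.id : Subst C D := Subst.ofVars Fm.var Tm.var

/-- `φ[σ]`. -/
def Fm.subst (φ : Fm C D) (σ : Subst C D) : Fm C D :=
  ⟨φ.1.subst ⟨fun x => (σ.onVarP x).1, σ.onVarJ, fun d => (σ.onConP d).1, σ.onConJ⟩,
    φ.2.subst (fun x => (σ.onVarP x).2) (fun d => (σ.onConP d).2)⟩

/-- `φ[x := ψ]`. -/
def Fm.substP (φ : Fm C D) (x : ℕ) (ψ : Fm C D) : Fm C D := φ.subst (Subst.id.updP x ψ)

/-- `φ[u := t]`. -/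
def Fm.substJ (φ : Fm C D) (u : ℕ) (t : Tm C) : Fm C D := φ.subst (Subst.id.updJ u t)

/-- Alpha-congruence. -/
inductive AlphaEq : Fm C D → Fm C D → Prop
  | refl (φ : Fm C D) : AlphaEq φ φ
  | symm {φ ψ : Fm C D} : AlphaEq φ ψ → AlphaEq ψ φ
  | trans {φ ψ χ : Fm C D} : AlphaEq φ ψ → AlphaEq ψ χ → AlphaEq φ χ
  | imp {φ₁ φ₂ ψ₁ ψ₂ : Fm C D} :
      AlphaEq φ₁ ψ₁ → AlphaEq φ₂ ψ₂ → AlphaEq (φ₁.imp φ₂) (ψ₁.imp ψ₂)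
  | eqv {φ₁ φ₂ ψ₁ ψ₂ : Fm C D} :
      AlphaEq φ₁ ψ₁ → AlphaEq φ₂ ψ₂ → AlphaEq (φ₁.eqv φ₂) (ψ₁.eqv ψ₂)
  | ref {φ₁ φ₂ ψ₁ ψ₂ : Fm C D} :
      AlphaEq φ₁ ψ₁ → AlphaEq φ₂ ψ₂ → AlphaEq (φ₁.ref φ₂) (ψ₁.ref ψ₂)
  | isTrue {φ ψ : Fm C D} : AlphaEq φ ψ → AlphaEq φ.isTrue ψ.isTrue
  | isFalse {φ ψ : Fm C D} : AlphaEq φ ψ → AlphaEq φ.isFalse ψ.isFalse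
  | just {φ ψ : Fm C D} (t : Tm C) : AlphaEq φ ψ → AlphaEq (φ.just t) (ψ.just t)
  | neg {φ ψ : Fm C D} : AlphaEq φ ψ → AlphaEq φ.neg ψ.neg
  | box {φ ψ : Fm C D} : AlphaEq φ ψ → AlphaEq φ.box ψ.box
  | allJ {u v : ℕ} {φ ψ : Fm C D} (hu : u ∈ φ.fvarJ) (hv : v ∈ ψ.fvarJ) :
      AlphaEq φ (ψ.substJ v (.var u)) → (v ≠ u → u ∉ ψ.fvarJ) →
      AlphaEq (.allJ u φ hu) (.allJ v ψ hv)
  | allP {x y : ℕ} {φ ψ : Fm C D} (hx : x ∈ φ.fvarP) (hy : y ∈ ψ.fvarP) :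
      AlphaEq φ (ψ.substP y (.var x)) → (y ≠ x → x ∉ ψ.fvarP) →
      AlphaEq (.allP x φ hx) (.allP y ψ hy)

/-- Syntactical reference `φ ≺ ψ`. -/
def SynRef (φ ψ : Fm C D) : Prop :=
  ∃ (x : ℕ) (ψ' : Fm C D), ψ' ≠ Fm.var x ∧ x ∈ ψ'.fvarP ∧ AlphaEq (ψ'.substP x φ) ψ

/-! ### The deductive system -/

/-- `φ` is a tautology of classical propositional logic: it is true under every valuation of the
formulas that respects implication and negation (all other formulas being atoms). -/
def Tautology (φ : Fm C D) : Prop :=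
  ∀ val : Fm C D → Prop,
    (∀ α β, val (α.imp β) ↔ (val α → val β)) → (∀ α, val α.neg ↔ ¬ val α) → val φ

/-- The conjunction of `φ` and the formulas in the list. -/
def Fm.conj : Fm C D → List (Fm C D) → Fm C D
  | φ, [] => φ
  | φ, ψ :: l => φ.and (Fm.conj ψ l)

/-- The implication from the conjunction of a list of formulas to `ψ`; for the empty list this is
`ψ` itself. -/
def Fm.conjImp : List (Fm C D) → Fm C D → Fm C D
  | [], ψ => ψ
  | φ :: l, ψ => (Fm.conj φ l).imp ψ

/-- The equations `σ x ≡ σ' x` for the free variables `x` of `φ`. -/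
def Fm.substEqs (σ σ' : Subst C D) (φ : Fm C D) : List (Fm C D) :=
  φ.fvarP.sort.map (fun x => (σ.onVarP x).eqv (σ'.onVarP x)) ++
    φ.fvarJ.sort.map (fun u => Fm.teq (σ.onVarJ u) (σ'.onVarJ u))

/-- The equations `σ u ≡ σ' u` for the variables `u` of `t`. -/
def Tm.substEqs (σ σ' : Subst C D) (t : Tm C) : List (Fm C D) :=
  t.vars.sort.map (fun u => Fm.teq (σ.onVarJ u) (σ'.onVarJ u))

open Fm in
/-- The axiom schemas, before closure under universal quantification. -/
inductive Schema : Fm C D → Prop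
  | taut {φ : Fm C D} : Tautology φ → Schema φ
  | tarski_true (φ : Fm C D) : Schema (iff (isTrue φ) φ)
  | tarski_false (φ : Fm C D) : Schema (iff (isFalse φ) (neg φ))
  | application (φ ψ : Fm C D) (s t : Tm C) :
      Schema (imp (just (imp φ ψ) s) (imp (just φ t) (just ψ (.app s t))))
  | weakening_left (φ : Fm C D) (s t : Tm C) : Schema (imp (just φ s) (just φ (.plus s t)))
  | weakening_right (φ : Fm C D) (s t : Tm C) : Schema (imp (just φ t) (just φ (.plus s t)))
  | necessity (φ : Fm C D) (u : ℕ) : u ∉ φ.fvarJ →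
      Schema (iff (box φ) (exJ u (just φ (.var u))
        (Finset.mem_union_right _ (Finset.mem_singleton_self u))))
  | box_elim (φ : Fm C D) : Schema (imp (box φ) φ)
  | ref_of_synRef {φ ψ : Fm C D} : SynRef φ ψ → Schema (ref φ ψ)
  | ref_trans (φ ψ χ : Fm C D) : Schema (imp (ref φ ψ) (imp (ref ψ χ) (ref φ χ)))
  | eqv_of_alphaEq {φ ψ : Fm C D} : AlphaEq φ ψ → Schema (eqv φ ψ)
  | eqv_elim (φ ψ : Fm C D) : Schema (imp (eqv φ ψ) (imp φ ψ))
  | subst_fm (p p' : ℕ → Fm C D) (j j' : ℕ → Tm C) (φ : Fm C D) :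
      Schema (conjImp (φ.substEqs (Subst.ofVars p j) (Subst.ofVars p' j'))
        (eqv (φ.subst (Subst.ofVars p j)) (φ.subst (Subst.ofVars p' j'))))
  | exJ_intro (u : ℕ) (φ : Fm C D) (t : Tm C) (h : u ∈ φ.fvarJ) :
      Schema (imp (φ.substJ u t) (exJ u φ h))
  | allJ_elim (u : ℕ) (φ : Fm C D) (t : Tm C) (h : u ∈ φ.fvarJ) :
      Schema (imp (allJ u φ h) (φ.substJ u t))
  | allJ_dist (u : ℕ) (ψ φ : Fm C D) (hψ : u ∈ ψ.fvarJ) (hφ : u ∈ φ.fvarJ) :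
      Schema (imp (allJ u (imp ψ φ) (Finset.mem_union_left _ hψ))
        (imp (allJ u ψ hψ) (allJ u φ hφ)))
  | allJ_shift (u : ℕ) (ψ φ : Fm C D) (hψ : u ∉ ψ.fvarJ) (hφ : u ∈ φ.fvarJ) :
      Schema (imp (allJ u (imp ψ φ) (Finset.mem_union_right _ hφ)) (imp ψ (allJ u φ hφ)))
  | exP_intro (x : ℕ) (φ ψ : Fm C D) (h : x ∈ φ.fvarP) :
      Schema (imp (φ.substP x ψ) (exP x φ h))
  | allP_elim (x : ℕ) (φ ψ : Fm C D) (h : x ∈ φ.fvarP) :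
      Schema (imp (allP x φ h) (φ.substP x ψ))
  | allP_dist (x : ℕ) (ψ φ : Fm C D) (hψ : x ∈ ψ.fvarP) (hφ : x ∈ φ.fvarP) :
      Schema (imp (allP x (imp ψ φ) (Finset.mem_union_left _ hψ))
        (imp (allP x ψ hψ) (allP x φ hφ)))
  | allP_shift (x : ℕ) (ψ φ : Fm C D) (hψ : x ∉ ψ.fvarP) (hφ : x ∈ φ.fvarP) :
      Schema (imp (allP x (imp ψ φ) (Finset.mem_union_right _ hφ)) (imp ψ (allP x φ hφ)))
  | le_iff (x : ℕ) (s t : Tm C) :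
      Schema (iff (tle s t) (allP x (imp (just (var x) s) (just (var x) t))
        (Finset.mem_union_left _ (Finset.mem_singleton_self x))))
  | extensionality (s t : Tm C) : Schema (iff (teq s t) (and (tle s t) (tle t s)))
  | subst_tm (p p' : ℕ → Fm C D) (j j' : ℕ → Tm C) (t : Tm C) :
      Schema (conjImp (t.substEqs (Subst.ofVars p j) (Subst.ofVars p' j'))
        (teq (t.subst (Subst.ofVars p j)) (t.subst (Subst.ofVars p' j'))))

/-- The smallest set that contains `S` and is closed under universal quantification over free
variables of either sort. -/
inductive GenClosure (S : Set (Fm C D)) : Set (Fm C D)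
  | base {φ} : φ ∈ S → GenClosure S φ
  | allJ {φ} (u : ℕ) (h : u ∈ φ.fvarJ) : GenClosure S φ → GenClosure S (.allJ u φ h)
  | allP {φ} (x : ℕ) (h : x ∈ φ.fvarP) : GenClosure S φ → GenClosure S (.allP x φ h)

/-- Schema (4): all formulas `□φ → □□φ`. -/
def schemaFour (C : Type u) (D : Type v) : Set (Fm C D) :=
  {χ | ∃ φ : Fm C D, χ = φ.box.imp φ.box.box}

/-- The axioms of the basic system. -/
def Ax (C : Type u) (D : Type v) : Set (Fm C D) := GenClosure {φ | Schema φ}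

/-- The axioms of the basic system extended by schema (4). -/
def AxFour (C : Type u) (D : Type v) : Set (Fm C D) :=
  GenClosure ({φ | Schema φ} ∪ schemaFour C D)

/-- `Derives A Φ` is the smallest set containing `Φ ∪ A` and closed under Modus Ponens. -/
inductive Derives (A Φ : Set (Fm C D)) : Fm C D → Prop
  | ax {φ} : φ ∈ A → Derives A Φ φ
  | hyp {φ} : φ ∈ Φ → Derives A Φ φ
  | mp {φ ψ} : Derives A Φ (φ.imp ψ) → Derives A Φ φ → Derives A Φ ψ

/-- Derivability in the system with schema (4). -/
def DerivesFour (Φ : Set (Fm C D)) (φ : Fm C D) : Prop := Derives (AxFour C D) Φ φ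

/-! ### Semantics -/

/-- Assignments: propositional variables to propositions, justification variables to indexes. -/
@[ext]
structure Asg (M L : Type w) where
  onP : ℕ → M
  onJ : ℕ → L

def Asg.updP {M L : Type w} (γ : Asg M L) (x : ℕ) (m : M) : Asg M L :=
  { γ with onP := Function.update γ.onP x m }

def Asg.updJ {M L : Type w} (γ : Asg M L) (u : ℕ) (l : L) : Asg M L :=
  { γ with onJ := Function.update γ.onJ u l }

/-- Models. The Gamma-function is split into its parts `gam` on formulas and `gamT` on terms. -/
structure Model (C : Type u) (D : Type v) where
  L : Type w
  M : Type w
  [order : PartialOrder L]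
  plus : L → L → L
  app : L → L → L
  TRUE : Set M
  FALSE : Set M
  NECESSARY : Set M
  REASON : L → Set M
  refers : M → M → Prop
  gam : Fm C D → Asg M L → M
  gamT : Tm C → Asg M L → L
  true_union_false : TRUE ∪ FALSE = Set.univ
  true_inter_false : TRUE ∩ FALSE = ∅
  necessary_subset : NECESSARY ⊆ TRUE
  necessary_eq : NECESSARY = ⋃ l, REASON l
  /-- `l ↦ REASON l` is an order isomorphism of `L` onto the family of justifications ordered by
  inclusion (injectivity follows from antisymmetry). -/
  le_iff : ∀ l l' : L, l ≤ l' ↔ REASON l ⊆ REASON l'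
  refers_trans : ∀ a b c, refers a b → refers b c → refers a c
  -- structure conditions
  ep_P : ∀ x γ, gam (.var x) γ = γ.onP x
  ep_J : ∀ u γ, gamT (.var u) γ = γ.onJ u
  cp_fm : ∀ (φ : Fm C D) (γ γ' : Asg M L), (∀ x ∈ φ.fvarP, γ.onP x = γ'.onP x) →
    (∀ u ∈ φ.fvarJ, γ.onJ u = γ'.onJ u) → gam φ γ = gam φ γ'
  cp_tm : ∀ (s : Tm C) (γ γ' : Asg M L), (∀ u ∈ s.vars, γ.onJ u = γ'.onJ u) →
    gamT s γ = gamT s γ'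
  sp_fm : ∀ (φ : Fm C D) (p : ℕ → Fm C D) (j : ℕ → Tm C) (γ : Asg M L),
    gam (φ.subst (Subst.ofVars p j)) γ = gam φ ⟨fun x => gam (p x) γ, fun u => gamT (j u) γ⟩
  sp_tm : ∀ (s : Tm C) (p : ℕ → Fm C D) (j : ℕ → Tm C) (γ : Asg M L),
    gamT (s.subst (Subst.ofVars p j)) γ = gamT s ⟨fun x => gam (p x) γ, fun u => gamT (j u) γ⟩
  rp : ∀ (φ ψ : Fm C D) (γ : Asg M L), SynRef φ ψ → refers (gam φ γ) (gam ψ γ)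
  hp_plus : ∀ s t γ, gamT (.plus s t) γ = plus (gamT s γ) (gamT t γ)
  hp_app : ∀ s t γ, gamT (.app s t) γ = app (gamT s γ) (gamT t γ)
  -- truth conditions
  t_imp : ∀ φ ψ γ, gam (φ.imp ψ) γ ∈ TRUE ↔ gam φ γ ∈ FALSE ∨ gam ψ γ ∈ TRUE
  t_neg : ∀ φ γ, gam φ.neg γ ∈ TRUE ↔ gam φ γ ∉ TRUE
  t_isTrue : ∀ φ γ, gam φ.isTrue γ ∈ TRUE ↔ gam φ γ ∈ TRUE
  t_isFalse : ∀ φ γ, gam φ.isFalse γ ∈ TRUE ↔ gam φ γ ∈ FALSE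
  t_eqv : ∀ φ ψ γ, gam (φ.eqv ψ) γ ∈ TRUE ↔ gam φ γ = gam ψ γ
  t_ref : ∀ φ ψ γ, gam (φ.ref ψ) γ ∈ TRUE ↔ refers (gam φ γ) (gam ψ γ)
  t_teq : ∀ s t γ, gam (.teq s t) γ ∈ TRUE ↔ gamT s γ = gamT t γ
  t_tle : ∀ s t γ, gam (.tle s t) γ ∈ TRUE ↔ gamT s γ ≤ gamT t γ
  t_box : ∀ φ γ, gam φ.box γ ∈ TRUE ↔ gam φ γ ∈ NECESSARY
  t_just : ∀ φ t γ, gam (φ.just t) γ ∈ TRUE ↔ gam φ γ ∈ REASON (gamT t γ)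
  t_app : ∀ φ ψ s t γ, gam (φ.imp ψ) γ ∈ REASON (gamT s γ) → gam φ γ ∈ REASON (gamT t γ) →
    gam ψ γ ∈ REASON (gamT (.app s t) γ)
  t_plus : ∀ φ s t γ, gam φ γ ∈ REASON (gamT s γ) ∪ REASON (gamT t γ) →
    gam φ γ ∈ REASON (gamT (.plus s t) γ)
  t_allJ : ∀ u φ h γ, gam (.allJ u φ h) γ ∈ TRUE ↔ ∀ l : L, gam φ (γ.updJ u l) ∈ TRUE
  t_allP : ∀ x φ h γ, gam (.allP x φ h) γ ∈ TRUE ↔ ∀ m : M, gam φ (γ.updP x m) ∈ TRUE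

/-- Satisfaction in the interpretation `(𝓜, γ)`. -/
def Model.Sat (𝓜 : Model.{u, v, w} C D) (γ : Asg 𝓜.M 𝓜.L) (φ : Fm C D) : Prop :=
  𝓜.gam φ γ ∈ 𝓜.TRUE

/-- Truth condition (4). -/
def Model.CondFour (𝓜 : Model.{u, v, w} C D) : Prop :=
  ∀ (φ : Fm C D) (γ : Asg 𝓜.M 𝓜.L), 𝓜.gam φ.box γ ∈ 𝓜.TRUE → 𝓜.gam φ.box.box γ ∈ 𝓜.TRUE

/-- Logical consequence over all models (with universes in `Type w`) with truth condition (4). -/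
def ConsequenceFour (Φ : Set (Fm C D)) (φ : Fm C D) : Prop :=
  ∀ 𝓜 : Model.{u, v, w} C D, 𝓜.CondFour → ∀ γ : Asg 𝓜.M 𝓜.L,
    (∀ ψ ∈ Φ, 𝓜.Sat γ ψ) → 𝓜.Sat γ φ

end

end EpsJ

-- Soundness is checked axiom by axiom. Alpha-congruence costs little there: the substitution
-- property of a model, applied to the identity substitution, already identifies a formula with its
-- renamed form.
--
-- Completeness is a Henkin construction. If `φ` is not derivable from `Φ`, there is a complete
-- theory `T` over a language with additional constants that contains the image of `Φ`, omits that
-- of `φ`, and contains a quantified formula as soon as it contains all its instances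
-- (`exists_henkin`). In the canonical model, propositions are formulas and indexes are terms, both
-- modulo the equations in `T`; a formula denotes the class of its instance under representatives of
-- the values of its variables. The axioms on equal substitutions make this independent of the
-- representatives (`Carrier.cls_gs_eq`), extensionality makes the order of the indexes
-- antisymmetric, and the witness property yields the clauses for the quantifiers, for `≤` and for
-- `□`.
--
-- The witnesses are introduced all at once: `Wit` codes constants by expressions that may
-- themselves contain such constants. The axioms `φ[x := c] → ∀x.φ` are conservative
-- (`derivesFour_of_union_witAx_finset`): a derivation uses finitely many, and one whose constant
-- has maximal size can be dropped, because that constant occurs in nothing else, so it can be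
-- replaced by a fresh variable which is then generalized. This requires derivability to be closed
-- under substitution for constants (`DerivesFour.gs`). The hard case is the axiom on equal
-- substitutions, which is stated only for substitutions that fix the constants;
-- `Complete.eqv_gs_of_forall` removes this restriction.
--
-- All of it rests on the choice of bound variables. The forced variable depends only on the free
-- variables of the result, so substitutions compose exactly and not just up to renaming
-- (`PreFm.gs_gs`). Hence `Fm.nf`, the instance under the identity, is a canonical representative,
-- and alpha-congruence becomes equality of normal forms (`AlphaEq.gs_eq`, `alphaEq_of_nf_eq`).

universe u₁ v₁ u₂ v₂ u₃ v₃

namespace EpsJ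

noncomputable section

/-! ### Substitutions between languages -/

/-- A substitution from the language over `C`, `D` into the one over `C₁`, with formula values
in `F`. -/
@[ext]
structure LSubst (C : Type u) (D : Type v) (C₁ : Type u₁) (F : Type w) where
  onVarP : ℕ → F
  onVarJ : ℕ → Tm C₁
  onConP : D → F
  onConJ : C → Tm C₁

variable {C : Type u} {D : Type v} {C₁ : Type u₁} {D₁ : Type v₁} {C₂ : Type u₂} {D₂ : Type v₂}
  {C₃ : Type u₃} {D₃ : Type v₃}

namespace LSubst

variable {F : Type w}

def updP (σ : LSubst C D C₁ F) (x : ℕ) (e : F) : LSubst C D C₁ F :=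
  { σ with onVarP := Function.update σ.onVarP x e }

def updJ (σ : LSubst C D C₁ F) (u : ℕ) (t : Tm C₁) : LSubst C D C₁ F :=
  { σ with onVarJ := Function.update σ.onVarJ u t }

variable (σ : LSubst C D C₁ F) (x y : ℕ) (e : F) (t : Tm C₁)

@[simp] theorem updP_onVarP : (σ.updP x e).onVarP y = if y = x then e else σ.onVarP y := by
  simp [updP, Function.update_apply]
@[simp] theorem updP_onVarJ : (σ.updP x e).onVarJ = σ.onVarJ := rfl
@[simp] theorem updP_onConP : (σ.updP x e).onConP = σ.onConP := rfl
@[simp] theorem updP_onConJ : (σ.updP x e).onConJ = σ.onConJ := rfl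
@[simp] theorem updJ_onVarP : (σ.updJ x t).onVarP = σ.onVarP := rfl
@[simp] theorem updJ_onVarJ : (σ.updJ x t).onVarJ y = if y = x then t else σ.onVarJ y := by
  simp [updJ, Function.update_apply]
@[simp] theorem updJ_onConP : (σ.updJ x t).onConP = σ.onConP := rfl
@[simp] theorem updJ_onConJ : (σ.updJ x t).onConJ = σ.onConJ := rfl

end LSubst

/-- A substitution within one language as a substitution between languages. -/
def SubstInto.toL {F : Type w} (σ : SubstInto C D F) : LSubst C D C F :=
  ⟨σ.onVarP, σ.onVarJ, σ.onConP, σ.onConJ⟩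

/-- Simultaneous substitution in a term. -/
def Tm.gs {F : Type w} (σ : LSubst C D C₁ F) : Tm C → Tm C₁
  | .var i => σ.onVarJ i
  | .con c => σ.onConJ c
  | .app s t => .app (s.gs σ) (t.gs σ)
  | .plus s t => .plus (s.gs σ) (t.gs σ)

theorem Tm.subst_eq_gs {F : Type w} (σ : SubstInto C D F) (t : Tm C) :
    t.subst σ = t.gs σ.toL := by
  induction t <;> simp_all [Tm.subst, Tm.gs, SubstInto.toL]

theorem Tm.mem_vars_gs {F : Type w} (σ : LSubst C D C₁ F) (t : Tm C) (i : ℕ) :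
    i ∈ (t.gs σ).vars ↔
      (∃ u ∈ t.vars, i ∈ (σ.onVarJ u).vars) ∨ ∃ c ∈ t.cons, i ∈ (σ.onConJ c).vars := by
  induction t <;> simp [Tm.gs, Tm.vars, Tm.cons] <;> grind

theorem Tm.mem_cons_gs {F : Type w} (σ : LSubst C D C₁ F) (t : Tm C) (i : C₁) :
    i ∈ (t.gs σ).cons ↔
      (∃ u ∈ t.vars, i ∈ (σ.onVarJ u).cons) ∨ ∃ c ∈ t.cons, i ∈ (σ.onConJ c).cons := by
  induction t <;> simp [Tm.gs, Tm.vars, Tm.cons] <;> grind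

theorem Tm.gs_congr {F : Type w} {F' : Type w} {σ : LSubst C D C₁ F} {τ : LSubst C D C₁ F'}
    (t : Tm C) (hv : ∀ u ∈ t.vars, σ.onVarJ u = τ.onVarJ u)
    (hc : ∀ c ∈ t.cons, σ.onConJ c = τ.onConJ c) : t.gs σ = t.gs τ := by
  induction t <;> simp_all [Tm.gs, Tm.vars, Tm.cons]

theorem above_notMem (s : Finset ℕ) : above s ∉ s := not_mem_of_above_le le_rfl

namespace PreFm

/-- The free propositional variables of the values of `σ` at the free variables and constants
of `φ`. -/
def supP (σ : LSubst C D C₁ (PreFm C₁ D₁)) (φ : PreFm C D) : Finset ℕ :=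
  φ.fvarP.biUnion (fun x => (σ.onVarP x).fvarP) ∪ φ.conP.biUnion (fun d => (σ.onConP d).fvarP)

/-- The free justification variables of the values of `σ` at the free variables and constants
of `φ`. -/
def supJ (σ : LSubst C D C₁ (PreFm C₁ D₁)) (φ : PreFm C D) : Finset ℕ :=
  (φ.fvarP.biUnion (fun x => (σ.onVarP x).fvarJ) ∪
      φ.fvarJ.biUnion (fun u => (σ.onVarJ u).vars)) ∪
    (φ.conP.biUnion (fun d => (σ.onConP d).fvarJ) ∪
      φ.conJ.biUnion (fun c => (σ.onConJ c).vars))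

theorem mem_supP {σ : LSubst C D C₁ (PreFm C₁ D₁)} {φ : PreFm C D} {i : ℕ} :
    i ∈ supP σ φ ↔ (∃ x ∈ φ.fvarP, i ∈ (σ.onVarP x).fvarP) ∨
      ∃ d ∈ φ.conP, i ∈ (σ.onConP d).fvarP := by
  simp [supP]

theorem mem_supJ {σ : LSubst C D C₁ (PreFm C₁ D₁)} {φ : PreFm C D} {i : ℕ} :
    i ∈ supJ σ φ ↔ ((∃ x ∈ φ.fvarP, i ∈ (σ.onVarP x).fvarJ) ∨
      ∃ u ∈ φ.fvarJ, i ∈ (σ.onVarJ u).vars) ∨ (∃ d ∈ φ.conP, i ∈ (σ.onConP d).fvarJ) ∨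
      ∃ c ∈ φ.conJ, i ∈ (σ.onConJ c).vars := by
  simp only [supJ, Finset.mem_union, Finset.mem_biUnion]

/-- Simultaneous substitution in a formula, with the bound variables renamed to the forced
ones. -/
def gs : PreFm C D → LSubst C D C₁ (PreFm C₁ D₁) → PreFm C₁ D₁
  | var x, σ => σ.onVarP x
  | con d, σ => σ.onConP d
  | imp a b, σ => imp (a.gs σ) (b.gs σ)
  | neg a, σ => neg (a.gs σ)
  | eqv a b, σ => eqv (a.gs σ) (b.gs σ)
  | ref a b, σ => ref (a.gs σ) (b.gs σ)
  | teq s t, σ => teq (s.gs σ) (t.gs σ)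
  | tle s t, σ => tle (s.gs σ) (t.gs σ)
  | isTrue a, σ => isTrue (a.gs σ)
  | isFalse a, σ => isFalse (a.gs σ)
  | box a, σ => box (a.gs σ)
  | just a t, σ => just (a.gs σ) (t.gs σ)
  | allP x a, σ =>
      allP (above (supP σ (allP x a))) (a.gs (σ.updP x (var (above (supP σ (allP x a))))))
  | allJ u a, σ =>
      allJ (above (supJ σ (allJ u a))) (a.gs (σ.updJ u (.var (above (supJ σ (allJ u a))))))

/-- This reduces the given substitution to the case of equal languages, so that the theory is
developed for `gs` alone. -/
theorem subst_eq_gs (φ : PreFm C D) (σ : SubstInto C D (PreFm C D)) :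
    φ.subst σ = φ.gs σ.toL := by
  induction φ generalizing σ with
  | allP x a ih => rw [subst, gs, ih]; rfl
  | allJ x a ih => rw [subst, gs, ih]; rfl
  | _ => simp_all [subst, gs, Tm.subst_eq_gs, SubstInto.toL]

/-- The forced variable is outside `supP`, so erasing it removes exactly the contribution of the
bound variable and captures nothing. The set that determines the next forced variable is therefore
visible in the result, which is what makes the choice stable under composition. -/
theorem fvarP_gs (φ : PreFm C D) (σ : LSubst C D C₁ (PreFm C₁ D₁)) :
    (φ.gs σ).fvarP = supP σ φ := by
  induction φ generalizing σ with
  | allP x a ih =>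
    ext i
    have hz := above_notMem (supP σ (allP x a))
    rw [gs]
    -- Only the freshness of the forced variable is used, not its minimality.
    generalize above (supP σ (allP x a)) = z at *
    rw [fvarP, ih, Finset.mem_erase]
    simp only [mem_supP, fvarP, conP, LSubst.updP_onVarP, LSubst.updP_onConP,
      Finset.mem_erase] at hz ⊢
    constructor
    · rintro ⟨hi, ⟨y, hy, h⟩ | h⟩
      · split_ifs at h with hyx
        · simp [fvarP, hi] at h
        · exact .inl ⟨y, ⟨hyx, hy⟩, h⟩
      · exact .inr h
    · intro h
      refine ⟨fun hiz => hz (hiz ▸ h), h.imp_left ?_⟩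
      rintro ⟨y, ⟨hyx, hy⟩, h⟩
      exact ⟨y, hy, by rwa [if_neg hyx]⟩
  | allJ x a ih => ext i; simp [gs, fvarP, ih, mem_supP, conP]
  | _ => ext i; simp_all [gs, fvarP, mem_supP, conP] <;> grind

theorem fvarJ_gs (φ : PreFm C D) (σ : LSubst C D C₁ (PreFm C₁ D₁)) :
    (φ.gs σ).fvarJ = supJ σ φ := by
  induction φ generalizing σ with
  | allJ x a ih =>
    ext i
    have hz := above_notMem (supJ σ (allJ x a))
    rw [gs]
    generalize above (supJ σ (allJ x a)) = z at *
    rw [fvarJ, ih, Finset.mem_erase]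
    simp only [mem_supJ, fvarJ, fvarP, conP, conJ, LSubst.updJ_onVarP, LSubst.updJ_onVarJ,
      LSubst.updJ_onConP, LSubst.updJ_onConJ, Finset.mem_erase] at hz ⊢
    constructor
    · rintro ⟨hi, (h | ⟨y, hy, h⟩) | h⟩
      · exact .inl (.inl h)
      · split_ifs at h with hyx
        · simp [Tm.vars, hi] at h
        · exact .inl (.inr ⟨y, ⟨hyx, hy⟩, h⟩)
      · exact .inr h
    · intro h
      refine ⟨fun hiz => hz (hiz ▸ h), h.imp_left (Or.imp_right ?_)⟩
      rintro ⟨y, ⟨hyx, hy⟩, h⟩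
      exact ⟨y, hy, by rwa [if_neg hyx]⟩
  | allP x a ih =>
    ext i
    rw [gs]
    simp only [fvarJ, ih, mem_supJ, fvarP, conP, conJ, LSubst.updP_onVarP, LSubst.updP_onVarJ,
      LSubst.updP_onConP, LSubst.updP_onConJ, Finset.mem_erase]
    refine or_congr_left (or_congr_left ⟨?_, ?_⟩)
    · rintro ⟨y, hy, h⟩
      split_ifs at h with hyx
      · simp [fvarJ] at h
      · exact ⟨y, ⟨hyx, hy⟩, h⟩
    · rintro ⟨y, ⟨hyx, hy⟩, h⟩
      exact ⟨y, hy, by rwa [if_neg hyx]⟩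
  | _ => ext i; simp_all [gs, fvarJ, fvarP, mem_supJ, conP, conJ, Tm.mem_vars_gs] <;> grind

theorem mem_conP_gs (φ : PreFm C D) (σ : LSubst C D C₁ (PreFm C₁ D₁)) (i : D₁) :
    i ∈ (φ.gs σ).conP ↔ (∃ x ∈ φ.fvarP, i ∈ (σ.onVarP x).conP) ∨
      ∃ d ∈ φ.conP, i ∈ (σ.onConP d).conP := by
  induction φ generalizing σ with
  | allP x a ih =>
    rw [gs]
    simp only [fvarP, conP, ih, LSubst.updP_onVarP, LSubst.updP_onConP, Finset.mem_erase]
    refine or_congr_left ⟨?_, ?_⟩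
    · rintro ⟨y, hy, h⟩
      split_ifs at h with hyx
      · simp [conP] at h
      · exact ⟨y, ⟨hyx, hy⟩, h⟩
    · rintro ⟨y, ⟨hyx, hy⟩, h⟩
      exact ⟨y, hy, by rwa [if_neg hyx]⟩
  | _ => simp_all [gs, fvarP, conP] <;> grind

theorem mem_conJ_gs (φ : PreFm C D) (σ : LSubst C D C₁ (PreFm C₁ D₁)) (i : C₁) :
    i ∈ (φ.gs σ).conJ ↔ ((∃ x ∈ φ.fvarP, i ∈ (σ.onVarP x).conJ) ∨
      ∃ u ∈ φ.fvarJ, i ∈ (σ.onVarJ u).cons) ∨ (∃ d ∈ φ.conP, i ∈ (σ.onConP d).conJ) ∨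
      ∃ c ∈ φ.conJ, i ∈ (σ.onConJ c).cons := by
  induction φ generalizing σ with
  | allP x a ih =>
    rw [gs]
    simp only [fvarP, fvarJ, conP, conJ, ih, LSubst.updP_onVarP, LSubst.updP_onVarJ,
      LSubst.updP_onConP, LSubst.updP_onConJ, Finset.mem_erase]
    refine or_congr_left (or_congr_left ⟨?_, ?_⟩)
    · rintro ⟨y, hy, h⟩
      split_ifs at h with hyx
      · simp [conJ] at h
      · exact ⟨y, ⟨hyx, hy⟩, h⟩
    · rintro ⟨y, ⟨hyx, hy⟩, h⟩
      exact ⟨y, hy, by rwa [if_neg hyx]⟩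
  | allJ x a ih =>
    rw [gs]
    simp only [fvarP, fvarJ, conP, conJ, ih, LSubst.updJ_onVarP, LSubst.updJ_onVarJ,
      LSubst.updJ_onConP, LSubst.updJ_onConJ, Finset.mem_erase]
    refine or_congr_left (or_congr_right ⟨?_, ?_⟩)
    · rintro ⟨y, hy, h⟩
      split_ifs at h with hyx
      · simp [Tm.cons] at h
      · exact ⟨y, ⟨hyx, hy⟩, h⟩
    · rintro ⟨y, ⟨hyx, hy⟩, h⟩
      exact ⟨y, hy, by rwa [if_neg hyx]⟩
  | _ => simp_all [gs, fvarP, fvarJ, conP, conJ, Tm.mem_cons_gs] <;> grind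

/-- `σ` and `τ` agree at the free variables and the constants of `φ`. -/
structure Agree (φ : PreFm C D) (σ τ : LSubst C D C₁ (PreFm C₁ D₁)) : Prop where
  varP : ∀ x ∈ φ.fvarP, σ.onVarP x = τ.onVarP x
  varJ : ∀ u ∈ φ.fvarJ, σ.onVarJ u = τ.onVarJ u
  conP : ∀ d ∈ φ.conP, σ.onConP d = τ.onConP d
  conJ : ∀ c ∈ φ.conJ, σ.onConJ c = τ.onConJ c

theorem Agree.supP_eq {φ : PreFm C D} {σ τ : LSubst C D C₁ (PreFm C₁ D₁)} (h : φ.Agree σ τ) :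
    supP σ φ = supP τ φ := by
  have := h.varP; have := h.conP
  ext i; rw [mem_supP, mem_supP]; grind

theorem Agree.supJ_eq {φ : PreFm C D} {σ τ : LSubst C D C₁ (PreFm C₁ D₁)} (h : φ.Agree σ τ) :
    supJ σ φ = supJ τ φ := by
  have := h.varP; have := h.conP; have := h.varJ; have := h.conJ
  ext i; rw [mem_supJ, mem_supJ]; grind

/-- The forced variable is computed from the values at occurring symbols only, so agreement there
gives equal binders and not merely alpha-congruent results. -/
theorem gs_congr (φ : PreFm C D) {σ τ : LSubst C D C₁ (PreFm C₁ D₁)} (h : φ.Agree σ τ) :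
    φ.gs σ = φ.gs τ := by
  induction φ generalizing σ τ with
  | allP x a ih =>
    rw [gs, gs, h.supP_eq, ih]
    refine ⟨fun y hy => ?_, h.varJ, h.conP, h.conJ⟩
    have := h.varP y
    simp only [fvarP, Finset.mem_erase, LSubst.updP_onVarP] at this ⊢
    split_ifs <;> simp_all
  | allJ x a ih =>
    rw [gs, gs, h.supJ_eq, ih]
    refine ⟨h.varP, fun y hy => ?_, h.conP, h.conJ⟩
    have := h.varJ y
    simp only [fvarJ, Finset.mem_erase, LSubst.updJ_onVarJ] at this ⊢
    split_ifs <;> simp_all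
  | var x => exact h.varP x (by simp [fvarP])
  | con x => exact h.conP x (by simp [conP])
  | teq s t | tle s t =>
    have hv := h.varJ
    have hc := h.conJ
    simp only [fvarJ, conJ, Finset.mem_union] at hv hc
    rw [gs, gs, s.gs_congr (fun u hu => hv u (.inl hu)) (fun u hu => hc u (.inl hu)),
      t.gs_congr (fun u hu => hv u (.inr hu)) (fun u hu => hc u (.inr hu))]
  | just a t ih =>
    have hv := h.varJ
    have hc := h.conJ
    simp only [fvarJ, conJ, Finset.mem_union] at hv hc
    rw [gs, gs, t.gs_congr (fun u hu => hv u (.inr hu)) (fun u hu => hc u (.inr hu)),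
      ih ⟨h.varP, fun u hu => hv u (.inl hu), h.conP, fun u hu => hc u (.inl hu)⟩]
  | imp a b iha ihb | eqv a b iha ihb | ref a b iha ihb =>
    have hv := h.varJ
    have hc := h.conJ
    have hv' := h.varP
    have hc' := h.conP
    simp only [fvarJ, conJ, fvarP, conP, Finset.mem_union] at hv hc hv' hc'
    rw [gs, gs, iha ⟨fun u hu => hv' u (.inl hu), fun u hu => hv u (.inl hu),
        fun u hu => hc' u (.inl hu), fun u hu => hc u (.inl hu)⟩,
      ihb ⟨fun u hu => hv' u (.inr hu), fun u hu => hv u (.inr hu),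
        fun u hu => hc' u (.inr hu), fun u hu => hc u (.inr hu)⟩]
  | neg a ih | isTrue a ih | isFalse a ih | box a ih =>
    rw [gs, gs, ih ⟨h.varP, h.varJ, h.conP, h.conJ⟩]

end PreFm

/-! ### Composition of substitutions -/

/-- Composition of substitutions: first `σ`, then `τ`. -/
def LSubst.comp (σ : LSubst C D C₁ (PreFm C₁ D₁)) (τ : LSubst C₁ D₁ C₂ (PreFm C₂ D₂)) :
    LSubst C D C₂ (PreFm C₂ D₂) :=
  ⟨fun x => (σ.onVarP x).gs τ, fun u => (σ.onVarJ u).gs τ, fun d => (σ.onConP d).gs τ,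
    fun c => (σ.onConJ c).gs τ⟩

theorem Tm.gs_gs (t : Tm C) (σ : LSubst C D C₁ (PreFm C₁ D₁))
    (τ : LSubst C₁ D₁ C₂ (PreFm C₂ D₂)) : (t.gs σ).gs τ = t.gs (σ.comp τ) := by
  induction t <;> simp_all [Tm.gs, LSubst.comp]

/-- Two successive renamings of a binder thus end in the variable that the composite forces
directly. -/
theorem PreFm.supP_gs (φ : PreFm C D) (σ : LSubst C D C₁ (PreFm C₁ D₁))
    (τ : LSubst C₁ D₁ C₂ (PreFm C₂ D₂)) : supP τ (φ.gs σ) = supP (σ.comp τ) φ := by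
  ext i
  simp only [mem_supP, fvarP_gs, mem_conP_gs, LSubst.comp]
  grind

theorem PreFm.supJ_gs (φ : PreFm C D) (σ : LSubst C D C₁ (PreFm C₁ D₁))
    (τ : LSubst C₁ D₁ C₂ (PreFm C₂ D₂)) : supJ τ (φ.gs σ) = supJ (σ.comp τ) φ := by
  ext i
  simp only [mem_supJ, mem_supP, fvarP_gs, fvarJ_gs, mem_conP_gs, mem_conJ_gs, LSubst.comp,
    Tm.mem_vars_gs]
  grind (splits := 40)

/-- Substituting for the variable of a renamed binder. -/
theorem PreFm.Agree.updP_comp {x z : ℕ} {a : PreFm C D} {σ : LSubst C D C₁ (PreFm C₁ D₁)}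
    (hz : z ∉ supP σ (.allP x a)) (τ : LSubst C₁ D₁ C₂ (PreFm C₂ D₂)) (e : PreFm C₂ D₂) :
    a.Agree ((σ.updP x (.var z)).comp (τ.updP z e)) ((σ.comp τ).updP x e) := by
  rw [mem_supP] at hz
  push Not at hz
  refine ⟨fun y hy => ?_, fun u hu => ?_, fun d hd => ?_, fun c hc => ?_⟩
  · simp only [LSubst.comp, LSubst.updP_onVarP]
    split_ifs with hyx
    · simp [gs]
    -- Since `y ≠ x` is free in the quantified formula, `z` is not free in the value at `y`, and the
    -- update at `z` is invisible.
    · refine gs_congr _ ⟨fun w hw => ?_, fun _ _ => rfl, fun _ _ => rfl, fun _ _ => rfl⟩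
      have := hz.1 y (by simp [fvarP, hy, hyx])
      simp only [LSubst.updP_onVarP]
      rw [if_neg (by grind)]
  · exact Tm.gs_congr _ (fun _ _ => rfl) (fun _ _ => rfl)
  · refine gs_congr _ ⟨fun w hw => ?_, fun _ _ => rfl, fun _ _ => rfl, fun _ _ => rfl⟩
    have := hz.2 d hd
    simp only [LSubst.updP_onVarP]
    rw [if_neg]
    rintro rfl
    exact this hw
  · exact Tm.gs_congr _ (fun _ _ => rfl) (fun _ _ => rfl)

theorem PreFm.Agree.updJ_comp {x z : ℕ} {a : PreFm C D} {σ : LSubst C D C₁ (PreFm C₁ D₁)}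
    (hz : z ∉ supJ σ (.allJ x a)) (τ : LSubst C₁ D₁ C₂ (PreFm C₂ D₂)) (e : Tm C₂) :
    a.Agree ((σ.updJ x (.var z)).comp (τ.updJ z e)) ((σ.comp τ).updJ x e) := by
  rw [mem_supJ] at hz
  push Not at hz
  obtain ⟨⟨h1, h2⟩, h3, h4⟩ := hz
  refine ⟨fun y hy => ?_, fun u hu => ?_, fun d hd => ?_, fun c hc => ?_⟩
  · refine gs_congr _ ⟨fun _ _ => rfl, fun w hw => ?_, fun _ _ => rfl, fun _ _ => rfl⟩
    have := h1 y hy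
    simp only [LSubst.updJ_onVarJ]
    rw [if_neg]
    rintro rfl
    exact this hw
  · simp only [LSubst.comp, LSubst.updJ_onVarJ]
    split_ifs with hyx
    · simp [Tm.gs]
    · refine Tm.gs_congr _ (fun w hw => ?_) (fun _ _ => rfl)
      have := h2 u (by simp [fvarJ, hu, hyx])
      simp only [LSubst.updJ_onVarJ]
      rw [if_neg (by grind)]
  · refine gs_congr _ ⟨fun _ _ => rfl, fun w hw => ?_, fun _ _ => rfl, fun _ _ => rfl⟩
    have := h3 d hd
    simp only [LSubst.updJ_onVarJ]
    rw [if_neg]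
    rintro rfl
    exact this hw
  · refine Tm.gs_congr _ (fun w hw => ?_) (fun _ _ => rfl)
    have := h4 c hc
    simp only [LSubst.updJ_onVarJ]
    rw [if_neg]
    rintro rfl
    exact this hw

/-- At a binder, `supP_gs` and `supJ_gs` make the forced variables coincide, and freshness of the
intermediate one makes the bodies agree; hence a true equation. -/
theorem PreFm.gs_gs (φ : PreFm C D) (σ : LSubst C D C₁ (PreFm C₁ D₁))
    (τ : LSubst C₁ D₁ C₂ (PreFm C₂ D₂)) : (φ.gs σ).gs τ = φ.gs (σ.comp τ) := by
  induction φ generalizing σ τ with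
  | allP x a ih =>
    have h := supP_gs (allP x a) σ τ
    rw [gs] at h ⊢
    rw [gs, h, ih, gs, gs_congr _ (Agree.updP_comp (above_notMem _) τ _)]
  | allJ x a ih =>
    have h := supJ_gs (allJ x a) σ τ
    rw [gs] at h ⊢
    rw [gs, h, ih, gs, gs_congr _ (Agree.updJ_comp (above_notMem _) τ _)]
  | var | con => rfl
  | _ => simp_all [gs, Tm.gs_gs]

theorem PreFm.Proper.gs {φ : PreFm C D} {σ : LSubst C D C₁ (PreFm C₁ D₁)} (h : φ.Proper)
    (hv : ∀ x, (σ.onVarP x).Proper) (hc : ∀ d, (σ.onConP d).Proper) : (φ.gs σ).Proper := by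
  induction φ generalizing σ with
  | allP y a ih =>
    refine ⟨?_, ih h.2 (fun x => ?_) hc⟩
    · rw [fvarP_gs, mem_supP]
      exact .inl ⟨y, h.1, by simp [fvarP]⟩
    · rw [LSubst.updP_onVarP]
      split_ifs
      · trivial
      · exact hv x
  | allJ y a ih =>
    refine ⟨?_, ih h.2 hv hc⟩
    rw [fvarJ_gs, mem_supJ]
    exact .inl (.inr ⟨y, h.1, by simp [Tm.vars]⟩)
  | var x => exact hv x
  | con d => exact hc d
  | teq | tle => trivial
  | imp a b ha hb | eqv a b ha hb | ref a b ha hb => exact ⟨ha h.1 hv hc, hb h.2 hv hc⟩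
  | neg a ha | isTrue a ha | isFalse a ha | box a ha | just a t ha => exact ha (σ := σ) h hv hc

/-! ### Substitution of proper formulas -/

/-- Substitutions between languages with values in the proper formulas. -/
abbrev FSubst (C : Type u) (D : Type v) (C₁ : Type u₁) (D₁ : Type v₁) :
    Type (max u v u₁ v₁) := LSubst C D C₁ (Fm C₁ D₁)

/-- Forget that the values are proper. -/
def LSubst.toPre (σ : FSubst C D C₁ D₁) : LSubst C D C₁ (PreFm C₁ D₁) :=
  ⟨fun x => (σ.onVarP x).1, σ.onVarJ, fun d => (σ.onConP d).1, σ.onConJ⟩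

theorem LSubst.toPre_updP (σ : FSubst C D C₁ D₁) (x : ℕ) (e : Fm C₁ D₁) :
    (σ.updP x e).toPre = σ.toPre.updP x e.1 := by
  ext : 1
  · funext y
    simp only [toPre, updP_onVarP]
    split_ifs <;> rfl
  all_goals rfl

theorem LSubst.toPre_updJ (σ : FSubst C D C₁ D₁) (x : ℕ) (e : Tm C₁) :
    (σ.updJ x e).toPre = σ.toPre.updJ x e := rfl

theorem Tm.gs_toPre (σ : FSubst C D C₁ D₁) (t : Tm C) : t.gs σ.toPre = t.gs σ := by
  induction t <;> simp_all [Tm.gs, LSubst.toPre]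

namespace Fm

/-- Propositional constants. -/
def conP (φ : Fm C D) : Finset D := φ.1.conP

/-- Justification constants. -/
def conJ (φ : Fm C D) : Finset C := φ.1.conJ

@[simp] theorem fvarP_var (x : ℕ) : (var x : Fm C D).fvarP = {x} := rfl
@[simp] theorem fvarJ_var (x : ℕ) : (var x : Fm C D).fvarJ = ∅ := rfl
@[simp] theorem conP_var (x : ℕ) : (var x : Fm C D).conP = ∅ := rfl
@[simp] theorem conJ_var (x : ℕ) : (var x : Fm C D).conJ = ∅ := rfl
@[simp] theorem fvarP_con (d : D) : (con d : Fm C D).fvarP = ∅ := rfl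
@[simp] theorem fvarJ_con (d : D) : (con d : Fm C D).fvarJ = ∅ := rfl
@[simp] theorem conP_con (d : D) : (con d : Fm C D).conP = {d} := rfl
@[simp] theorem conJ_con (d : D) : (con d : Fm C D).conJ = ∅ := rfl
theorem fvarP_imp (φ ψ : Fm C D) : (imp φ ψ).fvarP = φ.fvarP ∪ ψ.fvarP := rfl
theorem fvarJ_imp (φ ψ : Fm C D) : (imp φ ψ).fvarJ = φ.fvarJ ∪ ψ.fvarJ := rfl

theorem mem_conP_imp {φ ψ : Fm C D} {d : D} :
    d ∈ (imp φ ψ).conP ↔ d ∈ φ.conP ∨ d ∈ ψ.conP := by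
  classical exact Finset.mem_union

theorem mem_conJ_imp {φ ψ : Fm C D} {c : C} :
    c ∈ (imp φ ψ).conJ ↔ c ∈ φ.conJ ∨ c ∈ ψ.conJ := by
  classical exact Finset.mem_union

/-- Simultaneous substitution. -/
def gs (φ : Fm C D) (σ : FSubst C D C₁ D₁) : Fm C₁ D₁ :=
  ⟨φ.1.gs σ.toPre, φ.2.gs (fun x => (σ.onVarP x).2) (fun d => (σ.onConP d).2)⟩

theorem subst_eq_gs (φ : Fm C D) (σ : Subst C D) : φ.subst σ = φ.gs σ.toL :=
  Subtype.ext (PreFm.subst_eq_gs _ _)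

theorem gs_congr (φ : Fm C D) {σ τ : FSubst C D C₁ D₁}
    (hP : ∀ x ∈ φ.fvarP, σ.onVarP x = τ.onVarP x) (hJ : ∀ u ∈ φ.fvarJ, σ.onVarJ u = τ.onVarJ u)
    (cP : ∀ d ∈ φ.conP, σ.onConP d = τ.onConP d) (cJ : ∀ c ∈ φ.conJ, σ.onConJ c = τ.onConJ c) :
    φ.gs σ = φ.gs τ :=
  Subtype.ext (PreFm.gs_congr _ ⟨fun x hx => congrArg Subtype.val (hP x hx), hJ,
    fun x hx => congrArg Subtype.val (cP x hx), cJ⟩)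

theorem mem_fvarP_gs {φ : Fm C D} {σ : FSubst C D C₁ D₁} {i : ℕ} :
    i ∈ (φ.gs σ).fvarP ↔ (∃ x ∈ φ.fvarP, i ∈ (σ.onVarP x).fvarP) ∨
      ∃ d ∈ φ.conP, i ∈ (σ.onConP d).fvarP := by
  rw [fvarP, gs, PreFm.fvarP_gs, PreFm.mem_supP]; rfl

theorem mem_fvarJ_gs {φ : Fm C D} {σ : FSubst C D C₁ D₁} {i : ℕ} :
    i ∈ (φ.gs σ).fvarJ ↔ ((∃ x ∈ φ.fvarP, i ∈ (σ.onVarP x).fvarJ) ∨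
      ∃ u ∈ φ.fvarJ, i ∈ (σ.onVarJ u).vars) ∨ (∃ d ∈ φ.conP, i ∈ (σ.onConP d).fvarJ) ∨
      ∃ c ∈ φ.conJ, i ∈ (σ.onConJ c).vars := by
  rw [fvarJ, gs, PreFm.fvarJ_gs, PreFm.mem_supJ]; rfl

theorem mem_conP_gs {φ : Fm C D} {σ : FSubst C D C₁ D₁} {i : D₁} :
    i ∈ (φ.gs σ).conP ↔ (∃ x ∈ φ.fvarP, i ∈ (σ.onVarP x).conP) ∨
      ∃ d ∈ φ.conP, i ∈ (σ.onConP d).conP := by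
  rw [conP, gs, PreFm.mem_conP_gs]; rfl

theorem mem_conJ_gs {φ : Fm C D} {σ : FSubst C D C₁ D₁} {i : C₁} :
    i ∈ (φ.gs σ).conJ ↔ ((∃ x ∈ φ.fvarP, i ∈ (σ.onVarP x).conJ) ∨
      ∃ u ∈ φ.fvarJ, i ∈ (σ.onVarJ u).cons) ∨ (∃ d ∈ φ.conP, i ∈ (σ.onConP d).conJ) ∨
      ∃ c ∈ φ.conJ, i ∈ (σ.onConJ c).cons := by
  rw [conJ, gs, PreFm.mem_conJ_gs]; rfl

/-- The free propositional variables of the values of `σ` at the free variables other than `x`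
and the constants of `φ`. -/
def supP (σ : FSubst C D C₁ D₁) (x : ℕ) (φ : Fm C D) : Finset ℕ :=
  PreFm.supP σ.toPre (.allP x φ.1)

/-- The free justification variables of the values of `σ` at the free variables other than the
justification variable `u` and the constants of `φ`. -/
def supJ (σ : FSubst C D C₁ D₁) (u : ℕ) (φ : Fm C D) : Finset ℕ :=
  PreFm.supJ σ.toPre (.allJ u φ.1)

theorem mem_supP {σ : FSubst C D C₁ D₁} {x : ℕ} {φ : Fm C D} {i : ℕ} :
    i ∈ supP σ x φ ↔ (∃ y ∈ φ.fvarP, y ≠ x ∧ i ∈ (σ.onVarP y).fvarP) ∨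
      ∃ d ∈ φ.conP, i ∈ (σ.onConP d).fvarP := by
  rw [supP, PreFm.mem_supP]
  simp only [PreFm.fvarP, Finset.mem_erase, PreFm.conP, LSubst.toPre, fvarP, conP]
  grind

theorem mem_supJ {σ : FSubst C D C₁ D₁} {u : ℕ} {φ : Fm C D} {i : ℕ} :
    i ∈ supJ σ u φ ↔ ((∃ x ∈ φ.fvarP, i ∈ (σ.onVarP x).fvarJ) ∨
      ∃ v ∈ φ.fvarJ, v ≠ u ∧ i ∈ (σ.onVarJ v).vars) ∨ (∃ d ∈ φ.conP, i ∈ (σ.onConP d).fvarJ) ∨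
      ∃ c ∈ φ.conJ, i ∈ (σ.onConJ c).vars := by
  rw [supJ, PreFm.mem_supJ]
  simp only [PreFm.fvarP, PreFm.fvarJ, Finset.mem_erase, PreFm.conP, PreFm.conJ, LSubst.toPre,
    fvarP, conP, fvarJ, conJ]
  grind

theorem mem_fvarP_gs_updP {φ : Fm C D} {x : ℕ} (h : x ∈ φ.fvarP) (σ : FSubst C D C₁ D₁) (z : ℕ) :
    z ∈ (φ.gs (σ.updP x (var z))).fvarP :=
  mem_fvarP_gs.mpr (.inl ⟨x, h, by simp⟩)

theorem mem_fvarJ_gs_updJ {φ : Fm C D} {u : ℕ} (h : u ∈ φ.fvarJ) (σ : FSubst C D C₁ D₁) (z : ℕ) :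
    z ∈ (φ.gs (σ.updJ u (.var z))).fvarJ :=
  mem_fvarJ_gs.mpr (.inl (.inr ⟨u, h, by simp [Tm.vars]⟩))

theorem gs_allP {φ : Fm C D} {x : ℕ} (h : x ∈ φ.fvarP) (σ : FSubst C D C₁ D₁) :
    (allP x φ h).gs σ = allP (above (supP σ x φ)) (φ.gs (σ.updP x (var (above (supP σ x φ)))))
      (mem_fvarP_gs_updP h σ _) := by
  refine Subtype.ext ?_
  simp only [gs, allP, PreFm.gs, LSubst.toPre_updP]
  rfl

theorem gs_allJ {φ : Fm C D} {u : ℕ} (h : u ∈ φ.fvarJ) (σ : FSubst C D C₁ D₁) :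
    (allJ u φ h).gs σ = allJ (above (supJ σ u φ)) (φ.gs (σ.updJ u (.var (above (supJ σ u φ)))))
      (mem_fvarJ_gs_updJ h σ _) := rfl

section

variable (σ : FSubst C D C₁ D₁) (φ ψ : Fm C D) (s t : Tm C)

@[simp] theorem gs_var (x : ℕ) : (var x : Fm C D).gs σ = σ.onVarP x := rfl
@[simp] theorem gs_con (d : D) : (con d : Fm C D).gs σ = σ.onConP d := rfl
@[simp] theorem gs_imp : (imp φ ψ).gs σ = imp (φ.gs σ) (ψ.gs σ) := rfl
@[simp] theorem gs_neg : (neg φ).gs σ = neg (φ.gs σ) := rfl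
@[simp] theorem gs_and : (and φ ψ).gs σ = and (φ.gs σ) (ψ.gs σ) := rfl
@[simp] theorem gs_iff : (iff φ ψ).gs σ = iff (φ.gs σ) (ψ.gs σ) := rfl
@[simp] theorem gs_eqv : (eqv φ ψ).gs σ = eqv (φ.gs σ) (ψ.gs σ) := rfl
@[simp] theorem gs_ref : (ref φ ψ).gs σ = ref (φ.gs σ) (ψ.gs σ) := rfl
@[simp] theorem gs_isTrue : (isTrue φ).gs σ = isTrue (φ.gs σ) := rfl
@[simp] theorem gs_isFalse : (isFalse φ).gs σ = isFalse (φ.gs σ) := rfl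
@[simp] theorem gs_box : (box φ).gs σ = box (φ.gs σ) := rfl
@[simp] theorem gs_teq : (teq s t : Fm C D).gs σ = teq (s.gs σ) (t.gs σ) :=
  Subtype.ext (by simp [gs, teq, PreFm.gs, Tm.gs_toPre])
@[simp] theorem gs_tle : (tle s t : Fm C D).gs σ = tle (s.gs σ) (t.gs σ) :=
  Subtype.ext (by simp [gs, tle, PreFm.gs, Tm.gs_toPre])
@[simp] theorem gs_just : (just φ t).gs σ = just (φ.gs σ) (t.gs σ) :=
  Subtype.ext (by simp [gs, just, PreFm.gs, Tm.gs_toPre])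

end

end Fm

/-- Composition of substitutions: first `σ`, then `τ`. -/
def LSubst.fcomp (σ : FSubst C D C₁ D₁) (τ : FSubst C₁ D₁ C₂ D₂) : FSubst C D C₂ D₂ :=
  ⟨fun x => (σ.onVarP x).gs τ, fun u => (σ.onVarJ u).gs τ, fun d => (σ.onConP d).gs τ,
    fun c => (σ.onConJ c).gs τ⟩

theorem LSubst.toPre_fcomp (σ : FSubst C D C₁ D₁) (τ : FSubst C₁ D₁ C₂ D₂) :
    (σ.fcomp τ).toPre = σ.toPre.comp τ.toPre := by
  simp only [comp, Tm.gs_toPre]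
  rfl

theorem Tm.gs_fcomp (t : Tm C) (σ : FSubst C D C₁ D₁) (τ : FSubst C₁ D₁ C₂ D₂) :
    (t.gs σ).gs τ = t.gs (σ.fcomp τ) := by
  induction t <;> simp_all [Tm.gs, LSubst.fcomp]

theorem Fm.gs_gs (φ : Fm C D) (σ : FSubst C D C₁ D₁) (τ : FSubst C₁ D₁ C₂ D₂) :
    (φ.gs σ).gs τ = φ.gs (σ.fcomp τ) := by
  refine Subtype.ext ?_
  simp only [gs, PreFm.gs_gs, LSubst.toPre_fcomp]

theorem LSubst.fcomp_assoc (σ : FSubst C D C₁ D₁) (τ : FSubst C₁ D₁ C₂ D₂)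
    (ρ : FSubst C₂ D₂ C₃ D₃) : (σ.fcomp τ).fcomp ρ = σ.fcomp (τ.fcomp ρ) := by
  simp only [fcomp, Fm.gs_gs, Tm.gs_fcomp]

theorem LSubst.updP_fcomp (σ : FSubst C D C₁ D₁) (τ : FSubst C₁ D₁ C₂ D₂) (x : ℕ)
    (e : Fm C₁ D₁) : (σ.updP x e).fcomp τ = (σ.fcomp τ).updP x (e.gs τ) := by
  ext : 1
  · funext y
    simp only [fcomp, updP_onVarP]
    split_ifs <;> rfl
  · funext y
    exact Tm.gs_congr _ (fun _ _ => rfl) (fun _ _ => rfl)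
  all_goals rfl

theorem LSubst.updJ_fcomp (σ : FSubst C D C₁ D₁) (τ : FSubst C₁ D₁ C₂ D₂) (x : ℕ)
    (e : Tm C₁) : (σ.updJ x e).fcomp τ = (σ.fcomp τ).updJ x (e.gs τ) := by
  ext : 1
  · rfl
  · funext y
    simp only [fcomp, updJ_onVarJ]
    split_ifs <;> rfl
  all_goals rfl

/-- Substituting for the variable of a renamed binder. -/
theorem Fm.gs_updP_gs_updP {x z : ℕ} {φ : Fm C D} {σ : FSubst C D C₁ D₁}
    (hz : z ∉ supP σ x φ) (τ : FSubst C₁ D₁ C₂ D₂) (e : Fm C₂ D₂) :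
    (φ.gs (σ.updP x (var z))).gs (τ.updP z e) = φ.gs ((σ.fcomp τ).updP x e) := by
  refine Subtype.ext ?_
  simp only [gs, PreFm.gs_gs, LSubst.toPre_fcomp, LSubst.toPre_updP]
  exact PreFm.gs_congr _ (PreFm.Agree.updP_comp hz _ _)

theorem Fm.gs_updJ_gs_updJ {u z : ℕ} {φ : Fm C D} {σ : FSubst C D C₁ D₁}
    (hz : z ∉ supJ σ u φ) (τ : FSubst C₁ D₁ C₂ D₂) (e : Tm C₂) :
    (φ.gs (σ.updJ u (.var z))).gs (τ.updJ z e) = φ.gs ((σ.fcomp τ).updJ u e) := by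
  refine Subtype.ext ?_
  simp only [gs, PreFm.gs_gs, LSubst.toPre_fcomp, LSubst.toPre_updJ]
  exact PreFm.gs_congr _ (PreFm.Agree.updJ_comp hz _ _)

/-- The identity substitution. -/
def idL : FSubst C D C D := ⟨Fm.var, Tm.var, Fm.con, Tm.con⟩

@[simp] theorem Tm.gs_idL (t : Tm C) : t.gs (idL : FSubst C D C D) = t := by
  induction t <;> simp_all [Tm.gs, idL]

-- The identity is neutral only on this side: `σ.fcomp idL` renames the bound variables in the
-- values of `σ`.
@[simp] theorem idL_fcomp (σ : FSubst C D C₁ D₁) : idL.fcomp σ = σ := rfl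

theorem Fm.substP_eq_gs (φ : Fm C D) (x : ℕ) (ψ : Fm C D) :
    φ.substP x ψ = φ.gs (idL.updP x ψ) := by
  rw [substP, subst_eq_gs]; rfl

theorem Fm.substJ_eq_gs (φ : Fm C D) (u : ℕ) (t : Tm C) :
    φ.substJ u t = φ.gs (idL.updJ u t) := by
  rw [substJ, subst_eq_gs]; rfl

theorem Fm.subst_ofVars_eq_gs (φ : Fm C D) (p : ℕ → Fm C D) (j : ℕ → Tm C) :
    φ.subst (Subst.ofVars p j) = φ.gs ⟨p, j, con, .con⟩ := by
  rw [subst_eq_gs]; rfl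

theorem Tm.subst_ofVars_eq_gs (t : Tm C) (p : ℕ → Fm C D) (j : ℕ → Tm C) :
    t.subst (Subst.ofVars p j) = t.gs (⟨p, j, Fm.con, .con⟩ : FSubst C D C D) := by
  rw [subst_eq_gs]; rfl

/-! ### Alpha-congruence and normal forms -/

/-- The canonical representative of the alpha-congruence class of `φ`. -/
def Fm.nf (φ : Fm C D) : Fm C D := φ.gs idL

theorem Fm.nf_gs (φ : Fm C D) (σ : FSubst C D C₁ D₁) : (φ.gs σ).nf = φ.gs (σ.fcomp idL) :=
  gs_gs _ _ _

/-- Normalizing the values is idempotent. This is the rule by which two normal forms are compared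
throughout. -/
theorem LSubst.fcomp_idL_idL (σ : FSubst C D C₁ D₁) :
    (σ.fcomp idL).fcomp idL = σ.fcomp idL := by
  rw [fcomp_assoc]; rfl

/-- Alpha-congruent formulas have the same free variables and constants. -/
theorem AlphaEq.occ {φ ψ : Fm C D} (h : AlphaEq φ ψ) :
    φ.fvarP = ψ.fvarP ∧ φ.fvarJ = ψ.fvarJ ∧ φ.conP = ψ.conP ∧ φ.conJ = ψ.conJ := by
  induction h with
  | refl => simp
  | symm _ ih => simp [ih]
  | trans _ _ ih₁ ih₂ => simp [ih₁, ih₂]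
  | @allP x y φ ψ hx hy _ hxy ih =>
    obtain ⟨h1, h2, h3, h4⟩ := ih
    rw [Fm.substP_eq_gs] at h1 h2 h3 h4
    refine ⟨?_, ?_, ?_, ?_⟩ <;> ext i
    · simp only [Fm.allP, Fm.fvarP, PreFm.fvarP, Finset.mem_erase]
      rw [Fm.fvarP] at h1
      rw [h1, Fm.mem_fvarP_gs]
      constructor
      · rintro ⟨hi, ⟨z, hz, h⟩ | ⟨d, hd, h⟩⟩
        · rw [LSubst.updP_onVarP] at h
          split_ifs at h with hzy
          · simp [hi] at h
          · simp only [Fm.fvarP_var, idL, Finset.mem_singleton] at h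
            subst h; exact ⟨hzy, hz⟩
        · simp [idL] at h
      · rintro ⟨hi, h⟩
        refine ⟨?_, .inl ⟨i, h, by simp [hi, idL]⟩⟩
        rintro rfl
        exact hxy (Ne.symm hi) h
    · simp only [Fm.allP, Fm.fvarJ, PreFm.fvarJ]
      rw [Fm.fvarJ] at h2
      rw [h2, Fm.mem_fvarJ_gs]
      constructor
      · rintro ((⟨z, hz, h⟩ | ⟨z, hz, h⟩) | ⟨d, hd, h⟩ | ⟨d, hd, h⟩)
        · rw [LSubst.updP_onVarP] at h
          split_ifs at h <;> simp [idL] at h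
        · simp only [LSubst.updP_onVarJ, Tm.vars, idL, Finset.mem_singleton] at h
          subst h; exact hz
        · simp [idL] at h
        · simp [Tm.vars, idL] at h
      · intro h
        exact .inl (.inr ⟨i, h, by simp [Tm.vars, idL]⟩)
    · simp only [Fm.allP, Fm.conP, PreFm.conP]
      rw [Fm.conP] at h3
      rw [h3, Fm.mem_conP_gs]
      constructor
      · rintro (⟨z, hz, h⟩ | ⟨d, hd, h⟩)
        · rw [LSubst.updP_onVarP] at h
          split_ifs at h <;> simp [idL] at h
        · simp only [LSubst.updP_onConP, Fm.conP_con, idL, Finset.mem_singleton] at h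
          subst h; exact hd
      · intro h
        exact .inr ⟨i, h, by simp [idL]⟩
    · simp only [Fm.allP, Fm.conJ, PreFm.conJ]
      rw [Fm.conJ] at h4
      rw [h4, Fm.mem_conJ_gs]
      constructor
      · rintro ((⟨z, hz, h⟩ | ⟨z, hz, h⟩) | ⟨d, hd, h⟩ | ⟨d, hd, h⟩)
        · rw [LSubst.updP_onVarP] at h
          split_ifs at h <;> simp [idL] at h
        · simp [Tm.cons, idL] at h
        · simp [idL] at h
        · simp only [LSubst.updP_onConJ, Tm.cons, idL, Finset.mem_singleton] at h
          subst h; exact hd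
      · intro h
        exact .inr (.inr ⟨i, h, by simp [Tm.cons, idL]⟩)
  | @allJ x y φ ψ hx hy _ hxy ih =>
    obtain ⟨h1, h2, h3, h4⟩ := ih
    rw [Fm.substJ_eq_gs] at h1 h2 h3 h4
    refine ⟨?_, ?_, ?_, ?_⟩ <;> ext i
    · simp only [Fm.allJ, Fm.fvarP, PreFm.fvarP]
      rw [Fm.fvarP] at h1
      rw [h1, Fm.mem_fvarP_gs]
      simp [idL]
      rfl
    · simp only [Fm.allJ, Fm.fvarJ, PreFm.fvarJ, Finset.mem_erase]
      rw [Fm.fvarJ] at h2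
      rw [h2, Fm.mem_fvarJ_gs]
      constructor
      · rintro ⟨hi, (⟨z, hz, h⟩ | ⟨z, hz, h⟩) | ⟨d, hd, h⟩ | ⟨d, hd, h⟩⟩
        · simp [idL] at h
        · rw [LSubst.updJ_onVarJ] at h
          split_ifs at h with hzy
          · simp [Tm.vars, hi] at h
          · simp only [Tm.vars, idL, Finset.mem_singleton] at h
            subst h; exact ⟨hzy, hz⟩
        · simp [idL] at h
        · simp [Tm.vars, idL] at h
      · rintro ⟨hi, h⟩
        refine ⟨?_, .inl (.inr ⟨i, h, by simp [hi, Tm.vars, idL]⟩)⟩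
        rintro rfl
        exact hxy (Ne.symm hi) h
    · simp only [Fm.allJ, Fm.conP, PreFm.conP]
      rw [Fm.conP] at h3
      rw [h3, Fm.mem_conP_gs]
      simp [idL]
      rfl
    · simp only [Fm.allJ, Fm.conJ, PreFm.conJ]
      rw [Fm.conJ] at h4
      rw [h4, Fm.mem_conJ_gs]
      constructor
      · rintro ((⟨z, hz, h⟩ | ⟨z, hz, h⟩) | ⟨d, hd, h⟩ | ⟨d, hd, h⟩)
        · simp [idL] at h
        · rw [LSubst.updJ_onVarJ] at h
          split_ifs at h <;> simp [Tm.cons, idL] at h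
        · simp [idL] at h
        · simp only [LSubst.updJ_onConJ, Tm.cons, idL, Finset.mem_singleton] at h
          subst h; exact hd
      · intro h
        exact .inr (.inr ⟨i, h, by simp [Tm.cons, idL]⟩)
  | _ =>
    simp_all [Fm.fvarP, Fm.fvarJ, Fm.conP, Fm.conJ, Fm.imp, Fm.eqv, Fm.ref, Fm.isTrue,
      Fm.isFalse, Fm.just, Fm.neg, Fm.box, PreFm.fvarP, PreFm.fvarJ, PreFm.conP, PreFm.conJ]

/-- Alpha-congruent formulas have the same substitution instances. -/
theorem AlphaEq.gs_eq {φ ψ : Fm C D} (h : AlphaEq φ ψ) (σ : FSubst C D C₁ D₁) :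
    φ.gs σ = ψ.gs σ := by
  induction h generalizing σ with
  | refl => rfl
  | symm _ ih => exact (ih σ).symm
  | trans _ _ ih₁ ih₂ => exact (ih₁ σ).trans (ih₂ σ)
  | @allP x y φ ψ hx hy h hxy ih =>
    have hs : Fm.supP σ x φ = Fm.supP σ y ψ := by
      obtain ⟨h1, h2, h3, h4⟩ := (AlphaEq.allP hx hy h hxy).occ
      simp only [Fm.fvarP, Fm.conP, Fm.allP] at h1 h3
      simp only [Fm.supP, PreFm.supP, h1, h3]
    -- Renaming `y` to `x` in `ψ` and then `x` to `z` is renaming `y` to `z`, because `x` is not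
    -- free in `ψ` unless `x = y`. With the common forced variable the two quantified instances
    -- become identical.
    have hb : ∀ z, φ.gs (σ.updP x (.var z)) = ψ.gs (σ.updP y (.var z)) := by
      intro z
      rw [ih, Fm.substP_eq_gs, Fm.gs_gs]
      refine ψ.gs_congr (fun w hw => ?_) (fun _ _ => rfl) (fun _ _ => rfl) (fun _ _ => rfl)
      simp only [LSubst.fcomp, LSubst.updP_onVarP]
      split_ifs with hwy
      · simp
      · simp only [idL, Fm.gs_var, LSubst.updP_onVarP]
        rw [if_neg]
        rintro rfl
        exact hxy (Ne.symm hwy) hw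
    simp only [Fm.gs_allP, hb, hs]
  | @allJ x y φ ψ hx hy h hxy ih =>
    have hs : Fm.supJ σ x φ = Fm.supJ σ y ψ := by
      obtain ⟨h1, h2, h3, h4⟩ := (AlphaEq.allJ hx hy h hxy).occ
      simp only [Fm.fvarP, Fm.conP, Fm.fvarJ, Fm.conJ, Fm.allJ] at h1 h2 h3 h4
      simp only [Fm.supJ, PreFm.supJ, h1, h2, h3, h4]
    have hb : ∀ z, φ.gs (σ.updJ x (.var z)) = ψ.gs (σ.updJ y (.var z)) := by
      intro z
      rw [ih, Fm.substJ_eq_gs, Fm.gs_gs]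
      refine ψ.gs_congr (fun _ _ => rfl) (fun w hw => ?_) (fun _ _ => rfl) (fun _ _ => rfl)
      simp only [LSubst.fcomp, LSubst.updJ_onVarJ]
      split_ifs with hwy
      · simp [Tm.gs]
      · simp only [idL, Tm.gs, LSubst.updJ_onVarJ]
        rw [if_neg]
        rintro rfl
        exact hxy (Ne.symm hwy) hw
    simp only [Fm.gs_allJ, hb, hs]
  | _ => simp_all

/-- The body of the normal form is literally the renamed body that the alpha rule asks for, so no
induction hypothesis on the body is needed. -/
theorem alphaEq_nf_allP {x : ℕ} {φ : Fm C D} (h : x ∈ φ.fvarP) :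
    AlphaEq (φ.allP x h).nf (φ.allP x h) := by
  rw [Fm.nf, Fm.gs_allP]
  have hz := above_notMem (Fm.supP idL x φ)
  generalize above (Fm.supP idL x φ) = z at *
  refine .allP _ _ ?_ fun hxz hza => hz (Fm.mem_supP.mpr (.inl ⟨z, hza, hxz.symm, ?_⟩))
  · rw [Fm.substP_eq_gs]
    exact .refl _
  · simp [idL]

theorem alphaEq_nf_allJ {u : ℕ} {φ : Fm C D} (h : u ∈ φ.fvarJ) :
    AlphaEq (φ.allJ u h).nf (φ.allJ u h) := by
  rw [Fm.nf, Fm.gs_allJ]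
  have hz := above_notMem (Fm.supJ idL u φ)
  generalize above (Fm.supJ idL u φ) = z at *
  refine .allJ _ _ ?_ fun hxz hza =>
    hz (Fm.mem_supJ.mpr (.inl (.inr ⟨z, hza, hxz.symm, ?_⟩)))
  · rw [Fm.substJ_eq_gs]
    exact .refl _
  · simp [idL, Tm.vars]

theorem alphaEq_nf_just {φ : Fm C D} (t : Tm C) (h : AlphaEq φ.nf φ) :
    AlphaEq (φ.just t).nf (φ.just t) := by
  rw [Fm.nf, Fm.gs_just, Tm.gs_idL]
  exact h.just t

theorem alphaEq_nf_teq (s t : Tm C) : AlphaEq (Fm.teq s t : Fm C D).nf (Fm.teq s t) := by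
  rw [Fm.nf, Fm.gs_teq, Tm.gs_idL, Tm.gs_idL]
  exact .refl _

theorem alphaEq_nf_tle (s t : Tm C) : AlphaEq (Fm.tle s t : Fm C D).nf (Fm.tle s t) := by
  rw [Fm.nf, Fm.gs_tle, Tm.gs_idL, Tm.gs_idL]
  exact .refl _

/-- Phrased for a raw expression with its properness proof, so that structural induction is
available. -/
theorem alphaEq_nf_mk (a : PreFm C D) (h : a.Proper) :
    AlphaEq (Fm.nf ⟨a, h⟩) (⟨a, h⟩ : Fm C D) := by
  induction a with
  | var | con => exact .refl _
  | imp a b iha ihb => exact .imp (iha h.1) (ihb h.2)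
  | eqv a b iha ihb => exact .eqv (iha h.1) (ihb h.2)
  | ref a b iha ihb => exact .ref (iha h.1) (ihb h.2)
  | neg a ih => exact .neg (ih h)
  | isTrue a ih => exact .isTrue (ih h)
  | isFalse a ih => exact .isFalse (ih h)
  | box a ih => exact .box (ih h)
  | just a t ih => exact alphaEq_nf_just t (ih h)
  | teq s t => exact alphaEq_nf_teq s t
  | tle s t => exact alphaEq_nf_tle s t
  | allP x a ih => exact alphaEq_nf_allP (φ := ⟨a, h.2⟩) h.1
  | allJ x a ih => exact alphaEq_nf_allJ (φ := ⟨a, h.2⟩) h.1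

theorem alphaEq_nf (φ : Fm C D) : AlphaEq φ.nf φ := alphaEq_nf_mk φ.1 φ.2

/-- Together with `AlphaEq.gs_eq` this makes alpha-congruence an equation, provable by rewriting
with the composition laws. -/
theorem alphaEq_of_nf_eq {φ ψ : Fm C D} (h : φ.nf = ψ.nf) : AlphaEq φ ψ :=
  (alphaEq_nf φ).symm.trans (h ▸ alphaEq_nf ψ)

/-- The bound variable of a substituted quantifier may be any fresh variable. -/
theorem alphaEq_gs_allP {φ : Fm C D} {x z : ℕ} (h : x ∈ φ.fvarP) {σ : FSubst C D C₁ D₁}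
    (hz : z ∉ Fm.supP σ x φ) :
    AlphaEq ((Fm.allP x φ h).gs σ) (.allP z (φ.gs (σ.updP x (.var z)))
      (Fm.mem_fvarP_gs_updP h σ z)) := by
  rw [Fm.gs_allP]
  have hz' := above_notMem (Fm.supP σ x φ)
  generalize above (Fm.supP σ x φ) = z' at *
  refine .allP _ _ (alphaEq_of_nf_eq ?_) fun hne hm => hz' ?_
  -- Both bodies normalize to `φ` under the normalized values of `σ`, with `x` sent to `z'`.
  · rw [Fm.substP_eq_gs, Fm.gs_updP_gs_updP hz, Fm.nf_gs, Fm.nf_gs, LSubst.updP_fcomp,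
      LSubst.updP_fcomp, LSubst.fcomp_idL_idL]
  · rw [Fm.mem_fvarP_gs] at hm
    rw [Fm.mem_supP]
    refine hm.imp_left ?_
    rintro ⟨y, hy, hm⟩
    rw [LSubst.updP_onVarP] at hm
    split_ifs at hm with hyx
    · simp only [Fm.fvarP_var, Finset.mem_singleton] at hm
      exact absurd hm.symm hne
    · exact ⟨y, hy, hyx, hm⟩

theorem alphaEq_gs_allJ {φ : Fm C D} {x z : ℕ} (h : x ∈ φ.fvarJ) {σ : FSubst C D C₁ D₁}
    (hz : z ∉ Fm.supJ σ x φ) :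
    AlphaEq ((Fm.allJ x φ h).gs σ) (.allJ z (φ.gs (σ.updJ x (.var z)))
      (Fm.mem_fvarJ_gs_updJ h σ z)) := by
  rw [Fm.gs_allJ]
  have hz' := above_notMem (Fm.supJ σ x φ)
  generalize above (Fm.supJ σ x φ) = z' at *
  refine .allJ _ _ (alphaEq_of_nf_eq ?_) fun hne hm => hz' ?_
  · rw [Fm.substJ_eq_gs, Fm.gs_updJ_gs_updJ hz, Fm.nf_gs, Fm.nf_gs, LSubst.updJ_fcomp,
      LSubst.updJ_fcomp, LSubst.fcomp_idL_idL]
  · rw [Fm.mem_fvarJ_gs] at hm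
    rw [Fm.mem_supJ]
    refine hm.imp_left (Or.imp_right ?_)
    rintro ⟨y, hy, hm⟩
    rw [LSubst.updJ_onVarJ] at hm
    split_ifs at hm with hyx
    · simp only [Tm.vars, Finset.mem_singleton] at hm
      exact absurd hm.symm hne
    · exact ⟨y, hy, hyx, hm⟩

/-- Syntactical reference is preserved by substitution. -/
theorem SynRef.gs {φ ψ : Fm C D} (h : SynRef φ ψ) (σ : FSubst C D C₁ D₁) :
    SynRef (φ.gs σ) (ψ.gs σ) := by
  obtain ⟨x, χ, hne, hx, hα⟩ := h
  have hz := above_notMem (Fm.supP σ x χ)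
  generalize above (Fm.supP σ x χ) = z at *
  refine ⟨z, χ.gs (σ.updP x (.var z)), fun h => ?_, Fm.mem_fvarP_gs_updP hx σ z,
    alphaEq_of_nf_eq ?_⟩
  -- A formula other than `x` in which `x` is free is compound, hence so is its instance, which
  -- cannot be the variable `z`.
  · obtain ⟨a, ha⟩ := χ
    cases a with
    | var y =>
      simp only [Fm.fvarP, PreFm.fvarP, Finset.mem_singleton] at hx
      subst hx; exact hne rfl
    | con d => simp [Fm.fvarP, PreFm.fvarP] at hx
    | _ => exact nomatch congrArg Subtype.val h
  · rw [← hα.gs_eq, Fm.substP_eq_gs, Fm.substP_eq_gs, Fm.gs_updP_gs_updP hz, Fm.gs_gs, Fm.nf_gs,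
      Fm.nf_gs, LSubst.updP_fcomp, LSubst.updP_fcomp, LSubst.updP_fcomp, LSubst.fcomp_idL_idL]
    rfl

/-! ### Derivations and complete theories -/

theorem Schema.mem_axFour {φ : Fm C D} (h : Schema φ) : φ ∈ AxFour C D := .base (.inl h)

theorem Tautology.derives {Φ : Set (Fm C D)} {φ : Fm C D} (h : Tautology φ) :
    DerivesFour Φ φ := .ax (Schema.taut h).mem_axFour

theorem DerivesFour.mono {Φ Ψ : Set (Fm C D)} (h : Φ ⊆ Ψ) {φ : Fm C D} (hφ : DerivesFour Φ φ) :
    DerivesFour Ψ φ := by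
  induction hφ with
  | ax h => exact .ax h
  | hyp h' => exact .hyp (h h')
  | mp _ _ ih₁ ih₂ => exact .mp ih₁ ih₂

/-- The deduction theorem. -/
theorem DerivesFour.imp_intro {Φ : Set (Fm C D)} {ψ φ : Fm C D}
    (h : DerivesFour (insert ψ Φ) φ) : DerivesFour Φ (ψ.imp φ) := by
  have key : ∀ χ : Fm C D, DerivesFour Φ χ → DerivesFour Φ (ψ.imp χ) := fun χ hχ =>
    .mp (Tautology.derives (φ := χ.imp (ψ.imp χ)) fun val hi hn => by simp only [hi]; tauto) hχ
  induction h with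
  | ax h => exact key _ (.ax h)
  | @hyp χ h =>
    rcases h with rfl | h
    · exact Tautology.derives fun val hi hn => by simp only [hi]; tauto
    · exact key _ (.hyp h)
  | @mp α β _ _ ih₁ ih₂ =>
    exact .mp (.mp (Tautology.derives
      (φ := (ψ.imp (α.imp β)).imp ((ψ.imp α).imp (ψ.imp β)))
      fun val hi hn => by simp only [hi]; tauto) ih₁) ih₂

theorem DerivesFour.exists_finite {Φ : Set (Fm C D)} {φ : Fm C D} (h : DerivesFour Φ φ) :
    ∃ Ψ ⊆ Φ, Ψ.Finite ∧ DerivesFour Ψ φ := by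
  induction h with
  | ax h => exact ⟨∅, Set.empty_subset _, Set.finite_empty, .ax h⟩
  | @hyp φ h =>
    exact ⟨{φ}, Set.singleton_subset_iff.mpr h, Set.finite_singleton _, .hyp rfl⟩
  | mp _ _ ih₁ ih₂ =>
    obtain ⟨Ψ₁, h₁, f₁, d₁⟩ := ih₁
    obtain ⟨Ψ₂, h₂, f₂, d₂⟩ := ih₂
    exact ⟨Ψ₁ ∪ Ψ₂, Set.union_subset h₁ h₂, f₁.union f₂,
      .mp (DerivesFour.mono Set.subset_union_left d₁) (DerivesFour.mono Set.subset_union_right d₂)⟩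

/-- The iterated implication from the formulas of a list. -/
def impList (l : List (Fm C D)) (φ : Fm C D) : Fm C D := l.foldr Fm.imp φ

theorem DerivesFour.impList {Φ : Set (Fm C D)} {φ : Fm C D} (l : List (Fm C D))
    (h : DerivesFour (Φ ∪ {ψ | ψ ∈ l}) φ) : DerivesFour Φ (impList l φ) := by
  induction l generalizing Φ with
  | nil => exact h.mono (by simp)
  | cons a l ih =>
    refine DerivesFour.imp_intro (ih ?_)
    convert h using 1
    ext χ
    simp
    tauto

theorem DerivesFour.of_impList {Φ : Set (Fm C D)} {φ : Fm C D} {l : List (Fm C D)}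
    (h : DerivesFour Φ (EpsJ.impList l φ)) (hl : ∀ ψ ∈ l, DerivesFour Φ ψ) :
    DerivesFour Φ φ := by
  induction l with
  | nil => exact h
  | cons a l ih =>
    exact ih (.mp h (hl a (by simp))) fun ψ hψ => hl ψ (by simp [hψ])

theorem DerivesFour.exists_list {Φ : Set (Fm C D)} {φ : Fm C D} (h : DerivesFour Φ φ) :
    ∃ l : List (Fm C D), (∀ ψ ∈ l, ψ ∈ Φ) ∧ DerivesFour ∅ (EpsJ.impList l φ) := by
  obtain ⟨Ψ, hΨ, hf, hd⟩ := h.exists_finite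
  refine ⟨hf.toFinset.toList, fun ψ hψ => hΨ (by simpa using hψ), .impList _ ?_⟩
  convert hd
  ext
  simp

/-- A theory that contains the axioms and decides every formula coherently. -/
structure Complete (T : Set (Fm C D)) : Prop where
  ax : AxFour C D ⊆ T
  mem_imp : ∀ φ ψ : Fm C D, φ.imp ψ ∈ T ↔ (φ ∈ T → ψ ∈ T)
  mem_neg : ∀ φ : Fm C D, φ.neg ∈ T ↔ φ ∉ T

/-- Lindenbaum's lemma. -/
theorem exists_complete {Φ : Set (Fm C D)} {φ : Fm C D} (h : ¬ DerivesFour Φ φ) :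
    ∃ T, Complete T ∧ Φ ⊆ T ∧ φ ∉ T := by
  have hchain : ∀ c ⊆ {T : Set (Fm C D) | ¬ DerivesFour T φ}, IsChain (· ⊆ ·) c → c.Nonempty →
      ¬ DerivesFour (⋃₀ c) φ := by
    intro c hc hch hne hd
    obtain ⟨Ψ, hΨ, hf, hd⟩ := hd.exists_finite
    obtain ⟨S, hS, hΨS⟩ :=
      hch.directedOn.exists_mem_subset_of_finite_of_subset_sUnion hne hf hΨ
    exact hc hS (hd.mono hΨS)
  obtain ⟨T, hΦT, hT⟩ := zorn_subset_nonempty {T : Set (Fm C D) | ¬ DerivesFour T φ}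
    (fun c hc hch hne =>
      ⟨⋃₀ c, hchain c hc hch hne, fun s hs => Set.subset_sUnion_of_mem hs⟩) Φ h
  have hcons : ¬ DerivesFour T φ := hT.prop
  -- `T` is maximal among the sets that do not derive `φ`, so `φ` takes the role of falsum: what is
  -- outside `T` implies `φ` over `T`. In particular, if neither `ψ` nor its negation were in `T`,
  -- both would imply `φ`.
  have hmem : ∀ ψ, DerivesFour T (ψ.imp φ) ∨ ψ ∈ T := by
    intro ψ
    by_contra! hcon
    have := hT.le_of_ge (y := insert ψ T) (fun hd => hcon.1 (DerivesFour.imp_intro hd))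
      (Set.subset_insert _ _)
    exact hcon.2 (this (Set.mem_insert _ _))
  have hclosed : ∀ ψ, DerivesFour T ψ → ψ ∈ T := fun ψ hψ =>
    (hmem ψ).resolve_left fun h' => hcons (.mp h' hψ)
  have hneg : ∀ ψ : Fm C D, ψ.neg ∈ T ↔ ψ ∉ T := by
    intro ψ
    constructor
    · intro hn hp
      exact hcons (.mp (.mp (Tautology.derives (φ := ψ.neg.imp (ψ.imp φ))
        fun val hi hn => by simp only [hi, hn]; tauto) (.hyp hn)) (.hyp hp))
    · intro hp
      refine (hmem _).resolve_left fun hn => hcons ?_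
      exact .mp (.mp (Tautology.derives (φ := (ψ.imp φ).imp ((ψ.neg.imp φ).imp φ))
        fun val hi hn => by simp only [hi, hn]; tauto) ((hmem ψ).resolve_right hp)) hn
  refine ⟨T, ⟨fun ψ hψ => hclosed ψ (.ax hψ), fun α β => ⟨fun hi ha =>
    hclosed _ (.mp (.hyp hi) (.hyp ha)), fun hab => hclosed _ ?_⟩, hneg⟩, hΦT,
    fun hφ => hcons (.hyp hφ)⟩
  by_cases ha : α ∈ T
  · exact .mp (Tautology.derives (φ := β.imp (α.imp β))
      fun val hi hn => by simp only [hi]; tauto) (.hyp (hab ha))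
  · exact .mp (Tautology.derives (φ := α.neg.imp (α.imp β))
      fun val hi hn => by simp only [hi, hn]; tauto) (.hyp ((hneg α).mpr ha))

/-- This turns object-level propositional derivations into ordinary logic about membership, which
commutes with the connectives in a complete theory. -/
theorem derivesFour_of_forall_complete {Φ : Set (Fm C D)} {φ : Fm C D}
    (h : ∀ T, Complete T → Φ ⊆ T → φ ∈ T) : DerivesFour Φ φ := by
  by_contra hn
  obtain ⟨T, hT, hΦ, hφ⟩ := exists_complete hn
  exact hφ (h T hT hΦ)

/-! ### Propositional and equational reasoning inside a complete theory -/

namespace Complete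

variable {T : Set (Fm C D)} (hT : Complete T)

include hT

theorem schema {φ : Fm C D} (h : Schema φ) : φ ∈ T := hT.ax h.mem_axFour

theorem mem_of_derives {Φ : Set (Fm C D)} (hΦ : Φ ⊆ T) {φ : Fm C D} (h : DerivesFour Φ φ) :
    φ ∈ T := by
  induction h with
  | ax h => exact hT.ax h
  | hyp h => exact hΦ h
  | mp _ _ ih₁ ih₂ => exact (hT.mem_imp _ _).mp ih₁ ih₂

theorem mem_and (φ ψ : Fm C D) : φ.and ψ ∈ T ↔ φ ∈ T ∧ ψ ∈ T := by
  simp only [Fm.and, hT.mem_neg, hT.mem_imp]; tauto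

theorem mem_iff (φ ψ : Fm C D) : φ.iff ψ ∈ T ↔ (φ ∈ T ↔ ψ ∈ T) := by
  simp only [Fm.iff, hT.mem_and, hT.mem_imp]; tauto

theorem mem_conjImp (l : List (Fm C D)) (φ : Fm C D) :
    Fm.conjImp l φ ∈ T ↔ ((∀ ψ ∈ l, ψ ∈ T) → φ ∈ T) := by
  have key : ∀ (l : List (Fm C D)) (χ : Fm C D),
      Fm.conj χ l ∈ T ↔ χ ∈ T ∧ ∀ ψ ∈ l, ψ ∈ T := by
    intro l
    induction l with
    | nil => simp [Fm.conj]
    | cons a l ih => intro χ; simp [Fm.conj, hT.mem_and, ih]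
  cases l with
  | nil => simp [Fm.conjImp]
  | cons a l => simp [Fm.conjImp, hT.mem_imp, key]

theorem mem_of_eqv {φ ψ : Fm C D} (h : φ.eqv ψ ∈ T) (hφ : φ ∈ T) : ψ ∈ T :=
  (hT.mem_imp _ _).mp ((hT.mem_imp _ _).mp (hT.schema (.eqv_elim φ ψ)) h) hφ

theorem eqv_refl (φ : Fm C D) : φ.eqv φ ∈ T := hT.schema (.eqv_of_alphaEq (.refl φ))

theorem mem_iff_of_alphaEq {φ ψ : Fm C D} (h : AlphaEq φ ψ) : φ ∈ T ↔ ψ ∈ T :=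
  ⟨hT.mem_of_eqv (hT.schema (.eqv_of_alphaEq h)),
    hT.mem_of_eqv (hT.schema (.eqv_of_alphaEq h.symm))⟩

theorem mem_iff_of_nf_eq {φ ψ : Fm C D} (h : φ.nf = ψ.nf) : φ ∈ T ↔ ψ ∈ T :=
  hT.mem_iff_of_alphaEq (alphaEq_of_nf_eq h)

theorem mem_tle (x : ℕ) (s t : Tm C) : .tle s t ∈ T ↔
    Fm.allP x (.imp (.just (.var x) s) (.just (.var x) t))
      (Finset.mem_union_left _ (Finset.mem_singleton_self x)) ∈ T :=
  (hT.mem_iff _ _).mp (hT.schema (.le_iff x s t))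

theorem mem_teq (s t : Tm C) : .teq s t ∈ T ↔ .tle s t ∈ T ∧ .tle t s ∈ T := by
  rw [← hT.mem_and]
  exact (hT.mem_iff _ _).mp (hT.schema (.extensionality s t))

/-- Reflexivity is obtained through the order: `t ≤ t` unfolds to a generalized tautology, and
extensionality turns it into the equation. -/
theorem teq_refl (t : Tm C) : .teq t t ∈ T := by
  have : .tle t t ∈ T := (hT.mem_tle 0 t t).mpr (hT.ax (.allP _ _ (.base (.inl (.taut
    fun val hi hn => by simp only [hi]; tauto)))))
  exact (hT.mem_teq t t).mpr ⟨this, this⟩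

/-- Substituting provably equal expressions gives provably equal formulas. -/
theorem eqv_gs (φ : Fm C D) {p p' : ℕ → Fm C D} {j j' : ℕ → Tm C}
    (hp : ∀ x ∈ φ.fvarP, (p x).eqv (p' x) ∈ T) (hj : ∀ u ∈ φ.fvarJ, .teq (j u) (j' u) ∈ T) :
    (φ.gs ⟨p, j, .con, .con⟩).eqv (φ.gs ⟨p', j', .con, .con⟩) ∈ T := by
  have := (hT.mem_conjImp _ _).mp (hT.schema (.subst_fm p p' j j' φ)) fun ψ hψ => by
    simp only [Fm.substEqs, List.mem_append, List.mem_map, Finset.mem_sort] at hψ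
    rcases hψ with ⟨x, hx, rfl⟩ | ⟨x, hx, rfl⟩
    · exact hp x hx
    · exact hj x hx
  rwa [Fm.subst_ofVars_eq_gs, Fm.subst_ofVars_eq_gs] at this

theorem teq_gs (t : Tm C) {p p' : ℕ → Fm C D} {j j' : ℕ → Tm C}
    (hj : ∀ u ∈ t.vars, .teq (j u) (j' u) ∈ T) :
    .teq (t.gs (⟨p, j, .con, .con⟩ : FSubst C D C D))
      (t.gs (⟨p', j', .con, .con⟩ : FSubst C D C D)) ∈ T := by
  have := (hT.mem_conjImp _ _).mp (hT.schema (.subst_tm p p' j j' t)) fun ψ hψ => by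
    simp only [Tm.substEqs, List.mem_map, Finset.mem_sort] at hψ
    obtain ⟨x, hx, rfl⟩ := hψ
    exact hj x hx
  rwa [Tm.subst_ofVars_eq_gs, Tm.subst_ofVars_eq_gs] at this

/-- Replacement of two formulas and two terms in a formula. -/
theorem mem_gs_congr (χ : Fm C D) {p p' : ℕ → Fm C D} {j j' : ℕ → Tm C}
    (hp : ∀ x, (p x).eqv (p' x) ∈ T) (hj : ∀ u, .teq (j u) (j' u) ∈ T)
    (h : χ.gs ⟨p, j, .con, .con⟩ ∈ T) : χ.gs ⟨p', j', .con, .con⟩ ∈ T :=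
  hT.mem_of_eqv (hT.eqv_gs χ (fun x _ => hp x) (fun u _ => hj u)) h

/-- Leibniz' argument: replace the left occurrence of `φ` in `φ ≡ φ`. The template with the
variables 0 and 1 marks the place of replacement, here and in the congruences below. -/
theorem eqv_symm {φ ψ : Fm C D} (h : φ.eqv ψ ∈ T) : ψ.eqv φ ∈ T :=
  hT.mem_gs_congr (.eqv (.var 0) (.var 1)) (p := fun _ => φ)
    (p' := fun n => if n = 0 then ψ else φ) (j := .var) (j' := .var)
    (fun n => by by_cases hn : n = 0 <;> simp [hn, h, hT.eqv_refl]) (fun u => hT.teq_refl _)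
    (hT.eqv_refl φ)

theorem eqv_trans {φ ψ χ : Fm C D} (h : φ.eqv ψ ∈ T) (h' : ψ.eqv χ ∈ T) : φ.eqv χ ∈ T :=
  hT.mem_gs_congr (.eqv (.var 0) (.var 1)) (p := fun n => if n = 0 then φ else ψ)
    (p' := fun n => if n = 0 then φ else χ) (j := .var) (j' := .var)
    (fun n => by by_cases hn : n = 0 <;> simp [hn, h', hT.eqv_refl]) (fun u => hT.teq_refl _) h

theorem teq_symm {s t : Tm C} (h : .teq s t ∈ T) : .teq t s ∈ T := by
  rw [hT.mem_teq] at h ⊢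
  exact h.symm

theorem just_congr {φ φ' : Fm C D} {t t' : Tm C} (hφ : φ.eqv φ' ∈ T) (ht : .teq t t' ∈ T)
    (h : φ.just t ∈ T) : φ'.just t' ∈ T := by
  have := hT.mem_gs_congr (.just (.var 0) (.var 0)) (p := fun _ => φ) (p' := fun _ => φ')
    (j := fun _ => t) (j' := fun _ => t') (fun n => hφ) (fun u => ht) (by simpa [Tm.gs] using h)
  simpa [Tm.gs] using this

theorem ref_congr {φ φ' ψ ψ' : Fm C D} (hφ : φ.eqv φ' ∈ T) (hψ : ψ.eqv ψ' ∈ T)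
    (h : φ.ref ψ ∈ T) : φ'.ref ψ' ∈ T :=
  hT.mem_gs_congr (.ref (.var 0) (.var 1)) (p := fun n => if n = 0 then φ else ψ)
    (p' := fun n => if n = 0 then φ' else ψ') (j := .var) (j' := .var)
    (fun n => by by_cases hn : n = 0 <;> simp [hn, hφ, hψ]) (fun u => hT.teq_refl _) h

theorem teq_trans {r s t : Tm C} (h : .teq r s ∈ T) (h' : .teq s t ∈ T) : .teq r t ∈ T := by
  have := hT.mem_gs_congr (.teq (.var 0) (.var 1)) (p := .var) (p' := .var)
    (j := fun n => if n = 0 then r else s) (j' := fun n => if n = 0 then r else t)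
    (fun u => hT.eqv_refl _)
    (fun n => by by_cases hn : n = 0 <;> simp [hn, h', hT.teq_refl]) (by simpa [Tm.gs] using h)
  simpa [Tm.gs] using this

theorem app_congr {s s' t t' : Tm C} (hs : .teq s s' ∈ T) (ht : .teq t t' ∈ T) :
    .teq (.app s t) (.app s' t') ∈ T :=
  hT.teq_gs (.app (.var 0) (.var 1)) (p := .var) (p' := .var)
    (j := fun n => if n = 0 then s else t) (j' := fun n => if n = 0 then s' else t')
    (fun n _ => by by_cases hn : n = 0 <;> simp [hn, hs, ht])

theorem plus_congr {s s' t t' : Tm C} (hs : .teq s s' ∈ T) (ht : .teq t t' ∈ T) :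
    .teq (.plus s t) (.plus s' t') ∈ T :=
  hT.teq_gs (.plus (.var 0) (.var 1)) (p := .var) (p' := .var)
    (j := fun n => if n = 0 then s else t) (j' := fun n => if n = 0 then s' else t')
    (fun n _ => by by_cases hn : n = 0 <;> simp [hn, hs, ht])

end Complete

/-- Generalization over a propositional variable. -/
theorem DerivesFour.allP {φ : Fm C D} (h : DerivesFour ∅ φ) {x : ℕ} (hx : x ∈ φ.fvarP) :
    DerivesFour ∅ (φ.allP x hx) := by
  induction h with
  | ax h => exact .ax (.allP x hx h)
  | hyp h => exact absurd h (Set.notMem_empty _)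
  | @mp ψ φ hi hψ ih₁ ih₂ =>
    have hi' := ih₁ (Finset.mem_union_right _ hx)
    -- Vacuous quantification does not exist, so distributing the quantifier makes sense only if `x`
    -- is free in the premise; otherwise it is shifted past the premise.
    by_cases hxψ : x ∈ ψ.fvarP
    · exact .mp (.mp (.ax (Schema.allP_dist x ψ φ hxψ hx).mem_axFour) hi') (ih₂ hxψ)
    · exact .mp (.mp (.ax (Schema.allP_shift x ψ φ hxψ hx).mem_axFour) hi') hψ

/-- Generalization over a justification variable. -/
theorem DerivesFour.allJ {φ : Fm C D} (h : DerivesFour ∅ φ) {x : ℕ} (hx : x ∈ φ.fvarJ) :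
    DerivesFour ∅ (φ.allJ x hx) := by
  induction h with
  | ax h => exact .ax (.allJ x hx h)
  | hyp h => exact absurd h (Set.notMem_empty _)
  | @mp ψ φ hi hψ ih₁ ih₂ =>
    have hi' := ih₁ (Finset.mem_union_right _ hx)
    by_cases hxψ : x ∈ ψ.fvarJ
    · exact .mp (.mp (.ax (Schema.allJ_dist x ψ φ hxψ hx).mem_axFour) hi') (ih₂ hxψ)
    · exact .mp (.mp (.ax (Schema.allJ_shift x ψ φ hxψ hx).mem_axFour) hi') hψ

/-! ### Derivability is closed under substitution -/

namespace Complete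

variable {T : Set (Fm C₁ D₁)} (hT : Complete T)

include hT

/-- The axiom on terms speaks about one language and fixed constants only. Terms have no binders, so
congruence of the two operations suffices instead. -/
theorem teq_gs_of_forall (t : Tm C) {σ σ' : FSubst C D C₁ D₁}
    (hj : ∀ u ∈ t.vars, .teq (σ.onVarJ u) (σ'.onVarJ u) ∈ T)
    (hc : ∀ c, σ.onConJ c = σ'.onConJ c) : .teq (t.gs σ) (t.gs σ') ∈ T := by
  induction t with
  | var i => exact hj i (Finset.mem_singleton_self i)
  | con c => simp only [Tm.gs, hc]; exact hT.teq_refl _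
  | app s t ihs iht =>
    exact hT.app_congr (ihs fun u hu => hj u (Finset.mem_union_left _ hu))
      (iht fun u hu => hj u (Finset.mem_union_right _ hu))
  | plus s t ihs iht =>
    exact hT.plus_congr (ihs fun u hu => hj u (Finset.mem_union_left _ hu))
      (iht fun u hu => hj u (Finset.mem_union_right _ hu))

end Complete

/-! ### Equal substitutions that move constants -/

/-- The renaming of all variables to those with odd indices. -/
def oddVars : FSubst C D C D :=
  ⟨fun x => .var (2 * x + 1), fun u => .var (2 * u + 1), .con, .con⟩

/-- The substitution that acts like `σ` at the variables with even indices and inverts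
`oddVars`. -/
def splitVars (σ : FSubst C D C₁ D₁) : FSubst C₁ D₁ C₁ D₁ :=
  ⟨fun n => if n % 2 = 0 then σ.onVarP (n / 2) else .var (n / 2),
    fun n => if n % 2 = 0 then σ.onVarJ (n / 2) else .var (n / 2), .con, .con⟩

/-- Keep the variables apart from those in the images of constants under `σ`. -/
def separate (σ : FSubst C D C₁ D₁) : FSubst C D C₁ D₁ :=
  ⟨fun x => .var (2 * x), fun u => .var (2 * u), fun d => (σ.onConP d).gs oddVars,
    fun c => (σ.onConJ c).gs (oddVars : FSubst C₁ D₁ C₁ D₁)⟩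

theorem oddVars_fcomp_splitVars (σ : FSubst C D C₁ D₁) : oddVars.fcomp (splitVars σ) = idL := by
  ext x : 2
  · have h : (2 * x + 1) / 2 = x := by omega
    simp [LSubst.fcomp, oddVars, splitVars, idL, h]
  · have h : (2 * x + 1) / 2 = x := by omega
    simp [LSubst.fcomp, oddVars, splitVars, idL, Tm.gs, h]
  all_goals rfl

/-- Constants are treated first, with the variables of their images moved to odd indices; the values
at the variables, parked at even indices, come second, by a substitution that fixes the constants.
The images of the constants return normalized, whence the assumption that they are normal. -/
theorem gs_separate {σ : FSubst C D C₁ D₁} {σ' : FSubst C D C₁ D₁} (hP : σ'.onConP = σ.onConP)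
    (hJ : σ'.onConJ = σ.onConJ) (hnf : ∀ d, (σ.onConP d).nf = σ.onConP d) (φ : Fm C D) :
    (φ.gs (separate σ)).gs (splitVars σ') = φ.gs σ' := by
  rw [Fm.gs_gs]
  congr 1
  ext x : 2
  · simp [LSubst.fcomp, separate, splitVars]
  · simp [LSubst.fcomp, separate, splitVars, Tm.gs]
  · change ((σ.onConP x).gs oddVars).gs (splitVars σ') = σ'.onConP x
    rw [Fm.gs_gs, oddVars_fcomp_splitVars, hP]
    exact hnf x
  · change ((σ.onConJ x).gs (oddVars : FSubst C₁ D₁ C₁ D₁)).gs (splitVars σ') = σ'.onConJ x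
    rw [Tm.gs_fcomp, oddVars_fcomp_splitVars, hJ, Tm.gs_idL]

theorem odd_of_mem_fvarP_gs_oddVars {φ : Fm C D} {n : ℕ} (h : n ∈ (φ.gs oddVars).fvarP) :
    n % 2 = 1 := by
  rw [Fm.mem_fvarP_gs] at h
  rcases h with ⟨x, _, h⟩ | ⟨d, _, h⟩
  · simp only [oddVars, Fm.fvarP_var, Finset.mem_singleton] at h
    omega
  · simp [oddVars] at h

theorem odd_of_mem_vars_gs_oddVars {t : Tm C} {n : ℕ}
    (h : n ∈ (t.gs (oddVars : FSubst C D C D)).vars) : n % 2 = 1 := by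
  rw [Tm.mem_vars_gs] at h
  rcases h with ⟨x, _, h⟩ | ⟨d, _, h⟩
  · simp only [oddVars, Tm.vars, Finset.mem_singleton] at h
    omega
  · simp [oddVars, Tm.vars] at h

theorem odd_of_mem_fvarJ_gs_oddVars {φ : Fm C D} {n : ℕ} (h : n ∈ (φ.gs oddVars).fvarJ) :
    n % 2 = 1 := by
  rw [Fm.mem_fvarJ_gs] at h
  rcases h with (⟨x, _, h⟩ | ⟨x, _, h⟩) | ⟨d, _, h⟩ | ⟨d, _, h⟩
  · simp [oddVars] at h
  · simp only [oddVars, Tm.vars, Finset.mem_singleton] at h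
    omega
  · simp [oddVars] at h
  · simp [oddVars, Tm.vars] at h

/-- By `gs_separate` both sides are instances of one formula of the target language under
substitutions that fix its constants, so the axiom on equal substitutions applies. The two
substitutions coincide at odd indices, and at even ones they are equal by assumption. -/
theorem Complete.eqv_gs_of_forall {T : Set (Fm C₁ D₁)} (hT : Complete T) (φ : Fm C D)
    {σ σ' : FSubst C D C₁ D₁} (hp : ∀ x ∈ φ.fvarP, (σ.onVarP x).eqv (σ'.onVarP x) ∈ T)
    (hj : ∀ u ∈ φ.fvarJ, .teq (σ.onVarJ u) (σ'.onVarJ u) ∈ T)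
    (hcP : σ'.onConP = σ.onConP) (hcJ : σ'.onConJ = σ.onConJ)
    (hnf : ∀ d, (σ.onConP d).nf = σ.onConP d) : (φ.gs σ).eqv (φ.gs σ') ∈ T := by
  rw [← gs_separate rfl rfl hnf, ← gs_separate (σ := σ) (σ' := σ') hcP hcJ hnf]
  refine hT.eqv_gs _ (fun n hn => ?_) (fun n hn => ?_)
  · by_cases h2 : n % 2 = 0
    · simp only [h2, if_true]
      refine hp _ ?_
      -- An even variable cannot come from the image of a constant, so it is `2 * x` for some `x`
      -- free in `φ`.
      rw [Fm.mem_fvarP_gs] at hn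
      rcases hn with ⟨x, hx, h⟩ | ⟨d, _, h⟩
      · simp only [separate, Fm.fvarP_var, Finset.mem_singleton] at h
        rwa [h, Nat.mul_div_cancel_left _ two_pos]
      · have := odd_of_mem_fvarP_gs_oddVars h
        omega
    · simp only [h2, if_false]
      exact hT.eqv_refl _
  · by_cases h2 : n % 2 = 0
    · simp only [h2, if_true]
      refine hj _ ?_
      rw [Fm.mem_fvarJ_gs] at hn
      rcases hn with (⟨x, hx, h⟩ | ⟨x, hx, h⟩) | ⟨d, _, h⟩ | ⟨d, _, h⟩
      · simp [separate] at h
      · simp only [separate, Tm.vars, Finset.mem_singleton] at h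
        rwa [h, Nat.mul_div_cancel_left _ two_pos]
      · have := odd_of_mem_fvarJ_gs_oddVars h
        omega
      · have := odd_of_mem_vars_gs_oddVars h
        omega
    · simp only [h2, if_false]
      exact hT.teq_refl _

theorem Fm.allP_congr {φ ψ : Fm C D} (h : φ = ψ) {x : ℕ} (hx : x ∈ φ.fvarP)
    (hx' : x ∈ ψ.fvarP) : φ.allP x hx = ψ.allP x hx' := by
  subst h; rfl

theorem Fm.allJ_congr {φ ψ : Fm C D} (h : φ = ψ) {x : ℕ} (hx : x ∈ φ.fvarJ)
    (hx' : x ∈ ψ.fvarJ) : φ.allJ x hx = ψ.allJ x hx' := by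
  subst h; rfl

theorem Fm.gs_conj (σ : FSubst C D C₁ D₁) (φ : Fm C D) (l : List (Fm C D)) :
    (Fm.conj φ l).gs σ = Fm.conj (φ.gs σ) (l.map fun ψ => ψ.gs σ) := by
  induction l generalizing φ with
  | nil => rfl
  | cons a l ih => simp [conj, ih]

theorem Fm.gs_conjImp (σ : FSubst C D C₁ D₁) (φ : Fm C D) (l : List (Fm C D)) :
    (Fm.conjImp l φ).gs σ = Fm.conjImp (l.map fun ψ => ψ.gs σ) (φ.gs σ) := by
  cases l with
  | nil => rfl
  | cons a l => simp [conjImp, gs_conj]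

theorem Fm.gs_updP_of_notMem {φ : Fm C D} {x : ℕ} (h : x ∉ φ.fvarP) (σ : FSubst C D C₁ D₁)
    (e : Fm C₁ D₁) : φ.gs (σ.updP x e) = φ.gs σ := by
  refine φ.gs_congr (fun y hy => ?_) (fun _ _ => rfl) (fun _ _ => rfl) (fun _ _ => rfl)
  rw [LSubst.updP_onVarP, if_neg]
  rintro rfl
  exact h hy

theorem Fm.gs_updJ_of_notMem {φ : Fm C D} {x : ℕ} (h : x ∉ φ.fvarJ) (σ : FSubst C D C₁ D₁)
    (e : Tm C₁) : φ.gs (σ.updJ x e) = φ.gs σ := by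
  refine φ.gs_congr (fun _ _ => rfl) (fun y hy => ?_) (fun _ _ => rfl) (fun _ _ => rfl)
  rw [LSubst.updJ_onVarJ, if_neg]
  rintro rfl
  exact h hy

theorem Fm.gs_substP (φ : Fm C D) (x : ℕ) (ψ : Fm C D) (σ : FSubst C D C₁ D₁) :
    (φ.substP x ψ).gs σ = φ.gs (σ.updP x (ψ.gs σ)) := by
  rw [substP_eq_gs, gs_gs, LSubst.updP_fcomp, idL_fcomp]

theorem Fm.gs_substJ (φ : Fm C D) (x : ℕ) (t : Tm C) (σ : FSubst C D C₁ D₁) :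
    (φ.substJ x t).gs σ = φ.gs (σ.updJ x (t.gs σ)) := by
  rw [substJ_eq_gs, gs_gs, LSubst.updJ_fcomp, idL_fcomp]

/-! ### Substitution instances of axioms -/

namespace Complete

variable {T : Set (Fm C₁ D₁)} (hT : Complete T)

include hT

/-- Instantiating through the renamed binder normalizes the values of `σ`, so the two formulas need
not be identical; their normal forms are, and `T` does not distinguish alpha-congruent formulas. -/
theorem mem_gs_updP_iff {x z : ℕ} {φ : Fm C D} {σ : FSubst C D C₁ D₁}
    (hz : z ∉ Fm.supP σ x φ) (e : Fm C₁ D₁) :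
    (φ.gs (σ.updP x (.var z))).substP z e ∈ T ↔ φ.gs (σ.updP x e) ∈ T := by
  refine hT.mem_iff_of_nf_eq ?_
  rw [Fm.substP_eq_gs, Fm.gs_updP_gs_updP hz, Fm.nf_gs, Fm.nf_gs, LSubst.updP_fcomp,
    LSubst.updP_fcomp, LSubst.fcomp_idL_idL]

theorem mem_gs_updJ_iff {x z : ℕ} {φ : Fm C D} {σ : FSubst C D C₁ D₁}
    (hz : z ∉ Fm.supJ σ x φ) (e : Tm C₁) :
    (φ.gs (σ.updJ x (.var z))).substJ z e ∈ T ↔ φ.gs (σ.updJ x e) ∈ T := by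
  refine hT.mem_iff_of_nf_eq ?_
  rw [Fm.substJ_eq_gs, Fm.gs_updJ_gs_updJ hz, Fm.nf_gs, Fm.nf_gs, LSubst.updJ_fcomp,
    LSubst.updJ_fcomp, LSubst.fcomp_idL_idL, Tm.gs_idL]

theorem mem_gs_updP_of_allP {x : ℕ} {φ : Fm C D} {h : x ∈ φ.fvarP} {σ : FSubst C D C₁ D₁}
    (hφ : (φ.allP x h).gs σ ∈ T) (e : Fm C₁ D₁) : φ.gs (σ.updP x e) ∈ T := by
  rw [Fm.gs_allP] at hφ
  exact (hT.mem_gs_updP_iff (above_notMem _) e).mp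
    ((hT.mem_imp _ _).mp (hT.schema (.allP_elim _ _ _ _)) hφ)

theorem mem_gs_updJ_of_allJ {x : ℕ} {φ : Fm C D} {h : x ∈ φ.fvarJ} {σ : FSubst C D C₁ D₁}
    (hφ : (φ.allJ x h).gs σ ∈ T) (e : Tm C₁) : φ.gs (σ.updJ x e) ∈ T := by
  rw [Fm.gs_allJ] at hφ
  exact (hT.mem_gs_updJ_iff (above_notMem _) e).mp
    ((hT.mem_imp _ _).mp (hT.schema (.allJ_elim _ _ _ _)) hφ)

/-- Substitution instances of axioms are derivable. -/
theorem schema_gs {χ : Fm C D} (h : Schema χ) {τ : FSubst C D C₁ D₁}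
    (hτ : ∀ d, (τ.onConP d).nf = τ.onConP d) : χ.gs τ ∈ T := by
  cases h with
  | taut h => 
    -- Membership of the instance in `T` is itself a classical valuation.
    exact h (fun ψ => ψ.gs τ ∈ T) (fun α β => hT.mem_imp (α.gs τ) (β.gs τ))
      (fun α => hT.mem_neg (α.gs τ))
  | tarski_true φ => exact hT.schema (.tarski_true (φ.gs τ))
  | tarski_false φ => exact hT.schema (.tarski_false (φ.gs τ))
  | application φ ψ s t => simpa [Tm.gs] using hT.schema (.application _ _ _ _)
  | weakening_left φ s t => simpa [Tm.gs] using hT.schema (.weakening_left _ _ _)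
  | weakening_right φ s t => simpa [Tm.gs] using hT.schema (.weakening_right _ _ _)
  | necessity φ u hu =>
    have hu' : u ∈ (Fm.neg (φ.just (.var u))).fvarJ :=
      Finset.mem_union_right _ (Finset.mem_singleton_self u)
    change Fm.iff (φ.gs τ).box (Fm.neg ((Fm.allJ u (Fm.neg (φ.just (.var u))) hu').gs τ)) ∈ T
    rw [Fm.gs_allJ]
    have hz := above_notMem (Fm.supJ τ u (Fm.neg (φ.just (.var u))))
    generalize above (Fm.supJ τ u (Fm.neg (φ.just (.var u)))) = z at *
    -- Since `u` is not free in `φ`, omitting it from the forced set loses no free variable of the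
    -- instance of `φ`.
    have hz' : z ∉ (φ.gs τ).fvarJ := by
      intro h
      rw [Fm.mem_fvarJ_gs] at h
      refine hz (Fm.mem_supJ.mpr (h.imp (Or.imp_right ?_) (Or.imp_right ?_)))
      · rintro ⟨v, hv, h⟩
        exact ⟨v, Finset.mem_union_left _ hv, fun hvu => hu (hvu ▸ hv), h⟩
      · rintro ⟨v, hv, h⟩
        exact ⟨v, by classical exact Finset.mem_union_left _ hv, h⟩
    rw [Fm.allJ_congr (ψ := Fm.neg ((φ.gs τ).just (.var z)))
      (by simp [Tm.gs, Fm.gs_updJ_of_notMem hu]) _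
      (Finset.mem_union_right _ (Finset.mem_singleton_self z))]
    exact hT.schema (.necessity (φ.gs τ) z hz')
  | box_elim φ => exact hT.schema (.box_elim (φ.gs τ))
  | ref_of_synRef h => exact hT.schema (.ref_of_synRef (h.gs τ))
  | ref_trans φ ψ χ => exact hT.schema (.ref_trans (φ.gs τ) (ψ.gs τ) (χ.gs τ))
  | eqv_of_alphaEq h =>
    rw [Fm.gs_eqv, h.gs_eq τ]
    exact hT.eqv_refl _
  | eqv_elim φ ψ => exact hT.schema (.eqv_elim (φ.gs τ) (ψ.gs τ))
  | subst_fm p p' j j' φ =>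
    rw [Fm.gs_conjImp, hT.mem_conjImp]
    intro hl
    simp only [Fm.substEqs, List.mem_map, List.mem_append, Finset.mem_sort] at hl
    rw [Fm.gs_eqv, Fm.subst_ofVars_eq_gs, Fm.subst_ofVars_eq_gs, Fm.gs_gs, Fm.gs_gs]
    -- The composites send constants wherever `τ` does, so the axiom itself is not applicable.
    refine hT.eqv_gs_of_forall φ (fun x hx => ?_) (fun u hu => ?_) rfl rfl hτ
    · exact hl _ ⟨_, .inl ⟨x, hx, rfl⟩, rfl⟩
    · exact hl _ ⟨_, .inr ⟨u, hu, rfl⟩, Fm.gs_teq _ _ _⟩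
  | exJ_intro u φ t h =>
    rw [Fm.gs_imp, hT.mem_imp, Fm.exJ, Fm.gs_neg, hT.mem_neg, Fm.gs_substJ]
    intro h1 h2
    exact (hT.mem_neg (φ.gs (τ.updJ u (t.gs τ)))).mp (hT.mem_gs_updJ_of_allJ h2 (t.gs τ)) h1
  | allJ_elim u φ t h =>
    rw [Fm.gs_imp, hT.mem_imp, Fm.gs_substJ]
    exact fun h => hT.mem_gs_updJ_of_allJ h _
  | allJ_dist u ψ φ hψ hφ =>
    have hz := above_notMem (Fm.supJ τ u (ψ.imp φ))
    generalize above (Fm.supJ τ u (ψ.imp φ)) = z at *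
    -- The three quantified formulas may have different forced binders. A variable fresh for the
    -- implication is fresh for both parts, so all three are renamed to it by alpha-congruence.
    have hsub : Fm.supJ τ u ψ ⊆ Fm.supJ τ u (ψ.imp φ) ∧
        Fm.supJ τ u φ ⊆ Fm.supJ τ u (ψ.imp φ) := by
      constructor <;> intro i <;> simp only [Fm.mem_supJ, Fm.fvarP_imp, Fm.fvarJ_imp,
        Fm.mem_conP_imp, Fm.mem_conJ_imp, Finset.mem_union] <;> grind
    rw [Fm.gs_imp, Fm.gs_imp, hT.mem_imp, hT.mem_imp]
    intro h1 h2
    have := hT.schema (.allJ_dist z (ψ.gs (τ.updJ u (.var z))) (φ.gs (τ.updJ u (.var z)))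
      (Fm.mem_fvarJ_gs_updJ hψ _ _) (Fm.mem_fvarJ_gs_updJ hφ _ _))
    rw [hT.mem_imp, hT.mem_imp] at this
    exact (hT.mem_iff_of_alphaEq (alphaEq_gs_allJ hφ (fun h => hz (hsub.2 h)))).mpr
      (this ((hT.mem_iff_of_alphaEq (alphaEq_gs_allJ _ hz)).mp h1)
        ((hT.mem_iff_of_alphaEq (alphaEq_gs_allJ hψ (fun h => hz (hsub.1 h)))).mp h2))
  | allJ_shift u ψ φ hψ hφ =>
    have hz := above_notMem (Fm.supJ τ u (ψ.imp φ))
    generalize above (Fm.supJ τ u (ψ.imp φ)) = z at *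
    have hsub : (ψ.gs τ).fvarJ ⊆ Fm.supJ τ u (ψ.imp φ) ∧
        Fm.supJ τ u φ ⊆ Fm.supJ τ u (ψ.imp φ) := by
      constructor <;> intro i <;> simp only [Fm.mem_supJ, Fm.mem_fvarJ_gs, Fm.fvarP_imp, Fm.fvarJ_imp,
        Fm.mem_conP_imp, Fm.mem_conJ_imp, Finset.mem_union] <;> grind
    rw [Fm.gs_imp, Fm.gs_imp, hT.mem_imp, hT.mem_imp]
    intro h1 h2
    have := hT.schema (.allJ_shift z (ψ.gs τ) (φ.gs (τ.updJ u (.var z)))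
      (fun h => hz (hsub.1 h)) (Fm.mem_fvarJ_gs_updJ hφ _ _))
    rw [hT.mem_imp, hT.mem_imp] at this
    refine (hT.mem_iff_of_alphaEq (alphaEq_gs_allJ hφ (fun h => hz (hsub.2 h)))).mpr
      (this ?_ h2)
    have h1' := (hT.mem_iff_of_alphaEq (alphaEq_gs_allJ _ hz)).mp h1
    rwa [Fm.allJ_congr (ψ := (ψ.gs τ).imp (φ.gs (τ.updJ u (.var z))))
      (by simp [Fm.gs_updJ_of_notMem hψ])] at h1'
  | exP_intro x φ ψ h =>
    rw [Fm.gs_imp, hT.mem_imp, Fm.exP, Fm.gs_neg, hT.mem_neg, Fm.gs_substP]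
    intro h1 h2
    exact (hT.mem_neg (φ.gs (τ.updP x (ψ.gs τ)))).mp (hT.mem_gs_updP_of_allP h2 (ψ.gs τ)) h1
  | allP_elim x φ ψ h =>
    rw [Fm.gs_imp, hT.mem_imp, Fm.gs_substP]
    exact fun h => hT.mem_gs_updP_of_allP h _
  | allP_dist u ψ φ hψ hφ =>
    have hz := above_notMem (Fm.supP τ u (ψ.imp φ))
    generalize above (Fm.supP τ u (ψ.imp φ)) = z at *
    have hsub : Fm.supP τ u ψ ⊆ Fm.supP τ u (ψ.imp φ) ∧
        Fm.supP τ u φ ⊆ Fm.supP τ u (ψ.imp φ) := by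
      constructor <;> intro i <;> simp only [Fm.mem_supP, Fm.fvarP_imp,
        Fm.mem_conP_imp, Finset.mem_union] <;> grind
    rw [Fm.gs_imp, Fm.gs_imp, hT.mem_imp, hT.mem_imp]
    intro h1 h2
    have := hT.schema (.allP_dist z (ψ.gs (τ.updP u (.var z))) (φ.gs (τ.updP u (.var z)))
      (Fm.mem_fvarP_gs_updP hψ _ _) (Fm.mem_fvarP_gs_updP hφ _ _))
    rw [hT.mem_imp, hT.mem_imp] at this
    exact (hT.mem_iff_of_alphaEq (alphaEq_gs_allP hφ (fun h => hz (hsub.2 h)))).mpr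
      (this ((hT.mem_iff_of_alphaEq (alphaEq_gs_allP _ hz)).mp h1)
        ((hT.mem_iff_of_alphaEq (alphaEq_gs_allP hψ (fun h => hz (hsub.1 h)))).mp h2))
  | allP_shift u ψ φ hψ hφ =>
    have hz := above_notMem (Fm.supP τ u (ψ.imp φ))
    generalize above (Fm.supP τ u (ψ.imp φ)) = z at *
    have hsub : (ψ.gs τ).fvarP ⊆ Fm.supP τ u (ψ.imp φ) ∧
        Fm.supP τ u φ ⊆ Fm.supP τ u (ψ.imp φ) := by
      constructor <;> intro i <;> simp only [Fm.mem_supP, Fm.mem_fvarP_gs, Fm.fvarP_imp,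
        Fm.mem_conP_imp, Finset.mem_union] <;> grind
    rw [Fm.gs_imp, Fm.gs_imp, hT.mem_imp, hT.mem_imp]
    intro h1 h2
    have := hT.schema (.allP_shift z (ψ.gs τ) (φ.gs (τ.updP u (.var z)))
      (fun h => hz (hsub.1 h)) (Fm.mem_fvarP_gs_updP hφ _ _))
    rw [hT.mem_imp, hT.mem_imp] at this
    refine (hT.mem_iff_of_alphaEq (alphaEq_gs_allP hφ (fun h => hz (hsub.2 h)))).mpr
      (this ?_ h2)
    have h1' := (hT.mem_iff_of_alphaEq (alphaEq_gs_allP _ hz)).mp h1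
    rwa [Fm.allP_congr (ψ := (ψ.gs τ).imp (φ.gs (τ.updP u (.var z))))
      (by simp [Fm.gs_updP_of_notMem hψ])] at h1'
  | le_iff x s t =>
    have hx : x ∈ (Fm.imp (.just (.var x) s) (.just (.var x) t) : Fm C D).fvarP :=
      Finset.mem_union_left _ (Finset.mem_singleton_self x)
    change Fm.iff ((Fm.tle s t).gs τ) ((Fm.allP x _ hx).gs τ) ∈ T
    rw [Fm.gs_allP]
    generalize above (Fm.supP τ x _) = z
    have := hT.schema (.le_iff z (s.gs τ) (t.gs τ))
    have hs : ∀ (s : Tm C) (e : Fm C₁ D₁), s.gs (τ.updP x e) = s.gs τ := fun s e =>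
      Tm.gs_congr _ (fun _ _ => rfl) (fun _ _ => rfl)
    rwa [Fm.gs_tle, Fm.allP_congr
      (ψ := .imp (.just (.var z) (s.gs τ)) (.just (.var z) (t.gs τ))) (by simp [hs])]
  | extensionality s t => simpa using hT.schema (.extensionality _ _)
  | subst_tm p p' j j' t =>
    rw [Fm.gs_conjImp, hT.mem_conjImp]
    intro hl
    simp only [Tm.substEqs, List.mem_map, Finset.mem_sort] at hl
    rw [Fm.gs_teq, Tm.subst_ofVars_eq_gs, Tm.subst_ofVars_eq_gs, Tm.gs_fcomp, Tm.gs_fcomp]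
    exact hT.teq_gs_of_forall t (fun u hu => hl _ ⟨_, ⟨u, hu, rfl⟩, Fm.gs_teq _ _ _⟩)
      (fun _ => rfl)

end Complete

/-- An instance of a generalized axiom is the generalization of an instance under an updated
substitution, so the induction must vary `τ`. Updates at variables do not affect the normality of
the images of constants. -/
theorem derivesFour_gs_of_mem_axFour {χ : Fm C D} (h : χ ∈ AxFour C D) {τ : FSubst C D C₁ D₁}
    (hτ : ∀ d, (τ.onConP d).nf = τ.onConP d) : DerivesFour ∅ (χ.gs τ) := by
  induction h generalizing τ with
  | base h =>
    refine derivesFour_of_forall_complete fun T hT _ => ?_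
    rcases h with h | ⟨φ, rfl⟩
    · exact hT.schema_gs h hτ
    · exact hT.ax (.base (.inr ⟨φ.gs τ, rfl⟩))
  | allJ u h _ ih =>
    rw [Fm.gs_allJ]
    exact DerivesFour.allJ (ih (τ := τ.updJ u _) hτ) _
  | allP u h _ ih =>
    rw [Fm.gs_allP]
    exact DerivesFour.allP (ih (τ := τ.updP u _) hτ) _

/-- Derivability is closed under substitutions between languages. -/
theorem DerivesFour.gs {Φ : Set (Fm C D)} {χ : Fm C D} (h : DerivesFour Φ χ)
    {τ : FSubst C D C₁ D₁} (hτ : ∀ d, (τ.onConP d).nf = τ.onConP d) :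
    DerivesFour ((fun ψ => ψ.gs τ) '' Φ) (χ.gs τ) := by
  induction h with
  | ax h => exact (derivesFour_gs_of_mem_axFour h hτ).mono (Set.empty_subset _)
  | hyp h => exact .hyp ⟨_, h, rfl⟩
  | @mp α β _ _ ih₁ ih₂ => exact .mp (φ := α.gs τ) ih₁ ih₂

/-! ### Witnesses for quantifiers -/

theorem Complete.mem_impList {T : Set (Fm C D)} (hT : Complete T) (l : List (Fm C D))
    (φ : Fm C D) : impList l φ ∈ T ↔ ((∀ ψ ∈ l, ψ ∈ T) → φ ∈ T) := by
  induction l with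
  | nil => simp [impList]
  | cons a l ih => simp_all [impList, hT.mem_imp]

theorem notMem_conP_impList {l : List (Fm C D)} {φ : Fm C D} {d : D}
    (hl : ∀ ψ ∈ l, d ∉ ψ.conP) (hφ : d ∉ φ.conP) : d ∉ (impList l φ).conP := by
  classical
  induction l with
  | nil => exact hφ
  | cons a l ih =>
    change d ∉ (a.imp (impList l φ)).conP
    rw [Fm.mem_conP_imp]
    rintro (h | h)
    · exact hl a (by simp) h
    · exact ih (fun ψ hψ => hl ψ (by simp [hψ])) h

theorem notMem_conJ_impList {l : List (Fm C D)} {φ : Fm C D} {c : C}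
    (hl : ∀ ψ ∈ l, c ∉ ψ.conJ) (hφ : c ∉ φ.conJ) : c ∉ (impList l φ).conJ := by
  classical
  induction l with
  | nil => exact hφ
  | cons a l ih =>
    change c ∉ (a.imp (impList l φ)).conJ
    rw [Fm.mem_conJ_imp]
    rintro (h | h)
    · exact hl a (by simp) h
    · exact ih (fun ψ hψ => hl ψ (by simp [hψ])) h

open Classical in
/-- Replace the propositional constant `d` by a variable. -/
def replP (d : D) (z : ℕ) : FSubst C D C D :=
  { idL with onConP := Function.update Fm.con d (.var z) }

open Classical in
/-- Replace the justification constant `c` by a variable. -/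
def replJ (c : C) (z : ℕ) : FSubst C D C D :=
  { idL with onConJ := Function.update Tm.con c (.var z) }

theorem nf_replP (d : D) (z : ℕ) (e : D) :
    ((replP d z : FSubst C D C D).onConP e).nf = (replP d z : FSubst C D C D).onConP e := by
  classical
  by_cases h : e = d
  · subst h; simp only [replP, Function.update_self]; rfl
  · simp only [replP, Function.update_of_ne h]; rfl

/-- What is derivable for a fresh constant is derivable for all values. -/
theorem derivesFour_imp_allP {θ φ : Fm C D} {x : ℕ} (h : x ∈ φ.fvarP) {d : D}
    (hθ : d ∉ θ.conP) (hφ : d ∉ φ.conP) (hd : DerivesFour ∅ (θ.imp (φ.substP x (.con d)))) :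
    DerivesFour ∅ (θ.imp (φ.allP x h)) := by
  classical
  have hz := above_notMem (θ.fvarP ∪ φ.fvarP)
  generalize above (θ.fvarP ∪ φ.fvarP) = z at *
  rw [Finset.mem_union, not_or] at hz
  -- As `d` occurs in neither formula, replacing it by `z` turns `φ[x := d]` into `φ[x := z]` and
  -- merely normalizes `θ`.
  have h1 : DerivesFour ∅ (θ.nf.imp (φ.gs (idL.updP x (.var z)))) := by
    have := (hd.gs (nf_replP d z)).mono (Ψ := ∅) (by simp)
    rw [Fm.gs_imp, Fm.gs_substP, Fm.gs_con] at this
    convert this using 2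
    · refine θ.gs_congr (fun _ _ => rfl) (fun _ _ => rfl) (fun e he => ?_) (fun _ _ => rfl)
      simp only [replP, Function.update_of_ne (ne_of_mem_of_not_mem he hθ)]
      rfl
    · refine φ.gs_congr (fun y _ => ?_) (fun _ _ => rfl) (fun e he => ?_) (fun _ _ => rfl)
      · simp [replP]
      · simp only [replP, LSubst.updP_onConP, Function.update_of_ne (ne_of_mem_of_not_mem he hφ)]
        rfl
  have hzθ : z ∉ θ.nf.fvarP := (alphaEq_nf θ).occ.1 ▸ hz.1
  have hzφ := Fm.mem_fvarP_gs_updP h idL z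
  have h2 : DerivesFour ∅ _ := .mp (.ax (Schema.allP_shift z _ _ hzθ hzφ).mem_axFour)
    (DerivesFour.allP h1 (Finset.mem_union_right _ hzφ))
  refine derivesFour_of_forall_complete fun T hT _ => ?_
  have h3 := hT.mem_of_derives (Set.empty_subset T) h2
  rw [hT.mem_imp] at h3 ⊢
  intro hθT
  rw [← hT.mem_iff_of_alphaEq (alphaEq_nf _), Fm.nf,
    hT.mem_iff_of_alphaEq (alphaEq_gs_allP h (z := z) _)]
  · exact h3 ((hT.mem_iff_of_alphaEq (alphaEq_nf _)).mpr hθT)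
  · rw [Fm.mem_supP]
    simp only [idL, Fm.fvarP_var, Fm.fvarP_con, Finset.mem_singleton]
    rintro (⟨y, hy, -, rfl⟩ | ⟨e, -, he⟩)
    · exact hz.2 hy
    · simp at he

theorem derivesFour_imp_allJ {θ φ : Fm C D} {x : ℕ} (h : x ∈ φ.fvarJ) {c : C}
    (hθ : c ∉ θ.conJ) (hφ : c ∉ φ.conJ) (hd : DerivesFour ∅ (θ.imp (φ.substJ x (.con c)))) :
    DerivesFour ∅ (θ.imp (φ.allJ x h)) := by
  classical
  have hz := above_notMem (θ.fvarJ ∪ φ.fvarJ)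
  generalize above (θ.fvarJ ∪ φ.fvarJ) = z at *
  rw [Finset.mem_union, not_or] at hz
  have h1 : DerivesFour ∅ (θ.nf.imp (φ.gs (idL.updJ x (.var z)))) := by
    have := (hd.gs (τ := replJ c z) (fun _ => rfl)).mono (Ψ := ∅) (by simp)
    rw [Fm.gs_imp, Fm.gs_substJ] at this
    convert this using 2
    · refine θ.gs_congr (fun _ _ => rfl) (fun _ _ => rfl) (fun _ _ => rfl) (fun e he => ?_)
      simp only [replJ, Function.update_of_ne (ne_of_mem_of_not_mem he hθ)]
      rfl
    · refine φ.gs_congr (fun _ _ => rfl) (fun y _ => ?_) (fun _ _ => rfl) (fun e he => ?_)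
      · simp [replJ, Tm.gs]
      · simp only [replJ, LSubst.updJ_onConJ, Function.update_of_ne (ne_of_mem_of_not_mem he hφ)]
        rfl
  have hzθ : z ∉ θ.nf.fvarJ := (alphaEq_nf θ).occ.2.1 ▸ hz.1
  have hzφ := Fm.mem_fvarJ_gs_updJ h idL z
  have h2 : DerivesFour ∅ _ := .mp (.ax (Schema.allJ_shift z _ _ hzθ hzφ).mem_axFour)
    (DerivesFour.allJ h1 (Finset.mem_union_right _ hzφ))
  refine derivesFour_of_forall_complete fun T hT _ => ?_
  have h3 := hT.mem_of_derives (Set.empty_subset T) h2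
  rw [hT.mem_imp] at h3 ⊢
  intro hθT
  rw [← hT.mem_iff_of_alphaEq (alphaEq_nf _), Fm.nf,
    hT.mem_iff_of_alphaEq (alphaEq_gs_allJ h (z := z) _)]
  · exact h3 ((hT.mem_iff_of_alphaEq (alphaEq_nf _)).mpr hθT)
  · rw [Fm.mem_supJ]
    simp only [idL, Fm.fvarJ_var, Fm.fvarJ_con, Tm.vars, Finset.mem_singleton]
    rintro ((⟨e, -, he⟩ | ⟨y, hy, -, rfl⟩) | ⟨e, -, he⟩ | ⟨e, -, he⟩)
    · simp at he
    · exact hz.2 hy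
    · simp at he
    · simp at he

/-- If `χ` needs `α → β`, then over finitely many members `l` of `Γ` the failure of `χ`, as a single
formula, implies both `α` and `¬β`. When the implication of `α` can be improved to one of `β`, that
failure is refuted. For a witness axiom, `α` is the instance at the constant and `β` the quantified
formula. -/
theorem derivesFour_of_insert_imp {Γ : Set (Fm C D)} {α β χ : Fm C D}
    (hd : DerivesFour (insert (α.imp β) Γ) χ)
    (hαβ : ∀ l : List (Fm C D), (∀ ψ ∈ l, ψ ∈ Γ) → DerivesFour ∅ ((impList l χ).neg.imp α) →
      DerivesFour ∅ ((impList l χ).neg.imp β)) : DerivesFour Γ χ := by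
  obtain ⟨l, hl, hd⟩ := (DerivesFour.imp_intro hd).exists_list
  have h1 : ∀ γ : Fm C D, (∀ T, Complete T → α.imp β ∉ T → γ ∈ T) →
      DerivesFour ∅ ((impList l χ).neg.imp γ) := by
    intro γ hγ
    refine derivesFour_of_forall_complete fun T hT _ => ?_
    have := hT.mem_of_derives (Set.empty_subset T) hd
    rw [hT.mem_impList, hT.mem_imp] at this
    rw [hT.mem_imp, hT.mem_neg, hT.mem_impList]
    intro h
    exact hγ T hT (by tauto)
  have h2 := hαβ l hl (h1 α fun T hT h => by rw [hT.mem_imp] at h; tauto)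
  have h3 := h1 β.neg fun T hT h => by rw [hT.mem_imp] at h; rw [hT.mem_neg]; tauto
  refine DerivesFour.of_impList (l := l) (DerivesFour.mono (Set.empty_subset Γ) ?_)
    fun ψ hψ => .hyp (hl ψ hψ)
  refine derivesFour_of_forall_complete fun T hT _ => ?_
  have h2 := hT.mem_of_derives (Set.empty_subset T) h2
  have h3 := hT.mem_of_derives (Set.empty_subset T) h3
  rw [hT.mem_imp, hT.mem_neg] at h2 h3
  rw [hT.mem_neg] at h3
  tauto

/-! ### Witness constants and conservativity -/

/-- The witness constants: `mk true x φ` is to be a counterexample to `∀ x. φ` if there is one,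
and `mk false u φ` one to `⋀ u. φ`. -/
inductive Wit (C : Type u) (D : Type v) : Type (max u v)
  | mk : Bool → ℕ → PreFm (C ⊕ Wit C D) (D ⊕ Wit C D) → Wit C D

/-- A witness is built from an expression, so the witnesses occurring in that expression are
structurally smaller; size serves as the rank of a witness. -/
theorem Tm.sizeOf_wit_lt {t : Tm (C ⊕ Wit C D)} {k : Wit C D} (h : Sum.inr k ∈ t.cons) :
    sizeOf k < sizeOf t := by
  induction t <;> simp [Tm.cons] at * <;> grind

theorem PreFm.sizeOf_wit_lt_of_mem_conP {φ : PreFm (C ⊕ Wit C D) (D ⊕ Wit C D)} {k : Wit C D}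
    (h : Sum.inr k ∈ φ.conP) : sizeOf k < sizeOf φ := by
  induction φ <;> simp [conP] at * <;> grind

theorem PreFm.sizeOf_wit_lt_of_mem_conJ {φ : PreFm (C ⊕ Wit C D) (D ⊕ Wit C D)} {k : Wit C D}
    (h : Sum.inr k ∈ φ.conJ) : sizeOf k < sizeOf φ := by
  have ht := fun t : Tm (C ⊕ Wit C D) => Tm.sizeOf_wit_lt (t := t) (k := k)
  induction φ <;> simp [conJ] at * <;> grind

/-- Formulas of the language extended by the witness constants. -/
abbrev WFm (C : Type u) (D : Type v) : Type (max u v) := Fm (C ⊕ Wit C D) (D ⊕ Wit C D)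

/-- The axioms on witness constants. -/
inductive WitAx : Wit C D → WFm C D → Prop
  | allP (x : ℕ) (φ : WFm C D) (h : x ∈ φ.fvarP) : WitAx (.mk true x φ.1)
      ((φ.substP x (.con (.inr (.mk true x φ.1)))).imp (φ.allP x h))
  | allJ (u : ℕ) (φ : WFm C D) (h : u ∈ φ.fvarJ) : WitAx (.mk false u φ.1)
      ((φ.substJ u (.con (.inr (.mk false u φ.1)))).imp (φ.allJ u h))

/-- The constant records the sort of the quantifier, the variable and the body, so its axiom can be
read off from it. -/
theorem WitAx.unique {k : Wit C D} {χ χ' : WFm C D} (h : WitAx k χ) (h' : WitAx k χ') :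
    χ = χ' := by
  cases h with
  | allP x φ hx =>
    generalize hk : Wit.mk true x φ.1 = k at h'
    cases h' with
    | allP y ψ hy =>
      simp only [Wit.mk.injEq, true_and] at hk
      obtain ⟨rfl, h⟩ := hk
      obtain rfl := Subtype.ext h
      rfl
    | allJ y ψ hy => simp at hk
  | allJ x φ hx =>
    generalize hk : Wit.mk false x φ.1 = k at h'
    cases h' with
    | allJ y ψ hy =>
      simp only [Wit.mk.injEq, true_and] at hk
      obtain ⟨rfl, h⟩ := hk
      obtain rfl := Subtype.ext h
      rfl
    | allP y ψ hy => simp at hk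

/-- Besides its own constant, a witness axiom mentions only witnesses from the body coded in that
constant. -/
theorem WitAx.conP {k b : Wit C D} {χ : WFm C D} (h : WitAx k χ) (hb : Sum.inr b ∈ χ.conP) :
    b = k ∨ sizeOf b < sizeOf k := by
  classical
  cases h with
  | allP x φ hx =>
    rw [Fm.mem_conP_imp, Fm.substP_eq_gs, Fm.mem_conP_gs] at hb
    have key : Sum.inr b ∈ φ.conP → sizeOf b < sizeOf (Wit.mk true x φ.1) := by
      intro h
      have := PreFm.sizeOf_wit_lt_of_mem_conP h
      simp only [Wit.mk.sizeOf_spec]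
      omega
    rcases hb with (⟨y, hy, hb⟩ | ⟨d, hd, hb⟩) | hb
    · rw [LSubst.updP_onVarP] at hb
      split_ifs at hb
      · simp only [Fm.conP_con, Finset.mem_singleton, Sum.inr.injEq] at hb
        exact .inl hb
      · simp [idL] at hb
    · simp only [LSubst.updP_onConP, idL, Fm.conP_con, Finset.mem_singleton] at hb
      subst hb
      exact .inr (key hd)
    · exact .inr (key hb)
  | allJ x φ hx =>
    rw [Fm.mem_conP_imp, Fm.substJ_eq_gs, Fm.mem_conP_gs] at hb
    have key : Sum.inr b ∈ φ.conP → sizeOf b < sizeOf (Wit.mk false x φ.1) := by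
      intro h
      have := PreFm.sizeOf_wit_lt_of_mem_conP h
      simp only [Wit.mk.sizeOf_spec]
      omega
    rcases hb with (⟨y, hy, hb⟩ | ⟨d, hd, hb⟩) | hb
    · simp [idL] at hb
    · simp only [LSubst.updJ_onConP, idL, Fm.conP_con, Finset.mem_singleton] at hb
      subst hb
      exact .inr (key hd)
    · exact .inr (key hb)

theorem WitAx.conJ {k b : Wit C D} {χ : WFm C D} (h : WitAx k χ) (hb : Sum.inr b ∈ χ.conJ) :
    b = k ∨ sizeOf b < sizeOf k := by
  classical
  cases h with
  | allP x φ hx =>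
    rw [Fm.mem_conJ_imp, Fm.substP_eq_gs, Fm.mem_conJ_gs] at hb
    have key : Sum.inr b ∈ φ.conJ → sizeOf b < sizeOf (Wit.mk true x φ.1) := by
      intro h
      have := PreFm.sizeOf_wit_lt_of_mem_conJ h
      simp only [Wit.mk.sizeOf_spec]
      omega
    rcases hb with ((⟨y, hy, hb⟩ | ⟨y, hy, hb⟩) | ⟨d, hd, hb⟩ | ⟨d, hd, hb⟩) | hb
    · rw [LSubst.updP_onVarP] at hb
      split_ifs at hb <;> simp [idL] at hb
    · simp [idL, Tm.cons] at hb
    · simp [idL] at hb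
    · simp only [LSubst.updP_onConJ, idL, Tm.cons, Finset.mem_singleton] at hb
      subst hb
      exact .inr (key hd)
    · exact .inr (key hb)
  | allJ x φ hx =>
    rw [Fm.mem_conJ_imp, Fm.substJ_eq_gs, Fm.mem_conJ_gs] at hb
    have key : Sum.inr b ∈ φ.conJ → sizeOf b < sizeOf (Wit.mk false x φ.1) := by
      intro h
      have := PreFm.sizeOf_wit_lt_of_mem_conJ h
      simp only [Wit.mk.sizeOf_spec]
      omega
    rcases hb with ((⟨y, hy, hb⟩ | ⟨y, hy, hb⟩) | ⟨d, hd, hb⟩ | ⟨d, hd, hb⟩) | hb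
    · simp [idL] at hb
    · rw [LSubst.updJ_onVarJ] at hb
      split_ifs at hb
      · simp only [Tm.cons, Finset.mem_singleton, Sum.inr.injEq] at hb
        exact .inl hb
      · simp [idL, Tm.cons] at hb
    · simp [idL] at hb
    · simp only [LSubst.updJ_onConJ, idL, Tm.cons, Finset.mem_singleton] at hb
      subst hb
      exact .inr (key hd)
    · exact .inr (key hb)

/-- Removing a witness axiom whose constant does not occur elsewhere. -/
theorem WitAx.derivesFour_of_insert {k : Wit C D} {ω : WFm C D} (hω : WitAx k ω)
    {Γ : Set (WFm C D)} {χ : WFm C D} (hP : ∀ ψ ∈ Γ, Sum.inr k ∉ ψ.conP)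
    (hJ : ∀ ψ ∈ Γ, Sum.inr k ∉ ψ.conJ) (hχP : Sum.inr k ∉ χ.conP) (hχJ : Sum.inr k ∉ χ.conJ)
    (hd : DerivesFour (insert ω Γ) χ) : DerivesFour Γ χ := by
  cases hω with
  | allP x φ h =>
    refine derivesFour_of_insert_imp hd fun l hl hd => derivesFour_imp_allP h ?_ ?_ hd
    · exact notMem_conP_impList (fun ψ hψ => hP ψ (hl ψ hψ)) hχP
    · intro h
      have := PreFm.sizeOf_wit_lt_of_mem_conP h
      simp only [Wit.mk.sizeOf_spec] at this
      omega
  | allJ x φ h =>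
    refine derivesFour_of_insert_imp hd fun l hl hd => derivesFour_imp_allJ h ?_ ?_ hd
    · exact notMem_conJ_impList (fun ψ hψ => hJ ψ (hl ψ hψ)) hχJ
    · intro h
      have := PreFm.sizeOf_wit_lt_of_mem_conJ h
      simp only [Wit.mk.sizeOf_spec] at this
      omega

/-- The axioms are removed in order of decreasing size of their constants: a constant of maximal
size cannot occur in the axiom of a different constant that is not larger. -/
theorem derivesFour_of_union_witAx_finset {Γ : Set (WFm C D)} {χ : WFm C D}
    (hP : ∀ ψ ∈ insert χ Γ, ∀ k, Sum.inr k ∉ ψ.conP)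
    (hJ : ∀ ψ ∈ insert χ Γ, ∀ k, Sum.inr k ∉ ψ.conJ) (s : Finset (Wit C D))
    (hd : DerivesFour (Γ ∪ {ω | ∃ k ∈ s, WitAx k ω}) χ) : DerivesFour Γ χ := by
  classical
  induction s using Finset.induction_on_max_value (fun k : Wit C D => sizeOf k) with
  | empty => simpa using hd
  | insert a s ha hmax ih =>
    refine ih ?_
    -- Not every code has an axiom: its body may be improper or lack the variable.
    by_cases hω : ∃ ω, WitAx a ω
    · obtain ⟨ω, hω⟩ := hω
      refine hω.derivesFour_of_insert (Γ := Γ ∪ {ω | ∃ k ∈ s, WitAx k ω}) ?_ ?_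
        (hP χ (Set.mem_insert _ _) a) (hJ χ (Set.mem_insert _ _) a) (DerivesFour.mono ?_ hd)
      · rintro ψ (hψ | ⟨k, hk, hψ⟩)
        · exact hP ψ (Set.mem_insert_of_mem _ hψ) a
        · intro hak
          rcases hψ.conP hak with rfl | hlt
          · exact ha hk
          · exact absurd (hmax k hk) (not_le.mpr hlt)
      · rintro ψ (hψ | ⟨k, hk, hψ⟩)
        · exact hJ ψ (Set.mem_insert_of_mem _ hψ) a
        · intro hak
          rcases hψ.conJ hak with rfl | hlt
          · exact ha hk
          · exact absurd (hmax k hk) (not_le.mpr hlt)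
      · rintro ψ (hψ | ⟨k, hk, hψ⟩)
        · exact .inr (.inl hψ)
        · rcases Finset.mem_insert.mp hk with rfl | hk
          · exact .inl (hψ.unique hω)
          · exact .inr (.inr ⟨k, hk, hψ⟩)
    · refine DerivesFour.mono ?_ hd
      rintro ψ (hψ | ⟨k, hk, hψ⟩)
      · exact .inl hψ
      · rcases Finset.mem_insert.mp hk with rfl | hk
        · exact absurd ⟨ψ, hψ⟩ hω
        · exact .inr ⟨k, hk, hψ⟩

theorem exists_finset_witAx {Γ : Set (WFm C D)} {χ : WFm C D}
    (hd : DerivesFour (Γ ∪ {ω | ∃ k, WitAx k ω}) χ) :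
    ∃ s : Finset (Wit C D), DerivesFour (Γ ∪ {ω | ∃ k ∈ s, WitAx k ω}) χ := by
  classical
  induction hd with
  | ax h => exact ⟨∅, .ax h⟩
  | hyp h =>
    rcases h with h | ⟨k, h⟩
    · exact ⟨∅, .hyp (.inl h)⟩
    · exact ⟨{k}, .hyp (.inr ⟨k, Finset.mem_singleton_self k, h⟩)⟩
  | mp _ _ ih₁ ih₂ =>
    obtain ⟨s, hs⟩ := ih₁
    obtain ⟨t, ht⟩ := ih₂
    have hsub : ∀ {s t : Finset (Wit C D)}, s ⊆ t →
        Γ ∪ {ω | ∃ k ∈ s, WitAx k ω} ⊆ Γ ∪ {ω | ∃ k ∈ t, WitAx k ω} := fun h =>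
      Set.union_subset_union_right _ fun ω ⟨k, hk, hω⟩ => ⟨k, h hk, hω⟩
    exact ⟨s ∪ t, .mp (DerivesFour.mono (hsub Finset.subset_union_left) hs)
      (DerivesFour.mono (hsub Finset.subset_union_right) ht)⟩

/-- The inclusion of the language into the one with witness constants. -/
def incl : FSubst C D (C ⊕ Wit C D) (D ⊕ Wit C D) :=
  ⟨.var, .var, fun d => .con (.inl d), fun c => .con (.inl c)⟩

/-- Replace all witness constants by a variable. -/
def unwit : FSubst (C ⊕ Wit C D) (D ⊕ Wit C D) C D :=
  ⟨.var, .var, Sum.elim .con fun _ => .var 0, Sum.elim .con fun _ => .var 0⟩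

theorem notMem_conP_gs_incl (φ : Fm C D) (k : Wit C D) : Sum.inr k ∉ (φ.gs incl).conP := by
  rw [Fm.mem_conP_gs]
  simp [incl]

theorem notMem_conJ_gs_incl (φ : Fm C D) (k : Wit C D) : Sum.inr k ∉ (φ.gs incl).conJ := by
  rw [Fm.mem_conJ_gs]
  simp [incl, Tm.cons]

/-- Passing to the larger language and back is normalization, so the translated derivation proves
the normal form of `φ` from normal forms of premises. What the witnesses are replaced by is
immaterial. -/
theorem derivesFour_of_incl {Φ : Set (Fm C D)} {φ : Fm C D}
    (h : DerivesFour ((fun ψ => ψ.gs incl) '' Φ) (φ.gs incl)) : DerivesFour Φ φ := by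
  have hgs : ∀ ψ : Fm C D, (ψ.gs incl).gs unwit = ψ.nf := fun ψ => Fm.gs_gs _ _ _
  have h1 := h.gs (τ := unwit) (by rintro (d | d) <;> rfl)
  simp only [hgs, Set.image_image] at h1
  refine derivesFour_of_forall_complete fun T hT hΦ => ?_
  rw [← hT.mem_iff_of_alphaEq (alphaEq_nf φ)]
  refine hT.mem_of_derives ?_ h1
  rintro _ ⟨ψ, hψ, rfl⟩
  exact (hT.mem_iff_of_alphaEq (alphaEq_nf ψ)).mpr (hΦ hψ)

/-- Complete theories with witnesses. -/
structure Henkin (T : Set (Fm C D)) : Prop extends Complete T where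
  allP : ∀ (x : ℕ) (φ : Fm C D) (h : x ∈ φ.fvarP), (∀ e, φ.substP x e ∈ T) → φ.allP x h ∈ T
  allJ : ∀ (u : ℕ) (φ : Fm C D) (h : u ∈ φ.fvarJ), (∀ t, φ.substJ u t ∈ T) → φ.allJ u h ∈ T

/-- By conservativity, `φ` stays underivable when all witness axioms are added to `Φ`, and
Lindenbaum's lemma applies. -/
theorem exists_henkin {Φ : Set (Fm C D)} {φ : Fm C D} (h : ¬ DerivesFour Φ φ) :
    ∃ T : Set (WFm C D), Henkin T ∧ (∀ ψ ∈ Φ, ψ.gs incl ∈ T) ∧ φ.gs incl ∉ T := by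
  have h1 : ¬ DerivesFour ((fun ψ => ψ.gs incl) '' Φ ∪ {ω : WFm C D | ∃ k, WitAx k ω})
      (φ.gs incl) := by
    intro hd
    obtain ⟨s, hs⟩ := exists_finset_witAx hd
    refine h (derivesFour_of_incl (derivesFour_of_union_witAx_finset ?_ ?_ s hs))
    · rintro ψ (rfl | ⟨ψ, -, rfl⟩) k
      · exact notMem_conP_gs_incl _ _
      · exact notMem_conP_gs_incl _ _
    · rintro ψ (rfl | ⟨ψ, -, rfl⟩) k
      · exact notMem_conJ_gs_incl _ _
      · exact notMem_conJ_gs_incl _ _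
  obtain ⟨T, hT, hsub, hφ⟩ := exists_complete h1
  refine ⟨T, ⟨hT, fun x ψ hx hψ => ?_, fun u ψ hu hψ => ?_⟩,
    fun ψ hψ => hsub (.inl ⟨ψ, hψ, rfl⟩), hφ⟩
  -- The instance at the witness constant is among the given instances, and the witness axiom passes
  -- from it to the quantified formula.
  · exact (hT.mem_imp _ _).mp (hsub (.inr ⟨_, .allP x ψ hx⟩)) (hψ _)
  · exact (hT.mem_imp _ _).mp (hsub (.inr ⟨_, .allJ u ψ hu⟩)) (hψ _)

/-! ### The canonical model -/

namespace Henkin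

variable {T : Set (Fm C₁ D₁)} (hT : Henkin T)

include hT

theorem mem_gs_allP {φ : Fm C D} {x : ℕ} (h : x ∈ φ.fvarP) (σ : FSubst C D C₁ D₁) :
    (φ.allP x h).gs σ ∈ T ↔ ∀ e, φ.gs (σ.updP x e) ∈ T := by
  refine ⟨fun hφ e => hT.mem_gs_updP_of_allP hφ e, fun hφ => ?_⟩
  rw [Fm.gs_allP]
  exact hT.allP _ _ _ fun e => (hT.mem_gs_updP_iff (above_notMem _) e).mpr (hφ e)

theorem mem_gs_allJ {φ : Fm C D} {u : ℕ} (h : u ∈ φ.fvarJ) (σ : FSubst C D C₁ D₁) :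
    (φ.allJ u h).gs σ ∈ T ↔ ∀ t, φ.gs (σ.updJ u t) ∈ T := by
  refine ⟨fun hφ e => hT.mem_gs_updJ_of_allJ hφ e, fun hφ => ?_⟩
  rw [Fm.gs_allJ]
  exact hT.allJ _ _ _ fun e => (hT.mem_gs_updJ_iff (above_notMem _) e).mpr (hφ e)

/-- With witnesses, the quantifier in the axiom for `≤` ranges over all formulas, so `≤` becomes
inclusion of reasons. -/
theorem mem_tle_iff (s t : Tm C₁) : .tle s t ∈ T ↔ ∀ e : Fm C₁ D₁, e.just s ∈ T → e.just t ∈ T := by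
  have hs : ∀ (s : Tm C₁) (e : Fm C₁ D₁), s.gs ((idL : FSubst C₁ D₁ C₁ D₁).updP 0 e) = s :=
    fun s e => (Tm.gs_congr (σ := (idL : FSubst C₁ D₁ C₁ D₁).updP 0 e)
      (τ := (idL : FSubst C₁ D₁ C₁ D₁)) _ (fun _ _ => rfl) (fun _ _ => rfl)).trans s.gs_idL
  -- Any index would do, as terms contain no propositional variables. Passing to the normal form
  -- brings in a substitution, as `mem_gs_allP` requires.
  rw [hT.mem_tle 0, ← hT.mem_iff_of_alphaEq (alphaEq_nf _), Fm.nf]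
  refine (hT.mem_gs_allP _ _).trans ?_
  refine forall_congr' fun e => ?_
  rw [Fm.gs_imp, hT.mem_imp, Fm.gs_just, Fm.gs_just, hs, hs, Fm.gs_var, LSubst.updP_onVarP,
    if_pos rfl]

/-- The existential quantifier in the axiom for `□` is witnessed by a term, which is what makes
`NECESSARY` the union of the reasons. -/
theorem mem_box_iff (φ : Fm C₁ D₁) : φ.box ∈ T ↔ ∃ t, φ.just t ∈ T := by
  have hu := above_notMem φ.fvarJ
  generalize above φ.fvarJ = u at *
  have hu' : u ∈ (Fm.neg (φ.just (.var u))).fvarJ :=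
    Finset.mem_union_right _ (Finset.mem_singleton_self u)
  have h1 : φ.box ∈ T ↔ Fm.neg (Fm.allJ u (Fm.neg (φ.just (.var u))) hu') ∈ T :=
    (hT.mem_iff _ _).mp (hT.schema (.necessity φ u hu))
  rw [h1, hT.mem_neg, ← hT.mem_iff_of_alphaEq (alphaEq_nf _), Fm.nf, hT.mem_gs_allJ, not_forall]
  refine exists_congr fun t => ?_
  rw [Fm.gs_neg, hT.mem_neg, not_not, Fm.gs_just, Fm.gs_updJ_of_notMem hu]
  simp only [Tm.gs, LSubst.updJ_onVarJ, if_true]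
  exact hT.mem_iff_of_alphaEq ((alphaEq_nf φ).just t)

end Henkin

/-- Types of representatives for the propositions and the indexes given by a theory `T`. -/
structure Carrier (T : Set (Fm C₁ D₁)) where
  M : Type w
  L : Type w
  cls : Fm C₁ D₁ → M
  rep : M → Fm C₁ D₁
  clsT : Tm C₁ → L
  repT : L → Tm C₁
  cls_rep : ∀ m, cls (rep m) = m
  clsT_repT : ∀ l, clsT (repT l) = l
  cls_eq_iff : ∀ φ ψ, cls φ = cls ψ ↔ φ.eqv ψ ∈ T
  clsT_eq_iff : ∀ s t, clsT s = clsT t ↔ .teq s t ∈ T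

/-- Quotients by the equations in `T`, with chosen representatives. They live in different universes
and are lifted to a common one. -/
theorem Complete.exists_carrier {T : Set (Fm C₁ D₁)} (hT : Complete T) :
    Nonempty (Carrier.{max u₁ v₁ w} T) := by
  let SM : Setoid (Fm C₁ D₁) := ⟨fun φ ψ => φ.eqv ψ ∈ T, hT.eqv_refl, hT.eqv_symm, hT.eqv_trans⟩
  let SL : Setoid (Tm C₁) := ⟨fun s t => .teq s t ∈ T, hT.teq_refl, hT.teq_symm, hT.teq_trans⟩
  exact ⟨{
    M := ULift.{w} (Quotient SM)
    L := ULift.{max v₁ w} (Quotient SL)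
    cls := fun φ => ⟨⟦φ⟧⟩
    rep := fun m => m.down.out
    clsT := fun t => ⟨⟦t⟧⟩
    repT := fun l => l.down.out
    cls_rep := fun m => ULift.ext _ _ (Quotient.out_eq _)
    clsT_repT := fun l => ULift.ext _ _ (Quotient.out_eq _)
    cls_eq_iff := fun φ ψ => (ULift.up_injective.eq_iff).trans Quotient.eq
    clsT_eq_iff := fun s t => (ULift.up_injective.eq_iff).trans Quotient.eq }⟩

namespace Carrier

variable {T : Set (WFm C D)} (K : Carrier.{w} T)

/-- The propositions that are reasons of type `l`. -/
def reason (l : K.L) : Set K.M := {m | (K.rep m).just (K.repT l) ∈ T}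

/-- The substitution of representatives given by an assignment. -/
def asg (γ : Asg K.M K.L) : FSubst C D (C ⊕ Wit C D) (D ⊕ Wit C D) :=
  ⟨fun x => K.rep (γ.onP x), fun u => K.repT (γ.onJ u), fun d => .con (.inl d),
    fun c => .con (.inl c)⟩

theorem asg_updP (γ : Asg K.M K.L) (x : ℕ) (m : K.M) :
    K.asg (γ.updP x m) = (K.asg γ).updP x (K.rep m) := by
  ext y : 2
  · rw [LSubst.updP_onVarP]
    by_cases h : y = x
    · subst h; simp [asg, Asg.updP]
    · simp [asg, Asg.updP, h]
  all_goals rfl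

theorem asg_updJ (γ : Asg K.M K.L) (x : ℕ) (l : K.L) :
    K.asg (γ.updJ x l) = (K.asg γ).updJ x (K.repT l) := by
  ext y : 2
  · rfl
  · rw [LSubst.updJ_onVarJ]
    by_cases h : y = x
    · subst h; simp [asg, Asg.updJ]
    · simp [asg, Asg.updJ, h]
  all_goals rfl

theorem rep_cls (φ : WFm C D) : (K.rep (K.cls φ)).eqv φ ∈ T :=
  (K.cls_eq_iff _ _).mp (K.cls_rep _)

theorem repT_clsT (t : Tm (C ⊕ Wit C D)) : .teq (K.repT (K.clsT t)) t ∈ T :=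
  (K.clsT_eq_iff _ _).mp (K.clsT_repT _)

variable (hT : Henkin T)

include hT

theorem rep_cls_mem (φ : WFm C D) : K.rep (K.cls φ) ∈ T ↔ φ ∈ T :=
  ⟨hT.mem_of_eqv (K.rep_cls φ), hT.mem_of_eqv (hT.eqv_symm (K.rep_cls φ))⟩

theorem cls_mem_reason (φ : WFm C D) (t : Tm (C ⊕ Wit C D)) :
    K.cls φ ∈ K.reason (K.clsT t) ↔ φ.just t ∈ T :=
  ⟨hT.just_congr (K.rep_cls φ) (K.repT_clsT t),
    hT.just_congr (hT.eqv_symm (K.rep_cls φ)) (hT.teq_symm (K.repT_clsT t))⟩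

theorem ref_cls (φ ψ : WFm C D) :
    (K.rep (K.cls φ)).ref (K.rep (K.cls ψ)) ∈ T ↔ φ.ref ψ ∈ T :=
  ⟨hT.ref_congr (K.rep_cls φ) (K.rep_cls ψ),
    hT.ref_congr (hT.eqv_symm (K.rep_cls φ)) (hT.eqv_symm (K.rep_cls ψ))⟩

theorem reason_subset_iff (s t : Tm (C ⊕ Wit C D)) :
    K.reason (K.clsT s) ⊆ K.reason (K.clsT t) ↔ .tle s t ∈ T := by
  rw [hT.mem_tle_iff]
  constructor
  · intro h e he
    exact (K.cls_mem_reason hT e t).mp (h ((K.cls_mem_reason hT e s).mpr he))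
  · intro h m hm
    rw [← K.cls_rep m, K.cls_mem_reason hT] at hm ⊢
    exact h _ hm

/-- The inclusion order of the reasons. -/
@[reducible] def order : PartialOrder K.L where
  le l l' := K.reason l ⊆ K.reason l'
  le_refl _ := subset_rfl
  le_trans _ _ _ := subset_trans
  -- This is where the extensionality axiom enters: terms with the same reasons are equal in `T`.
  le_antisymm l l' h h' := by
    rw [← K.clsT_repT l, ← K.clsT_repT l', K.reason_subset_iff hT] at h h'
    rw [← K.clsT_repT l, ← K.clsT_repT l', K.clsT_eq_iff, hT.mem_teq]
    exact ⟨h, h'⟩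

/-- The denotation does not depend on the representatives. The substitutions here go between two
languages, so the general form `eqv_gs_of_forall` is needed. -/
theorem cls_gs_eq (φ : Fm C D) {σ σ' : FSubst C D (C ⊕ Wit C D) (D ⊕ Wit C D)}
    (hp : ∀ x, (σ.onVarP x).eqv (σ'.onVarP x) ∈ T)
    (hj : ∀ u, .teq (σ.onVarJ u) (σ'.onVarJ u) ∈ T)
    (hσ : σ.onConP = fun d => .con (.inl d)) (hσ' : σ'.onConP = fun d => .con (.inl d))
    (hc : σ'.onConJ = σ.onConJ) : K.cls (φ.gs σ) = K.cls (φ.gs σ') :=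
  (K.cls_eq_iff _ _).mpr (hT.eqv_gs_of_forall φ (fun x _ => hp x) (fun u _ => hj u)
    (hσ'.trans hσ.symm) hc (fun d => by rw [hσ]; rfl))

theorem clsT_gs_eq (t : Tm C) {σ σ' : FSubst C D (C ⊕ Wit C D) (D ⊕ Wit C D)}
    (hj : ∀ u, .teq (σ.onVarJ u) (σ'.onVarJ u) ∈ T)
    (hc : σ.onConJ = σ'.onConJ) : K.clsT (t.gs σ) = K.clsT (t.gs σ') :=
  (K.clsT_eq_iff _ _).mpr (hT.teq_gs_of_forall t (fun u _ => hj u) (fun c => congrFun hc c))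

/-- The canonical model of a theory with witnesses. -/
def model : Model.{u, v, w} C D :=
  letI := K.order hT
  { L := K.L
    M := K.M
    plus := fun l l' => K.clsT (.plus (K.repT l) (K.repT l'))
    app := fun l l' => K.clsT (.app (K.repT l) (K.repT l'))
    TRUE := {m | K.rep m ∈ T}
    FALSE := {m | K.rep m ∉ T}
    NECESSARY := ⋃ l, K.reason l
    REASON := K.reason
    refers := fun m m' => (K.rep m).ref (K.rep m') ∈ T
    gam := fun φ γ => K.cls (φ.gs (K.asg γ))
    gamT := fun t γ => K.clsT (t.gs (K.asg γ))
    true_union_false := Set.union_compl_self _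
    true_inter_false := Set.inter_compl_self _
    necessary_subset := by
      rintro m hm
      obtain ⟨l, hm⟩ := Set.mem_iUnion.mp hm
      exact (hT.mem_imp _ _).mp (hT.schema (.box_elim _)) ((hT.mem_box_iff _).mpr ⟨_, hm⟩)
    necessary_eq := rfl
    le_iff := fun _ _ => Iff.rfl
    refers_trans := fun a b c hab hbc =>
      (hT.mem_imp _ _).mp ((hT.mem_imp _ _).mp (hT.schema (.ref_trans _ _ _)) hab) hbc
    ep_P := fun x γ => K.cls_rep _
    ep_J := fun u γ => K.clsT_repT _
    cp_fm := fun φ γ γ' hP hJ =>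
      congrArg K.cls (φ.gs_congr (fun x hx => congrArg K.rep (hP x hx))
        (fun u hu => congrArg K.repT (hJ u hu)) (fun _ _ => rfl) (fun _ _ => rfl))
    cp_tm := fun t γ γ' hJ =>
      congrArg K.clsT (t.gs_congr (fun u hu => congrArg K.repT (hJ u hu)) (fun _ _ => rfl))
    sp_fm := fun φ p j γ => by
      -- One side uses the values of `p` and `j` under `K.asg γ`, the other the representatives of
      -- their classes; these are equal in `T`.
      rw [Fm.subst_ofVars_eq_gs, Fm.gs_gs]
      exact K.cls_gs_eq hT φ (fun x => hT.eqv_symm (K.rep_cls _))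
        (fun u => hT.teq_symm (K.repT_clsT _)) rfl rfl rfl
    sp_tm := fun t p j γ => by
      rw [Tm.subst_ofVars_eq_gs, Tm.gs_fcomp]
      exact K.clsT_gs_eq hT t (fun u => hT.teq_symm (K.repT_clsT _)) rfl
    rp := fun φ ψ γ h => (K.ref_cls hT _ _).mpr (hT.schema (.ref_of_synRef (h.gs _)))
    hp_plus := fun s t γ => (K.clsT_eq_iff _ _).mpr
      (hT.plus_congr (hT.teq_symm (K.repT_clsT _)) (hT.teq_symm (K.repT_clsT _)))
    hp_app := fun s t γ => (K.clsT_eq_iff _ _).mpr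
      (hT.app_congr (hT.teq_symm (K.repT_clsT _)) (hT.teq_symm (K.repT_clsT _)))
    t_imp := fun φ ψ γ => by
      simp only [Set.mem_ofPred_eq, K.rep_cls_mem hT, Fm.gs_imp, hT.mem_imp]
      tauto
    t_neg := fun φ γ => by
      simp only [Set.mem_ofPred_eq, K.rep_cls_mem hT, Fm.gs_neg, hT.mem_neg]
    t_isTrue := fun φ γ => by
      simp only [Set.mem_ofPred_eq, K.rep_cls_mem hT, Fm.gs_isTrue]
      exact (hT.mem_iff _ _).mp (hT.schema (.tarski_true _))
    t_isFalse := fun φ γ => by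
      simp only [Set.mem_ofPred_eq, K.rep_cls_mem hT, Fm.gs_isFalse]
      rw [← hT.mem_neg]
      exact (hT.mem_iff _ _).mp (hT.schema (.tarski_false _))
    t_eqv := fun φ ψ γ => by
      simp only [Set.mem_ofPred_eq, K.rep_cls_mem hT, Fm.gs_eqv, K.cls_eq_iff]
    t_ref := fun φ ψ γ => by
      simp only [Set.mem_ofPred_eq, K.rep_cls_mem hT, Fm.gs_ref, K.ref_cls hT]
    t_teq := fun s t γ => by
      simp only [Set.mem_ofPred_eq, K.rep_cls_mem hT, Fm.gs_teq, K.clsT_eq_iff]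
    t_tle := fun s t γ => by
      simp only [Set.mem_ofPred_eq, K.rep_cls_mem hT, Fm.gs_tle]
      exact (K.reason_subset_iff hT _ _).symm
    t_box := fun φ γ => by
      simp only [Set.mem_ofPred_eq, K.rep_cls_mem hT, Fm.gs_box, hT.mem_box_iff, Set.mem_iUnion]
      constructor
      · rintro ⟨t, ht⟩
        exact ⟨K.clsT t, (K.cls_mem_reason hT _ _).mpr ht⟩
      · rintro ⟨l, hl⟩
        rw [← K.clsT_repT l, K.cls_mem_reason hT] at hl
        exact ⟨_, hl⟩
    t_just := fun φ t γ => by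
      simp only [Set.mem_ofPred_eq, K.rep_cls_mem hT, Fm.gs_just, K.cls_mem_reason hT]
    t_app := fun φ ψ s t γ => by
      simp only [Fm.gs_imp, Tm.gs, K.cls_mem_reason hT]
      intro h1 h2
      exact (hT.mem_imp _ _).mp ((hT.mem_imp _ _).mp (hT.schema (.application _ _ _ _)) h1) h2
    t_plus := fun φ s t γ => by
      simp only [Set.mem_union, Tm.gs, K.cls_mem_reason hT]
      rintro (h | h)
      · exact (hT.mem_imp _ _).mp (hT.schema (.weakening_left _ _ _)) h
      · exact (hT.mem_imp _ _).mp (hT.schema (.weakening_right _ _ _)) h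
    t_allJ := fun u φ h γ => by
      simp only [Set.mem_ofPred_eq, K.rep_cls_mem hT, hT.mem_gs_allJ h, K.asg_updJ]
      refine ⟨fun hφ l => hφ _, fun hφ t => ?_⟩
      -- The model quantifies over classes and hence over chosen representatives, the theory over
      -- all terms; an arbitrary `t` is replaced by the representative of its class.
      have := (K.rep_cls_mem hT _).mpr (hφ (K.clsT t))
      rwa [K.cls_gs_eq hT φ (σ := (K.asg γ).updJ u (K.repT (K.clsT t)))
        (σ' := (K.asg γ).updJ u t) (fun x => hT.eqv_refl _) (fun v => ?_)
        rfl rfl rfl, K.rep_cls_mem hT] at this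
      rw [LSubst.updJ_onVarJ, LSubst.updJ_onVarJ]
      split_ifs
      · exact K.repT_clsT t
      · exact hT.teq_refl _
    t_allP := fun x φ h γ => by
      simp only [Set.mem_ofPred_eq, K.rep_cls_mem hT, hT.mem_gs_allP h, K.asg_updP]
      refine ⟨fun hφ l => hφ _, fun hφ e => ?_⟩
      have := (K.rep_cls_mem hT _).mpr (hφ (K.cls e))
      rwa [K.cls_gs_eq hT φ (σ := (K.asg γ).updP x (K.rep (K.cls e)))
        (σ' := (K.asg γ).updP x e) (fun y => ?_) (fun v => hT.teq_refl _)
        rfl rfl rfl, K.rep_cls_mem hT] at this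
      rw [LSubst.updP_onVarP, LSubst.updP_onVarP]
      split_ifs
      · exact K.rep_cls e
      · exact hT.eqv_refl _ }

theorem model_condFour : (K.model hT).CondFour := fun φ γ h =>
  (K.rep_cls_mem hT (φ.box.box.gs (K.asg γ))).mpr ((hT.mem_imp _ _).mp
    (hT.ax (.base (.inr ⟨φ.gs (K.asg γ), rfl⟩)))
    ((K.rep_cls_mem hT (φ.box.gs (K.asg γ))).mp h))

/-- Truth under the assignment that sends each variable to its class. -/
theorem model_sat_iff (φ : Fm C D) :
    (K.model hT).Sat ⟨fun x => K.cls (.var x), fun u => K.clsT (.var u)⟩ φ ↔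
      φ.gs incl ∈ T := by
  change K.rep (K.cls (φ.gs (K.asg ⟨fun x => K.cls (.var x), fun u => K.clsT (.var u)⟩))) ∈ T ↔ _
  rw [K.cls_gs_eq hT φ
    (σ := K.asg ⟨fun x => K.cls (.var x), fun u => K.clsT (.var u)⟩) (σ' := incl)
    (fun x => K.rep_cls _) (fun u => K.repT_clsT _) rfl rfl rfl, K.rep_cls_mem hT]

end Carrier

/-! ### Soundness -/

namespace Model

variable (𝓜 : Model.{u, v, w} C D) (γ : Asg 𝓜.M 𝓜.L)

theorem mem_false_iff (m : 𝓜.M) : m ∈ 𝓜.FALSE ↔ m ∉ 𝓜.TRUE := by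
  constructor
  · intro h h'
    have : m ∈ 𝓜.TRUE ∩ 𝓜.FALSE := ⟨h', h⟩
    rw [𝓜.true_inter_false] at this
    exact this
  · intro h
    have : m ∈ 𝓜.TRUE ∪ 𝓜.FALSE := by rw [𝓜.true_union_false]; trivial
    exact this.resolve_left h

theorem sat_imp (φ ψ : Fm C D) : 𝓜.Sat γ (φ.imp ψ) ↔ (𝓜.Sat γ φ → 𝓜.Sat γ ψ) := by
  rw [Sat, 𝓜.t_imp, 𝓜.mem_false_iff]
  exact imp_iff_not_or.symm

theorem sat_neg (φ : Fm C D) : 𝓜.Sat γ φ.neg ↔ ¬ 𝓜.Sat γ φ := 𝓜.t_neg φ γ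

theorem sat_and (φ ψ : Fm C D) : 𝓜.Sat γ (φ.and ψ) ↔ 𝓜.Sat γ φ ∧ 𝓜.Sat γ ψ := by
  simp only [Fm.and, sat_neg, sat_imp]; tauto

theorem sat_iff (φ ψ : Fm C D) : 𝓜.Sat γ (φ.iff ψ) ↔ (𝓜.Sat γ φ ↔ 𝓜.Sat γ ψ) := by
  simp only [Fm.iff, sat_and, sat_imp]; tauto

theorem sat_conjImp (l : List (Fm C D)) (φ : Fm C D) :
    𝓜.Sat γ (Fm.conjImp l φ) ↔ ((∀ ψ ∈ l, 𝓜.Sat γ ψ) → 𝓜.Sat γ φ) := by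
  have key : ∀ (l : List (Fm C D)) (χ : Fm C D),
      𝓜.Sat γ (Fm.conj χ l) ↔ 𝓜.Sat γ χ ∧ ∀ ψ ∈ l, 𝓜.Sat γ ψ := by
    intro l
    induction l with
    | nil => simp [Fm.conj]
    | cons a l ih => intro χ; simp [Fm.conj, sat_and, ih]
  cases l with
  | nil => simp [Fm.conjImp]
  | cons a l => simp [Fm.conjImp, sat_imp, key]

/-- The normal form is the instance under the identity substitution, and that substitution does not
change the assignment. Alpha-congruent formulas thus have equal denotations without an induction in
the model. -/
theorem gam_nf (φ : Fm C D) : 𝓜.gam φ.nf γ = 𝓜.gam φ γ := by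
  have := 𝓜.sp_fm φ .var .var γ
  simp only [𝓜.ep_P, 𝓜.ep_J] at this
  rw [← this, Fm.subst_ofVars_eq_gs]
  rfl

theorem gam_eq_of_alphaEq {φ ψ : Fm C D} (h : AlphaEq φ ψ) : 𝓜.gam φ γ = 𝓜.gam ψ γ := by
  rw [← 𝓜.gam_nf γ φ, ← 𝓜.gam_nf γ ψ, Fm.nf, h.gs_eq, Fm.nf]

theorem gam_substP (φ : Fm C D) (x : ℕ) (ψ : Fm C D) :
    𝓜.gam (φ.substP x ψ) γ = 𝓜.gam φ (γ.updP x (𝓜.gam ψ γ)) := by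
  refine (𝓜.sp_fm φ (Function.update .var x ψ) .var γ).trans ?_
  congr 1
  ext y
  · by_cases h : y = x
    · subst h; simp [Asg.updP]
    · simp [Asg.updP, h, 𝓜.ep_P]
  · exact 𝓜.ep_J _ _

theorem gam_substJ (φ : Fm C D) (u : ℕ) (t : Tm C) :
    𝓜.gam (φ.substJ u t) γ = 𝓜.gam φ (γ.updJ u (𝓜.gamT t γ)) := by
  refine (𝓜.sp_fm φ .var (Function.update .var u t) γ).trans ?_
  congr 1
  ext y
  · exact 𝓜.ep_P _ _
  · by_cases h : y = u
    · subst h; simp [Asg.updJ]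
    · simp [Asg.updJ, h, 𝓜.ep_J]

theorem gam_updP_of_notMem {φ : Fm C D} {x : ℕ} (h : x ∉ φ.fvarP) (m : 𝓜.M) :
    𝓜.gam φ (γ.updP x m) = 𝓜.gam φ γ := by
  refine 𝓜.cp_fm φ _ _ (fun y hy => ?_) (fun _ _ => rfl)
  exact Function.update_of_ne (ne_of_mem_of_not_mem hy h) _ _

theorem gam_updJ_of_notMem {φ : Fm C D} {u : ℕ} (h : u ∉ φ.fvarJ) (l : 𝓜.L) :
    𝓜.gam φ (γ.updJ u l) = 𝓜.gam φ γ := by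
  refine 𝓜.cp_fm φ _ _ (fun _ _ => rfl) (fun y hy => ?_)
  exact Function.update_of_ne (ne_of_mem_of_not_mem hy h) _ _

theorem sat_just (φ : Fm C D) (t : Tm C) :
    𝓜.Sat γ (φ.just t) ↔ 𝓜.gam φ γ ∈ 𝓜.REASON (𝓜.gamT t γ) := 𝓜.t_just φ t γ

theorem sat_ref (φ ψ : Fm C D) :
    𝓜.Sat γ (φ.ref ψ) ↔ 𝓜.refers (𝓜.gam φ γ) (𝓜.gam ψ γ) := 𝓜.t_ref φ ψ γ

theorem sat_eqv (φ ψ : Fm C D) : 𝓜.Sat γ (φ.eqv ψ) ↔ 𝓜.gam φ γ = 𝓜.gam ψ γ := 𝓜.t_eqv φ ψ γ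

theorem sat_allJ {u : ℕ} {φ : Fm C D} (h : u ∈ φ.fvarJ) :
    𝓜.Sat γ (φ.allJ u h) ↔ ∀ l, 𝓜.Sat (γ.updJ u l) φ := 𝓜.t_allJ u φ h γ

theorem sat_allP {x : ℕ} {φ : Fm C D} (h : x ∈ φ.fvarP) :
    𝓜.Sat γ (φ.allP x h) ↔ ∀ m, 𝓜.Sat (γ.updP x m) φ := 𝓜.t_allP x φ h γ

theorem sat_exJ {u : ℕ} {φ : Fm C D} (h : u ∈ φ.fvarJ) :
    𝓜.Sat γ (φ.exJ u h) ↔ ∃ l, 𝓜.Sat (γ.updJ u l) φ := by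
  refine (𝓜.sat_neg γ _).trans ((not_congr (𝓜.sat_allJ γ (φ := φ.neg) h)).trans ?_)
  simp only [sat_neg, not_forall, not_not]

theorem sat_exP {x : ℕ} {φ : Fm C D} (h : x ∈ φ.fvarP) :
    𝓜.Sat γ (φ.exP x h) ↔ ∃ m, 𝓜.Sat (γ.updP x m) φ := by
  refine (𝓜.sat_neg γ _).trans ((not_congr (𝓜.sat_allP γ (φ := φ.neg) h)).trans ?_)
  simp only [sat_neg, not_forall, not_not]

theorem sat_substJ (φ : Fm C D) (u : ℕ) (t : Tm C) :
    𝓜.Sat γ (φ.substJ u t) ↔ 𝓜.Sat (γ.updJ u (𝓜.gamT t γ)) φ := by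
  rw [Sat, gam_substJ, Sat]

theorem sat_substP (φ : Fm C D) (x : ℕ) (ψ : Fm C D) :
    𝓜.Sat γ (φ.substP x ψ) ↔ 𝓜.Sat (γ.updP x (𝓜.gam ψ γ)) φ := by
  rw [Sat, gam_substP, Sat]

theorem sat_schema {χ : Fm C D} (h : Schema χ) : 𝓜.Sat γ χ := by
  cases h with
  | taut h => exact h (𝓜.Sat γ) (𝓜.sat_imp γ) (𝓜.sat_neg γ)
  | tarski_true φ => exact (𝓜.sat_iff γ _ _).mpr (𝓜.t_isTrue φ γ)
  | tarski_false φ =>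
    rw [sat_iff, sat_neg, Sat, 𝓜.t_isFalse, 𝓜.mem_false_iff]
    rfl
  | application φ ψ s t =>
    simp only [sat_imp, sat_just]
    exact 𝓜.t_app φ ψ s t γ
  | weakening_left φ s t =>
    simp only [sat_imp, sat_just]
    exact fun h => 𝓜.t_plus φ s t γ (.inl h)
  | weakening_right φ s t =>
    simp only [sat_imp, sat_just]
    exact fun h => 𝓜.t_plus φ s t γ (.inr h)
  | necessity φ u hu =>
    refine (𝓜.sat_iff γ _ _).mpr ((𝓜.t_box φ γ).trans (Iff.trans ?_ (𝓜.sat_exJ γ _).symm))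
    rw [𝓜.necessary_eq, Set.mem_iUnion]
    refine exists_congr fun l => ?_
    rw [sat_just, 𝓜.ep_J, 𝓜.gam_updJ_of_notMem γ hu]
    simp [Asg.updJ]
  | box_elim φ =>
    exact (𝓜.sat_imp γ _ _).mpr fun h => 𝓜.necessary_subset ((𝓜.t_box φ γ).mp h)
  | ref_of_synRef h => exact (𝓜.t_ref _ _ γ).mpr (𝓜.rp _ _ γ h)
  | ref_trans φ ψ χ =>
    simp only [sat_imp, sat_ref]
    exact 𝓜.refers_trans _ _ _
  | eqv_of_alphaEq h => exact (𝓜.t_eqv _ _ γ).mpr (𝓜.gam_eq_of_alphaEq γ h)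
  | eqv_elim φ ψ =>
    simp only [sat_imp, sat_eqv]
    intro h h'
    rwa [Sat, ← h]
  | subst_fm p p' j j' φ =>
    rw [sat_conjImp]
    intro hl
    simp only [Fm.substEqs, List.mem_map, List.mem_append, Finset.mem_sort] at hl
    rw [Sat, 𝓜.t_eqv, 𝓜.sp_fm, 𝓜.sp_fm]
    refine 𝓜.cp_fm φ _ _ (fun x hx => ?_) (fun u hu => ?_)
    · exact (𝓜.t_eqv _ _ γ).mp (hl _ (.inl ⟨x, hx, rfl⟩))
    · exact (𝓜.t_teq _ _ γ).mp (hl _ (.inr ⟨u, hu, rfl⟩))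
  | exJ_intro u φ t h =>
    rw [sat_imp, sat_substJ]
    exact fun h' => (𝓜.sat_exJ γ h).mpr ⟨_, h'⟩
  | allJ_elim u φ t h =>
    rw [sat_imp, sat_substJ]
    exact fun h' => (𝓜.sat_allJ γ h).mp h' _
  | allJ_dist u ψ φ hψ hφ =>
    rw [sat_imp, sat_imp]
    exact fun h1 h2 => (𝓜.sat_allJ γ hφ).mpr fun a => (𝓜.sat_imp _ _ _).mp
      ((𝓜.sat_allJ γ _).mp h1 a) ((𝓜.sat_allJ γ hψ).mp h2 a)
  | allJ_shift u ψ φ hψ hφ =>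
    rw [sat_imp, sat_imp]
    refine fun h1 h2 => (𝓜.sat_allJ γ hφ).mpr fun a => (𝓜.sat_imp _ _ _).mp
      ((𝓜.sat_allJ γ _).mp h1 a) ?_
    rwa [Sat, 𝓜.gam_updJ_of_notMem γ hψ]
  | exP_intro x φ ψ h =>
    rw [sat_imp, sat_substP]
    exact fun h' => (𝓜.sat_exP γ h).mpr ⟨_, h'⟩
  | allP_elim x φ ψ h =>
    rw [sat_imp, sat_substP]
    exact fun h' => (𝓜.sat_allP γ h).mp h' _
  | allP_dist x ψ φ hψ hφ =>
    rw [sat_imp, sat_imp]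
    exact fun h1 h2 => (𝓜.sat_allP γ hφ).mpr fun a => (𝓜.sat_imp _ _ _).mp
      ((𝓜.sat_allP γ _).mp h1 a) ((𝓜.sat_allP γ hψ).mp h2 a)
  | allP_shift x ψ φ hψ hφ =>
    rw [sat_imp, sat_imp]
    refine fun h1 h2 => (𝓜.sat_allP γ hφ).mpr fun a => (𝓜.sat_imp _ _ _).mp
      ((𝓜.sat_allP γ _).mp h1 a) ?_
    rwa [Sat, 𝓜.gam_updP_of_notMem γ hψ]
  | le_iff x s t =>
    refine (𝓜.sat_iff γ _ _).mpr ((𝓜.t_tle s t γ).trans (Iff.trans ?_ (𝓜.sat_allP γ _).symm))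
    -- Because the order is inclusion of reasons and the propositional quantifier ranges over all of
    -- `M`, the two sides match element by element.
    rw [𝓜.le_iff, Set.subset_def]
    refine forall_congr' fun m => ?_
    have hs : ∀ s : Tm C, 𝓜.gamT s (γ.updP x m) = 𝓜.gamT s γ := fun s =>
      𝓜.cp_tm s _ _ fun _ _ => rfl
    rw [sat_imp, sat_just, sat_just, hs, hs, 𝓜.ep_P]
    simp [Asg.updP]
  | extensionality s t =>
    let := 𝓜.order
    rw [sat_iff, sat_and]
    simp only [Sat, 𝓜.t_teq, 𝓜.t_tle]
    exact le_antisymm_iff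
  | subst_tm p p' j j' t =>
    rw [sat_conjImp]
    intro hl
    simp only [Tm.substEqs, List.mem_map, Finset.mem_sort] at hl
    rw [Sat, 𝓜.t_teq, 𝓜.sp_tm, 𝓜.sp_tm]
    exact 𝓜.cp_tm t _ _ (fun u hu => (𝓜.t_teq _ _ γ).mp (hl _ ⟨u, hu, rfl⟩))

theorem sat_axFour (h4 : 𝓜.CondFour) {χ : Fm C D} (h : χ ∈ AxFour C D) : 𝓜.Sat γ χ := by
  induction h generalizing γ with
  | base h =>
    rcases h with h | ⟨φ, rfl⟩
    · exact 𝓜.sat_schema γ h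
    · exact (𝓜.sat_imp γ _ _).mpr (h4 φ γ)
  | allJ u h _ ih => exact (𝓜.t_allJ _ _ _ _).mpr fun l => ih _
  | allP x h _ ih => exact (𝓜.t_allP _ _ _ _).mpr fun m => ih _

end Model

/-! ### The two directions of the completeness theorem -/

theorem DerivesFour.consequence {Φ : Set (Fm C D)} {φ : Fm C D} (h : DerivesFour Φ φ) :
    ConsequenceFour.{u, v, w} Φ φ := by
  intro 𝓜 h4 γ hΦ
  induction h with
  | ax h => exact 𝓜.sat_axFour γ h4 h
  | hyp h => exact hΦ _ h
  | mp _ _ ih₁ ih₂ => exact (𝓜.sat_imp γ _ _).mp ih₁ ih₂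

/-- The canonical model of a theory with witnesses omitting `φ`, under the assignment of each
variable to its own class, is a countermodel. The universe of the models has to accommodate formulas
over `C` and `D`. -/
theorem ConsequenceFour.derives {Φ : Set (Fm C D)} {φ : Fm C D}
    (h : ConsequenceFour.{u, v, max u v w} Φ φ) : DerivesFour Φ φ := by
  by_contra hn
  obtain ⟨T, hT, hΦ, hφ⟩ := exists_henkin hn
  obtain ⟨K⟩ : Nonempty (Carrier.{max u v w} T) := Complete.exists_carrier.{w} hT.toComplete
  exact hφ ((K.model_sat_iff hT φ).mp (h (K.model hT) (K.model_condFour hT) _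
    fun ψ hψ => (K.model_sat_iff hT ψ).mpr (hΦ ψ hψ)))

end

end EpsJ

theorem corollary680 {C : Type u} {D : Type v}
    (Φ : Set (EpsJ.Fm C D)) (φ : EpsJ.Fm C D) :
    EpsJ.ConsequenceFour.{u, v, max u v w} Φ φ ↔ EpsJ.DerivesFour Φ φ :=
  ⟨fun h => EpsJ.ConsequenceFour.derives.{u, v, w} h, fun h => h.consequence⟩
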